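/- Let $D\ge 2$ be even, let $V_0$ be a real polynomial of degree $D$ with positive leading coefficient, and put $V(z,t)=V_0(z)+tz$ for $t\in\mathbb R$. Let $C_k=e^{2\pi i k/D}[0,\infty)$ for $k=0,\dots,D-1$, with $C_0$ oriented away from the origin and $C_1,\dots,C_{D-1}$ oriented towards it, and put $\Gamma_k=C_0\cup C_k$ and $\Gamma=\bigcup_{k=1}^{D-1}\Gamma_k$. For $n\ge 0$ and $t\in\mathbb R$ consider the following problem: find $A_n(\cdot,t):\mathbb C\setminus\Gamma\to\mathcal M_{D+1}(\mathbb C)$ that is analytic, is bounded near $0$, extends continuously to $\Gamma\setminus\{0\}$ from the left ($+$) and from the right ($-$), and satisfies $A_n^+=A_n^-J$ on $\Gamma\setminus\{0\}$ and $$A_n(z,t)=(\mathbb I+\mathcal O(z^{-1}))\,\mathrm{diag}(z^{2n+D-1},z^{-2n},z^{-1},\dots,z^{-1})\qquad(z\to\infty),$$ where $J$ is the identity matrix with its first row replaced by $(1,\ e^{-2V}\chi_{\mathbb R},\ e^{-V}\chi_{\Gamma_1},\dots,e^{-V}\chi_{\Gamma_{D-1}})$. Then for all $n,t$ this problem has exactly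 one solution $A_n$, and the following holds. Let $\widehat{A_n}=A_n^{-\mathsf T}$, $E_1=\mathrm{diag}(1,0,\dots,0)$, $E_2=\mathrm{diag}(0,1,0,\dots,0)$, $\sigma=E_1-E_2$ and $\breve A_n(z,t)=\widehat{A_n}(z,t)e^{V(z,t)\sigma}$. Then $\breve A_n$ has continuous boundary values from both sides on $\Gamma\setminus\{0\}$, and $\breve A_n^+=\breve A_n^-K$ there, where $K$ is the identity matrix with its first column replaced by $(1,-\chi_{\mathbb R},-\chi_{\Gamma_1},\dots,-\chi_{\Gamma_{D-1}})^{\mathsf T}$. There is an expansion $$\widehat{A_n}(z,t)=\left(\mathbb I+z^{-1}A^{(1)}_n(t)+z^{-2}A^{(2)}_n(t)+\mathcal O(z^{-3})\right)\mathrm{diag}(z^{-2n-D+1},z^{2n},z,\dots,z)\qquad(z\to\infty).$$ With $$\rho(z,t,n)=z^2E_2+z\left(A^{(1)}_{n+1}E_2-E_2A^{(1)}_n\right)+\mathbb I-E_1-E_2+A^{(2)}_{n+1}E_2+E_2\left((A^{(1)}_n)^2-A^{(2)}_n\right)-A^{(1)}_{n+1}E_2A^{(1)}_n$$ and $\lambda(z,t,n)=z\sigma+[A^{(1)}_n,\sigma]$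 one has, for $n\ge0$, $t\in\mathbb R$ and $z\in\mathbb C\setminus\Gamma$, the Lax pair $$\breve A_{n+1}=\rho(z,t,n)\breve A_n,\qquad \partial_t\breve A_n=\lambda(z,t,n)\breve A_n,$$ and the compatibility condition $\partial_t\rho(z,t,n)+\rho(z,t,n)\lambda(z,t,n)-\lambda(z,t,n+1)\rho(z,t,n)=0$ for all $z\in\mathbb C$. Write $a^{(m)}_{ij}(n)=A^{(m)}_n(t)_{ij}$ and $b_i(n)=\sum_{k=3}^{D+1}a^{(1)}_{2k}(n)a^{(1)}_{ki}(n)$. For all $n\ge 0$, $t\in\mathbb R$ and $i=3,\dots,D+1$ the following derivatives exist and $a^{(2)}_{12}(n+1)\ne 0$: \begin{align*} \tfrac{d}{dt}a^{(1)}_{22}(n)&=\sum_{k=3}^{D+1}a^{(1)}_{2k}(n)a^{(1)}_{k2}(n),\qquad \tfrac{d}{dt}a^{(1)}_{2i}(n)=b_i(n),\\ \tfrac{d}{dt}a^{(1)}_{i2}(n)&=a^{(2)}_{i2}(n)-a^{(1)}_{i2}(n)a^{(1)}_{22}(n),\qquad \tfrac{d}{dt}a^{(2)}_{22}(n)=\sum_{k=3}^{D+1}a^{(1)}_{2k}(n)a^{(2)}_{k2}(n),\\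 \tfrac{d}{dt}\ln a^{(2)}_{12}(n+1)&=2a^{(1)}_{22}(n)-\sum_{j=3}^{D+1}a^{(1)}_{2j}(n)a^{(2)}_{j2}(n+1),\\ \tfrac{d}{dt}a^{(2)}_{i2}(n+1)&=a^{(2)}_{i2}(n+1)a^{(1)}_{22}(n)+a^{(1)}_{i2}(n+1)a^{(2)}_{22}(n)+a^{(1)}_{i2}(n)-a^{(1)}_{i2}(n+1)a^{(2)}_{22}(n+1)\\ &\quad+a^{(1)}_{i2}(n+2)\frac{a^{(2)}_{12}(n+1)}{a^{(2)}_{12}(n+2)}-a^{(1)}_{i2}(n+1)a^{(1)}_{22}(n)^2-a^{(1)}_{i2}(n+1)\sum_{k=3}^{D+1}a^{(1)}_{2k}(n)a^{(1)}_{k2}(n), \end{align*} and for $n\ge1$ \begin{align*} \tfrac{d}{dt}b_i(n)&=\frac{a^{(2)}_{12}(n)}{a^{(2)}_{12}(n+1)}a^{(1)}_{2i}(n-1)+a^{(1)}_{22}(n+1)a^{(1)}_{22}(n)a^{(1)}_{2i}(n)+a^{(1)}_{2i}(n+1)-a^{(2)}_{22}(n+1)a^{(1)}_{2i}(n)+a^{(2)}_{22}(n)a^{(1)}_{2i}(n)\\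 &\quad-a^{(1)}_{2i}(n)a^{(1)}_{22}(n)^2-a^{(1)}_{22}(n)b_i(n)-2a^{(1)}_{2i}(n)\sum_{k=3}^{D+1}a^{(1)}_{2k}(n)a^{(1)}_{k2}(n)+a^{(1)}_{22}(n+1)b_i(n). \end{align*} Here $\frac{d}{dt}\ln f$ means $f'/f$. Moreover, for all $n\ge 0$, $$\sum_{j=3}^{D+1}a^{(1)}_{2j}(n)a^{(1)}_{j2}(n+1)=2,$$ and at $n=0$, for all $t\in\mathbb R$ and $i=3,\dots,D+1$, $a^{(1)}_{22}(0)=a^{(1)}_{i2}(0)=a^{(2)}_{22}(0)=a^{(2)}_{12}(0)=a^{(2)}_{i2}(0)=0$. -/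

import Mathlib

noncomputable section

namespace SkewToda

open Complex Filter Topology Polynomial Asymptotics

/-- The index set `{1, …, D+1}` of the matrices, split as `{1, 2} ∪ {3, …, D+1}`:
`inl 0` is the index `1`, `inl 1` is the index `2`, and `inr j` is the index `j + 3`
(the one that belongs to the contour `Γ_{j+1}`). -/
abbrev Idx (D : ℕ) : Type := Fin 2 ⊕ Fin (D - 1)

/-- Complex matrices of size `D + 1` (for `D ≥ 1`). -/
abbrev Mat (D : ℕ) : Type := Matrix (Idx D) (Idx D) ℂ

/-! ### Contours -/

/-- The ray `C_k = e^{2πik/D} [0, ∞)`. -/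
def ray (D k : ℕ) : Set ℂ :=
  {z | ∃ r : ℝ, 0 ≤ r ∧ z = r * exp (2 * Real.pi * I * k / D)}

/-- The contour `Γ_k = C_0 ∪ C_k`. -/
def gammaK (D k : ℕ) : Set ℂ := ray D 0 ∪ ray D k

/-- The contour `Γ = Γ_1 ∪ … ∪ Γ_{D-1}`. -/
def gamma (D : ℕ) : Set ℂ := ⋃ j : Fin (D - 1), gammaK D ((j : ℕ) + 1)

/-- The real line in `ℂ`. -/
def realLine : Set ℂ := {z | z.im = 0}

open Classical in
/-- A vector tangent to `Γ` at `x ∈ Γ \ {0}` in the direction of the orientation: `C_0` is oriented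
away from the origin, the other rays are oriented towards the origin. -/
def tangent (D : ℕ) (x : ℂ) : ℂ := if x ∈ ray D 0 then x else -x

/-- The half-plane to the left of the tangent line at `x`, which near `x` is the `+` side. -/
def leftSide (D : ℕ) (x : ℂ) : Set ℂ := {z | 0 < ((z - x) / tangent D x).im}

/-- The half-plane to the right of the tangent line at `x`, which near `x` is the `-` side. -/
def rightSide (D : ℕ) (x : ℂ) : Set ℂ := {z | ((z - x) / tangent D x).im < 0}

/-- `F` has continuous boundary values `F⁺`, `F⁻` on the two sides of `Γ \ {0}`, and
`F⁺ = F⁻ J` on `Γ \ {0}`. -/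
def HasJump (D : ℕ) (F J : ℂ → Mat D) : Prop :=
  ∃ Fp Fm : ℂ → Mat D,
    ContinuousOn Fp (gamma D \ {0}) ∧ ContinuousOn Fm (gamma D \ {0}) ∧
    ∀ x ∈ gamma D \ {0},
      Tendsto F (𝓝[leftSide D x] x) (𝓝 (Fp x)) ∧
      Tendsto F (𝓝[rightSide D x] x) (𝓝 (Fm x)) ∧
      Fp x = Fm x * J x

/-! ### The even Riemann-Hilbert problem -/

/-- The first row of the jump matrix, without its diagonal entry:
`(0, e^{-2V} χ_ℝ, e^{-V} χ_{Γ_1}, …, e^{-V} χ_{Γ_{D-1}})`. -/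
def jumpRow (D : ℕ) (V : ℝ[X]) (x : ℂ) : Idx D → ℂ :=
  Sum.elim
    ![0, realLine.indicator (fun y => exp (-2 * aeval y V)) x]
    (fun j => (gammaK D ((j : ℕ) + 1)).indicator (fun y => exp (-aeval y V)) x)

/-- The jump matrix: the identity plus `jumpRow` in the first row. -/
def jumpMatrix (D : ℕ) (V : ℝ[X]) (x : ℂ) : Mat D :=
  1 + Matrix.vecMulVec (Pi.single (Sum.inl 0) 1) (jumpRow D V x)

/-- The exponents `(2n + D - 1, -2n, -1, …, -1)` of the normalisation at infinity. -/
def expo (D n : ℕ) : Idx D → ℤ :=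
  Sum.elim ![2 * (n : ℤ) + (D : ℤ) - 1, -(2 * (n : ℤ))] (fun _ => -1)

/-- The filter `z → ∞`, `z ∈ ℂ \ Γ`. -/
def atInf (D : ℕ) : Filter ℂ := Bornology.cobounded ℂ ⊓ 𝓟 (gamma D)ᶜ

/-- `A` solves the even Riemann-Hilbert problem with parameter `n` for the potential `V`.
The values of `A` on `Γ` are irrelevant. -/
structure IsEvenSolution (D : ℕ) (V : ℝ[X]) (n : ℕ) (A : ℂ → Mat D) : Prop where
  analytic : ∀ i j, DifferentiableOn ℂ (fun z => A z i j) (gamma D)ᶜ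
  jump : HasJump D A (jumpMatrix D V)
  bounded : ∀ i j, ∃ M : ℝ, ∀ᶠ z in 𝓝[(gamma D)ᶜ] 0, ‖A z i j‖ ≤ M
  /-- `A(z) = (1 + O(z⁻¹)) diag(z^{2n+D-1}, z^{-2n}, z⁻¹, …, z⁻¹)`. -/
  normalised : ∀ i j,
    (fun z => (A z * Matrix.diagonal (fun k => z ^ (-expo D n k)) - 1) i j)
      =O[atInf D] (fun z => z⁻¹)

/-! ### The deformation, the dual problem and its expansion -/

/-- The deformed potential `V(z,t) = V₀(z) + t z`. -/
def deform (V₀ : ℝ[X]) (t : ℝ) : ℝ[X] := V₀ + C t * X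

/-- The inverse transpose `Â = A^{-T}`. -/
def hat {D : ℕ} (A : ℂ → Mat D) (z : ℂ) : Mat D := ((A z)⁻¹).transpose

/-- `Â(z) = (1 + z⁻¹ a₁ + z⁻² a₂ + O(z⁻³)) diag(z^{-2n-D+1}, z^{2n}, z, …, z)` as `z → ∞`. -/
def HasExpansion (D n : ℕ) (Ahat : ℂ → Mat D) (a₁ a₂ : Mat D) : Prop :=
  ∀ i j,
    (fun z => (Ahat z * Matrix.diagonal (fun k => z ^ expo D n k)
        - (1 + z⁻¹ • a₁ + (z ^ 2)⁻¹ • a₂)) i j)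
      =O[atInf D] (fun z => (z ^ 3)⁻¹)

/-- `E_1 = diag(1, 0, …, 0)`. -/
def E1 (D : ℕ) : Mat D := Matrix.diagonal (Pi.single (Sum.inl 0) 1)

/-- `E_2 = diag(0, 1, 0, …, 0)`. -/
def E2 (D : ℕ) : Mat D := Matrix.diagonal (Pi.single (Sum.inl 1) 1)

/-- `σ = E_1 - E_2`. -/
def sigma (D : ℕ) : Mat D := E1 D - E2 D

/-- The transform `Â(z) e^{V(z) σ}`, where `e^{V σ} = diag(e^V, e^{-V}, 1, …, 1)`. -/
def breve {D : ℕ} (V : ℝ[X]) (A : ℂ → Mat D) (z : ℂ) : Mat D :=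
  hat A z *
    Matrix.diagonal (Sum.elim ![exp (aeval z V), exp (-aeval z V)] (fun _ => 1))

/-- The column `(0, χ_ℝ, χ_{Γ_1}, …, χ_{Γ_{D-1}})ᵀ`. -/
def constCol (D : ℕ) (x : ℂ) : Idx D → ℂ :=
  Sum.elim
    ![0, realLine.indicator (fun _ => 1) x]
    (fun j => (gammaK D ((j : ℕ) + 1)).indicator (fun _ => 1) x)

/-- The jump matrix of the transformed problem, independent of `n` and `t`: the identity minus
`constCol` in the first column. -/
def constJump (D : ℕ) (x : ℂ) : Mat D :=
  1 - Matrix.vecMulVec (constCol D x) (Pi.single (Sum.inl 0) 1)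

/-! ### The Lax pair -/

section Lax

variable {D : ℕ} (a₁ a₂ : ℕ → ℝ → Mat D)

def rho1 (n : ℕ) (t : ℝ) : Mat D := a₁ (n + 1) t * E2 D - E2 D * a₁ n t

def rho2 (n : ℕ) (t : ℝ) : Mat D :=
  1 - E1 D - E2 D + a₂ (n + 1) t * E2 D + E2 D * (a₁ n t ^ 2 - a₂ n t)
    - a₁ (n + 1) t * E2 D * a₁ n t

/-- `ρ(z,t,n) = z² E_2 + z ρ_n^{(1)}(t) + ρ_n^{(2)}(t)`. -/
def rho (z : ℂ) (t : ℝ) (n : ℕ) : Mat D :=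
  z ^ 2 • E2 D + z • rho1 a₁ n t + rho2 a₁ a₂ n t

/-- `λ(z,t,n) = z σ + [A_n^{(1)}(t), σ]`. -/
def lam (z : ℂ) (t : ℝ) (n : ℕ) : Mat D :=
  z • sigma D + (a₁ n t * sigma D - sigma D * a₁ n t)

/-- The Lax pair for the matrices `F n t z`: the linear equation in `n`, the linear equation
in `t`, and the compatibility condition of the two. -/
structure IsLaxPair (F : ℕ → ℝ → ℂ → Mat D) : Prop where
  shift : ∀ n t, ∀ z ∈ (gamma D)ᶜ, F (n + 1) t z = rho a₁ a₂ z t n * F n t z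
  flow : ∀ n t, ∀ z ∈ (gamma D)ᶜ, ∀ i j,
    HasDerivAt (fun s => F n s z i j) ((lam a₁ z t n * F n t z) i j) t
  /-- `∂ρ/∂t + ρ(n) λ(n) - λ(n+1) ρ(n) = 0` for all `z`. -/
  compat : ∀ n t z i j,
    HasDerivAt (fun s => rho a₁ a₂ z s n i j)
      ((lam a₁ z t (n + 1) * rho a₁ a₂ z t n - rho a₁ a₂ z t n * lam a₁ z t n) i j) t

/-- `b_j(n,t) = ∑_{k=3}^{D+1} a^{(1)}_{2k}(n,t) a^{(1)}_{kj}(n,t)`. -/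
def bvar (n : ℕ) (t : ℝ) (j : Fin (D - 1)) : ℂ :=
  ∑ k : Fin (D - 1), a₁ n t (.inl 1) (.inr k) * a₁ n t (.inr k) (.inr j)

/-- The dynamical system for the expansion coefficients, with its constraint and its
initial data at `n = 0`. All sums run over the indices `3, …, D+1`. -/
structure IsTodaSystem : Prop where
  d_a1_22 : ∀ n t,
    HasDerivAt (fun s => a₁ n s (.inl 1) (.inl 1))
      (∑ k : Fin (D - 1), a₁ n t (.inl 1) (.inr k) * a₁ n t (.inr k) (.inl 1)) t
  d_a1_2i : ∀ n t i,
    HasDerivAt (fun s => a₁ n s (.inl 1) (.inr i)) (bvar a₁ n t i) t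
  d_a1_i2 : ∀ n t i,
    HasDerivAt (fun s => a₁ n s (.inr i) (.inl 1))
      (a₂ n t (.inr i) (.inl 1) - a₁ n t (.inr i) (.inl 1) * a₁ n t (.inl 1) (.inl 1)) t
  d_a2_22 : ∀ n t,
    HasDerivAt (fun s => a₂ n s (.inl 1) (.inl 1))
      (∑ k : Fin (D - 1), a₁ n t (.inl 1) (.inr k) * a₂ n t (.inr k) (.inl 1)) t
  a2_12_ne_zero : ∀ n t, a₂ (n + 1) t (.inl 0) (.inl 1) ≠ 0
  /-- The equation for the logarithmic derivative of `a^{(2)}_{12}(n+1)`, multiplied by the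
  nonzero function `a^{(2)}_{12}(n+1)`. -/
  d_a2_12 : ∀ n t,
    HasDerivAt (fun s => a₂ (n + 1) s (.inl 0) (.inl 1))
      (a₂ (n + 1) t (.inl 0) (.inl 1) *
        (2 * a₁ n t (.inl 1) (.inl 1)
          - ∑ j : Fin (D - 1), a₁ n t (.inl 1) (.inr j) * a₂ (n + 1) t (.inr j) (.inl 1))) t
  d_a2_i2 : ∀ n t i,
    HasDerivAt (fun s => a₂ (n + 1) s (.inr i) (.inl 1))
      (a₂ (n + 1) t (.inr i) (.inl 1) * a₁ n t (.inl 1) (.inl 1)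
        + a₁ (n + 1) t (.inr i) (.inl 1) * a₂ n t (.inl 1) (.inl 1)
        + a₁ n t (.inr i) (.inl 1)
        - a₁ (n + 1) t (.inr i) (.inl 1) * a₂ (n + 1) t (.inl 1) (.inl 1)
        + a₁ (n + 2) t (.inr i) (.inl 1)
          * (a₂ (n + 1) t (.inl 0) (.inl 1) / a₂ (n + 2) t (.inl 0) (.inl 1))
        - a₁ (n + 1) t (.inr i) (.inl 1) * a₁ n t (.inl 1) (.inl 1) ^ 2
        - a₁ (n + 1) t (.inr i) (.inl 1)
          * ∑ k : Fin (D - 1), a₁ n t (.inl 1) (.inr k) * a₁ n t (.inr k) (.inl 1)) t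
  d_b : ∀ n t i, 1 ≤ n →
    HasDerivAt (fun s => bvar a₁ n s i)
      (a₂ n t (.inl 0) (.inl 1) / a₂ (n + 1) t (.inl 0) (.inl 1)
          * a₁ (n - 1) t (.inl 1) (.inr i)
        + a₁ (n + 1) t (.inl 1) (.inl 1) * a₁ n t (.inl 1) (.inl 1) * a₁ n t (.inl 1) (.inr i)
        + a₁ (n + 1) t (.inl 1) (.inr i)
        - a₂ (n + 1) t (.inl 1) (.inl 1) * a₁ n t (.inl 1) (.inr i)
        + a₂ n t (.inl 1) (.inl 1) * a₁ n t (.inl 1) (.inr i)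
        - a₁ n t (.inl 1) (.inr i) * a₁ n t (.inl 1) (.inl 1) ^ 2
        - a₁ n t (.inl 1) (.inl 1) * bvar a₁ n t i
        - 2 * a₁ n t (.inl 1) (.inr i)
          * ∑ k : Fin (D - 1), a₁ n t (.inl 1) (.inr k) * a₁ n t (.inr k) (.inl 1)
        + a₁ (n + 1) t (.inl 1) (.inl 1) * bvar a₁ n t i) t
  constraint : ∀ n t,
    ∑ j : Fin (D - 1), a₁ n t (.inl 1) (.inr j) * a₁ (n + 1) t (.inr j) (.inl 1) = 2
  init_a1_22 : ∀ t, a₁ 0 t (.inl 1) (.inl 1) = 0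
  init_a1_i2 : ∀ t i, a₁ 0 t (.inr i) (.inl 1) = 0
  init_a2_22 : ∀ t, a₂ 0 t (.inl 1) (.inl 1) = 0
  init_a2_12 : ∀ t, a₂ 0 t (.inl 0) (.inl 1) = 0
  init_a2_i2 : ∀ t i, a₂ 0 t (.inr i) (.inl 1) = 0

end Lax

end SkewToda

end

noncomputable section

namespace SkewToda

open Complex Filter Topology Polynomial Asymptotics MeasureTheory

/-! ### Geometry of the contour -/

/-! Existence is linear algebra on polynomials. By the Plemelj formula, a row with the prescribed
jump can be built from a polynomial `p`, its Cauchy transform over the real line with weight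
`e^{-2V}`, and its Cauchy transforms over the `Γ_j` with weight `e^{-V}` (`rowOf`). The
normalisation at infinity then prescribes `2n` moments of `p` over the line and `D - 1` moments over
the `Γ_j`, for equally many free coefficients. The homogeneous system has only the zero solution
(`eq_zero_of_all_moments`). Indeed, the `D - 1` functionals over the `Γ_j` are independent in degree
below `D - 1` (`moments_independent`): moving the potential to its leading monomial, where a
Vandermonde matrix decides, does not change this. A `p` with vanishing `Γ_j`-moments is therefore
exact, `p = q' - V'q` (`exists_eq_twist`). The remaining conditions then put `q` in the kernel of
the skew form `∫ (q' - V'q) s e^{-2V}`, which is nondegenerate in degree below `2n`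
(`skew_nondegenerate`). Cramer's rule makes the solution differentiable in `t` (`exists_trialPoly`).

The other analytic statements come from Liouville's theorem across `Γ` (`eq_zero_of_no_jump`). If
`A` and `B` have the same jump and `det A = 1`, then `B A⁻¹` has no jump and equals the polynomial
part of its expansion at infinity (`mul_adjugate_eq_of_tendsto`). With `B` a second solution this is
uniqueness; with `A_n` and `A_{n+1}` it produces `ρ`; with `B = ∂_t A - z A σ`, which has the same
jump as `A`, it produces `λ`. Differentiating the shift equation in `t` gives compatibility off `Γ`,
and density gives it everywhere.

The dynamical system consists of entries of the flow and of the compatibility condition. It closes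
because of three facts: skew-symmetry annihilates the entries `(1,2)` and `(2,1)` of `A^{(1)}`; the
rows of `A⁻¹` with index at least `3` have no jump, hence are linear in `z`, so the corresponding
columns of `A^{(2)}` vanish; and `a^{(2)}_{12}(n+1) a^{(2)}_{21}(n) = 1`. Entries of `ρ` that vanish
identically turn their compatibility equations into algebraic identities, which yield the constraint
and eliminate the first row and column of `A^{(1)}`. -/

/-- The direction `e^{2πik/D}` of the ray `C_k`. -/
def rt (D k : ℕ) : ℂ := exp (2 * Real.pi * I * k / D)

lemma rt_ne_zero (D k : ℕ) : rt D k ≠ 0 := exp_ne_zero _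

lemma rt_zero (D : ℕ) : rt D 0 = 1 := by simp [rt]

lemma norm_rt (D k : ℕ) : ‖rt D k‖ = 1 := by
  have : (2 * Real.pi * I * k / D : ℂ) = ((2 * Real.pi * k / D : ℝ) : ℂ) * I := by
    push_cast; ring
  rw [rt, this, norm_exp_ofReal_mul_I]

lemma rt_pow_self {D : ℕ} (hD : D ≠ 0) (k : ℕ) : rt D k ^ D = 1 := by
  have h : (D : ℂ) ≠ 0 := by exact_mod_cast hD
  rw [rt, ← exp_nat_mul, mul_div_cancel₀ _ h, exp_eq_one_iff]
  exact ⟨k, by push_cast; ring⟩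

lemma mem_ray_iff {D k : ℕ} {z : ℂ} :
    z ∈ ray D k ↔ (z / rt D k).im = 0 ∧ 0 ≤ (z / rt D k).re := by
  constructor
  · rintro ⟨r, hr, rfl⟩
    change (_ * rt D k / rt D k).im = 0 ∧ 0 ≤ (_ * rt D k / rt D k).re
    rw [mul_div_cancel_right₀ _ (rt_ne_zero D k)]
    exact ⟨ofReal_im r, by simpa using hr⟩
  · rintro ⟨h1, h2⟩
    refine ⟨(z / rt D k).re, h2, ?_⟩
    have : ((z / rt D k).re : ℂ) = z / rt D k := Complex.ext rfl (by simp [h1])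
    rw [this]
    exact (div_mul_cancel₀ z (rt_ne_zero D k)).symm

lemma isClosed_ray (D k : ℕ) : IsClosed (ray D k) := by
  have : ray D k = {z | (z / rt D k).im = 0} ∩ {z | 0 ≤ (z / rt D k).re} := by
    ext z; exact mem_ray_iff
  rw [this]
  exact (isClosed_eq (by fun_prop) continuous_const).inter
    (isClosed_le continuous_const (by fun_prop))

lemma ray_eq_of_mem {D k : ℕ} {x : ℂ} (hx : x ≠ 0) (h : x ∈ ray D k) :
    ray D k = {y | (y / x).im = 0 ∧ 0 ≤ (y / x).re} := by
  obtain ⟨r, hr, hxr⟩ := h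
  change x = r * rt D k at hxr
  have hr0 : 0 < r := by
    rcases hr.lt_or_eq with h | h
    · exact h
    · exact absurd (by rw [hxr, ← h]; simp) hx
  ext y
  have : y / rt D k = r * (y / x) := by
    rw [hxr]
    have := rt_ne_zero D k
    have : (r : ℂ) ≠ 0 := by exact_mod_cast hr0.ne'
    field_simp
  rw [mem_ray_iff, this, Set.mem_ofPred_eq, re_ofReal_mul, im_ofReal_mul]
  constructor
  · rintro ⟨h1, h2⟩
    exact ⟨(mul_eq_zero.1 h1).resolve_left hr0.ne', nonneg_of_mul_nonneg_right h2 hr0⟩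
  · rintro ⟨h1, h2⟩
    exact ⟨by rw [h1, mul_zero], mul_nonneg hr h2⟩

lemma mem_ray_zero {D : ℕ} {x : ℂ} : x ∈ ray D 0 ↔ x.im = 0 ∧ 0 ≤ x.re := by
  rw [mem_ray_iff, rt_zero, div_one]

lemma mem_gamma_iff {D : ℕ} (hD : 2 ≤ D) {z : ℂ} : z ∈ gamma D ↔ ∃ k < D, z ∈ ray D k := by
  simp only [gamma, gammaK, Set.mem_iUnion, Set.mem_union]
  constructor
  · rintro ⟨j, h | h⟩
    · exact ⟨0, by omega, h⟩
    · exact ⟨j + 1, by omega, h⟩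
  · rintro ⟨k, hk, h⟩
    rcases Nat.eq_zero_or_pos k with rfl | hk0
    · exact ⟨⟨0, by omega⟩, Or.inl h⟩
    · refine ⟨⟨k - 1, by omega⟩, Or.inr ?_⟩
      rwa [show k - 1 + 1 = k by omega]

lemma isClosed_gamma (D : ℕ) : IsClosed (gamma D) :=
  isClosed_iUnion_of_finite fun _ => (isClosed_ray D 0).union (isClosed_ray D _)

lemma isOpen_compl_gamma (D : ℕ) : IsOpen (gamma D)ᶜ := (isClosed_gamma D).isOpen_compl

/-- Near a point `x ≠ 0` of `Γ`, the contour is the line through `0` and `x`. -/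
lemma eventually_mem_gamma_iff {D : ℕ} (hD : 2 ≤ D) {x : ℂ} (hx : x ∈ gamma D \ {0}) :
    ∀ᶠ y in 𝓝 x, (y ∈ gamma D ↔ (y / x).im = 0) ∧ 0 < (y / x).re := by
  obtain ⟨hxg, hx0⟩ := hx
  replace hx0 : x ≠ 0 := hx0
  have h1 : ∀ᶠ y in 𝓝 x, ∀ k ∈ Finset.range D, x ∉ ray D k → y ∉ ray D k := by
    rw [Filter.eventually_all_finset]
    intro k _
    by_cases h : x ∈ ray D k
    · simp [h]
    · filter_upwards [(isClosed_ray D k).isOpen_compl.mem_nhds h] with y hy _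
      exact hy
  have h2 : ∀ᶠ y in 𝓝 x, 0 < (y / x).re := by
    have : ContinuousAt (fun y : ℂ => (y / x).re) x := by fun_prop
    exact this.eventually_const_lt (by simp [div_self hx0])
  filter_upwards [h1, h2] with y hy1 hy2
  refine ⟨⟨fun hy => ?_, fun hy => ?_⟩, hy2⟩
  · obtain ⟨k, hk, hyk⟩ := (mem_gamma_iff hD).1 hy
    have hxk : x ∈ ray D k := by
      by_contra h
      exact hy1 k (Finset.mem_range.2 hk) h hyk
    rw [ray_eq_of_mem hx0 hxk] at hyk
    exact hyk.1
  · obtain ⟨k, hk, hxk⟩ := (mem_gamma_iff hD).1 hxg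
    refine (mem_gamma_iff hD).2 ⟨k, hk, ?_⟩
    rw [ray_eq_of_mem hx0 hxk]
    exact ⟨hy, hy2.le⟩

open Classical in
lemma im_sub_div_tangent {D : ℕ} {x : ℂ} (hx : x ≠ 0) (z : ℂ) :
    ((z - x) / tangent D x).im = if x ∈ ray D 0 then (z / x).im else -(z / x).im := by
  unfold tangent
  split_ifs
  · rw [sub_div, div_self hx, sub_im, one_im, sub_zero]
  · rw [div_neg, sub_div, div_self hx, neg_im, sub_im, one_im, sub_zero]

open Classical in
lemma leftSide_eq {D : ℕ} {x : ℂ} (hx : x ≠ 0) :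
    leftSide D x = {z | 0 < if x ∈ ray D 0 then (z / x).im else -(z / x).im} := by
  ext z; rw [leftSide, Set.mem_ofPred_eq, im_sub_div_tangent hx, Set.mem_ofPred_eq]

open Classical in
lemma rightSide_eq {D : ℕ} {x : ℂ} (hx : x ≠ 0) :
    rightSide D x = {z | (if x ∈ ray D 0 then (z / x).im else -(z / x).im) < 0} := by
  ext z; rw [rightSide, Set.mem_ofPred_eq, im_sub_div_tangent hx, Set.mem_ofPred_eq]

lemma leftSide_union_rightSide {D : ℕ} {x : ℂ} (hx : x ≠ 0) :
    leftSide D x ∪ rightSide D x = {z | (z / x).im ≠ 0} := by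
  ext z
  rw [leftSide_eq hx, rightSide_eq hx]
  simp only [Set.mem_union, Set.mem_ofPred_eq]
  split_ifs
  · rw [or_comm, ← lt_or_lt_iff_ne]
  · rw [← lt_or_lt_iff_ne, neg_pos, neg_lt_zero]

lemma mem_closure_leftSide {D : ℕ} {x : ℂ} (hx : x ≠ 0) : x ∈ closure (leftSide D x) := by
  have ht : tangent D x ≠ 0 := by unfold tangent; split_ifs <;> simpa using hx
  rw [mem_closure_iff_seq_limit]
  refine ⟨fun n => x + tangent D x * (((1 / ((n : ℝ) + 1) : ℝ) : ℂ) * I), fun n => ?_, ?_⟩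
  · simp only [leftSide, Set.mem_ofPred_eq]
    rw [add_sub_cancel_left, mul_div_cancel_left₀ _ ht]
    rw [im_ofReal_mul, I_im]
    positivity
  · have h := (continuous_ofReal.tendsto 0).comp (tendsto_one_div_add_atTop_nhds_zero_nat (𝕜 := ℝ))
    have h2 := ((h.mul_const I).const_mul (tangent D x)).const_add x
    simpa using h2

lemma mem_closure_rightSide {D : ℕ} {x : ℂ} (hx : x ≠ 0) : x ∈ closure (rightSide D x) := by
  have ht : tangent D x ≠ 0 := by unfold tangent; split_ifs <;> simpa using hx
  rw [mem_closure_iff_seq_limit]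
  refine ⟨fun n => x + tangent D x * (((1 / ((n : ℝ) + 1) : ℝ) : ℂ) * (-I)), fun n => ?_, ?_⟩
  · simp only [rightSide, Set.mem_ofPred_eq]
    rw [add_sub_cancel_left, mul_div_cancel_left₀ _ ht]
    rw [im_ofReal_mul, neg_im, I_im, mul_neg, mul_one, neg_lt_zero]
    positivity
  · have h := (continuous_ofReal.tendsto 0).comp (tendsto_one_div_add_atTop_nhds_zero_nat (𝕜 := ℝ))
    have h2 := ((h.mul_const (-I)).const_mul (tangent D x)).const_add x
    simpa using h2

lemma neBot_leftSide {D : ℕ} {x : ℂ} (hx : x ≠ 0) : (𝓝[leftSide D x] x).NeBot :=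
  mem_closure_iff_nhdsWithin_neBot.1 (mem_closure_leftSide hx)

/-- The two sides depend only on the ray. -/
lemma eventually_sides_eq {D : ℕ} (hD : 2 ≤ D) {x : ℂ} (hx : x ∈ gamma D \ {0}) :
    ∀ᶠ y in 𝓝[gamma D \ {0}] x, leftSide D y = leftSide D x ∧ rightSide D y = rightSide D x := by
  have hx0 : x ≠ 0 := hx.2
  filter_upwards [(eventually_mem_gamma_iff hD hx).filter_mono nhdsWithin_le_nhds,
    self_mem_nhdsWithin] with y hy hyg
  have hy0 : y ≠ 0 := hyg.2
  have him := hy.1.1 hyg.1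
  obtain ⟨c, hc, hyc⟩ : ∃ c : ℝ, 0 < c ∧ y = c * x := by
    refine ⟨(y / x).re, hy.2, ?_⟩
    have : ((y / x).re : ℂ) = y / x := Complex.ext rfl (by simp [him])
    rw [this, div_mul_cancel₀ _ hx0]
  have hc0 : (c : ℂ) ≠ 0 := by exact_mod_cast hc.ne'
  have hray : y ∈ ray D 0 ↔ x ∈ ray D 0 := by
    rw [mem_ray_zero, mem_ray_zero, hyc, re_ofReal_mul, im_ofReal_mul]
    simp [hc.ne', hc]
  have hdiv : ∀ z, (z / y).im = c⁻¹ * (z / x).im := fun z => by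
    rw [← im_ofReal_mul, hyc]; congr 1; push_cast; field_simp
  have hci : 0 < c⁻¹ := inv_pos.2 hc
  have hp : ∀ b : ℝ, 0 < c⁻¹ * b ↔ 0 < b := fun b => mul_pos_iff_of_pos_left hci
  have hn : ∀ b : ℝ, c⁻¹ * b < 0 ↔ b < 0 := fun b => by
    rw [← neg_pos, ← mul_neg, hp, neg_pos]
  rw [leftSide_eq hy0, leftSide_eq hx0, rightSide_eq hy0, rightSide_eq hx0]
  by_cases hm : x ∈ ray D 0
  · simp only [hm, hray.2 hm, if_true, hdiv, hp, hn, and_self]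
  · simp only [hm, mt hray.1 hm, if_false, hdiv, ← mul_neg, hp, hn, and_self]

lemma eventually_not_mem_gamma_left {D : ℕ} (hD : 2 ≤ D) {x : ℂ} (hx : x ∈ gamma D \ {0}) :
    ∀ᶠ y in 𝓝[leftSide D x] x, y ∈ (gamma D)ᶜ := by
  filter_upwards [(eventually_mem_gamma_iff hD hx).filter_mono nhdsWithin_le_nhds,
    self_mem_nhdsWithin] with y hy hyl hyg
  have : y ∈ leftSide D x ∪ rightSide D x := Or.inl hyl
  rw [leftSide_union_rightSide hx.2] at this
  exact this (hy.1.1 hyg)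

lemma eventually_not_mem_gamma_right {D : ℕ} (hD : 2 ≤ D) {x : ℂ} (hx : x ∈ gamma D \ {0}) :
    ∀ᶠ y in 𝓝[rightSide D x] x, y ∈ (gamma D)ᶜ := by
  filter_upwards [(eventually_mem_gamma_iff hD hx).filter_mono nhdsWithin_le_nhds,
    self_mem_nhdsWithin] with y hy hyl hyg
  have : y ∈ leftSide D x ∪ rightSide D x := Or.inr hyl
  rw [leftSide_union_rightSide hx.2] at this
  exact this (hy.1.1 hyg)

lemma nhdsWithin_compl_gamma {D : ℕ} (hD : 2 ≤ D) {x : ℂ} (hx : x ∈ gamma D \ {0}) :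
    𝓝[(gamma D)ᶜ] x = 𝓝[leftSide D x] x ⊔ 𝓝[rightSide D x] x := by
  rw [← nhdsWithin_union, leftSide_union_rightSide hx.2]
  refine nhdsWithin_eq_iff_eventuallyEq.2 ((eventually_mem_gamma_iff hD hx).mono fun y hy => ?_)
  exact propext (not_congr hy.1)

/-- The approach region `S` is locally constant along `Γ \ {0}`, so near `x` the function of limits
coincides with the single extension `extendFrom (S x) F`, which is continuous wherever the limits
exist. -/
lemma continuousOn_limits {D : ℕ} {Y : Type*} [TopologicalSpace Y] [T3Space Y]
    {F Fp : ℂ → Y} (S : ℂ → Set ℂ) (hS : ∀ x ∈ gamma D \ {0}, x ∈ closure (S x))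
    (hSe : ∀ x ∈ gamma D \ {0}, ∀ᶠ y in 𝓝[gamma D \ {0}] x, S y = S x)
    (h : ∀ x ∈ gamma D \ {0}, Tendsto F (𝓝[S x] x) (𝓝 (Fp x))) :
    ContinuousOn Fp (gamma D \ {0}) := by
  intro x hx
  set B := {y | y ∈ gamma D \ {0} ∧ S y = S x} with hB
  have hBc : ContinuousOn (extendFrom (S x) F) B := by
    apply continuousOn_extendFrom
    · rintro y ⟨hy, hyS⟩
      rw [← hyS]; exact hS y hy
    · rintro y ⟨hy, hyS⟩
      exact ⟨Fp y, hyS ▸ h y hy⟩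
  have heq : Set.EqOn Fp (extendFrom (S x) F) B := by
    rintro y ⟨hy, hyS⟩
    exact (extendFrom_eq (hyS ▸ hS y hy) (hyS ▸ h y hy)).symm
  have hmem : B ∈ 𝓝[gamma D \ {0}] x := by
    filter_upwards [hSe x hx, self_mem_nhdsWithin] with y h1 h2 using ⟨h2, h1⟩
  exact ((hBc.congr heq) x ⟨hx, rfl⟩).mono_of_mem_nhdsWithin hmem

/-- One-sided limits satisfying the jump relation are automatically continuous along `Γ \ {0}`. -/
lemma HasJump.of_limits {D : ℕ} (hD : 2 ≤ D) {F J : ℂ → Mat D}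
    (h : ∀ x ∈ gamma D \ {0}, ∃ fp fm : Mat D, Tendsto F (𝓝[leftSide D x] x) (𝓝 fp) ∧
      Tendsto F (𝓝[rightSide D x] x) (𝓝 fm) ∧ fp = fm * J x) : HasJump D F J := by
  choose! Fp Fm hp hm hj using h
  have : T3Space (Mat D) := inferInstanceAs (T3Space (Idx D → Idx D → ℂ))
  refine ⟨Fp, Fm, ?_, ?_, fun x hx => ⟨hp x hx, hm x hx, hj x hx⟩⟩
  · exact continuousOn_limits (leftSide D) (fun x hx => mem_closure_leftSide hx.2)
      (fun x hx => (eventually_sides_eq hD hx).mono fun _ h => h.1) hp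
  · exact continuousOn_limits (rightSide D) (fun x hx => mem_closure_rightSide hx.2)
      (fun x hx => (eventually_sides_eq hD hx).mono fun _ h => h.2) hm

/-! ### Liouville's theorem for functions without jump -/

/-- A continuous function that is holomorphic off a horizontal line is holomorphic. -/
lemma differentiableOn_ball_of_off_real {f : ℂ → ℂ} {c : ℂ} {r : ℝ}
    (hc : ContinuousOn f (Metric.ball c r))
    (hd : DifferentiableOn ℂ f (Metric.ball c r ∩ {z | z.im ≠ 0})) :
    DifferentiableOn ℂ f (Metric.ball c r) := by
  have key : ∀ z w : ℂ, Rectangle z w ⊆ Metric.ball c r →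
      (0 : ℝ) ∉ Set.Ioo (min z.im w.im) (max z.im w.im) →
      (∫ x : ℝ in z.re..w.re, f (x + z.im * I)) - (∫ x : ℝ in z.re..w.re, f (x + w.im * I)) +
      I • (∫ y : ℝ in z.im..w.im, f (re w + y * I)) -
      I • (∫ y : ℝ in z.im..w.im, f (re z + y * I)) = 0 := by
    intro z w hR h0
    apply integral_boundary_rect_eq_zero_of_continuousOn_of_differentiableOn
    · exact hc.mono hR
    · apply hd.mono
      intro y hy
      refine ⟨hR ⟨Set.Ioo_subset_Icc_self hy.1, Set.Ioo_subset_Icc_self hy.2⟩, fun hy0 => h0 ?_⟩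
      have := hy.2
      rwa [Set.mem_preimage, hy0] at this
  have hcons : IsConservativeOn f (Metric.ball c r) := by
    intro z w hR
    rw [eq_neg_iff_add_eq_zero, wedgeIntegral_add_wedgeIntegral_eq]
    -- A rectangle that meets the line is cut along it. Each half has its interior off the line, so
    -- `key` applies to it, and the integrals over the common edge cancel in the sum.
    by_cases h0 : (0 : ℝ) ∈ Set.uIcc z.im w.im
    · have hv : ∀ a ∈ Set.uIcc z.re w.re,
          ContinuousOn (fun y : ℝ => f (a + y * I)) (Set.uIcc z.im w.im) := by
        intro a ha
        apply hc.comp (by fun_prop)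
        intro y hy
        exact hR ⟨by simpa using ha, by simpa using hy⟩
      have hsub1 : Set.uIcc z.im 0 ⊆ Set.uIcc z.im w.im := Set.uIcc_subset_uIcc_left h0
      have hsub2 : Set.uIcc 0 w.im ⊆ Set.uIcc z.im w.im := Set.uIcc_subset_uIcc_right h0
      have hsplit : ∀ a ∈ Set.uIcc z.re w.re, (∫ y : ℝ in z.im..w.im, f (a + y * I)) =
          (∫ y : ℝ in z.im..0, f (a + y * I)) + ∫ y : ℝ in (0 : ℝ)..w.im, f (a + y * I) := by
        intro a ha
        exact (intervalIntegral.integral_add_adjacent_intervals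
          ((hv a ha).mono hsub1).intervalIntegrable
          ((hv a ha).mono hsub2).intervalIntegrable).symm
      have k1 := key z w.re (fun y hy => hR ⟨by simpa using hy.1, hsub1 (by simpa using hy.2)⟩)
        (by simp only [ofReal_im, Set.mem_Ioo, not_and_or, not_lt]; grind)
      have k2 := key z.re w (fun y hy => hR ⟨by simpa using hy.1, hsub2 (by simpa using hy.2)⟩)
        (by simp only [ofReal_im, Set.mem_Ioo, not_and_or, not_lt]; grind)
      simp only [ofReal_re, ofReal_im] at k1 k2
      rw [hsplit _ Set.left_mem_uIcc, hsplit _ Set.right_mem_uIcc]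
      simp only [smul_eq_mul] at k1 k2 ⊢
      linear_combination k1 + k2
    · refine key z w hR fun h => h0 ?_
      exact Set.Ioo_subset_Icc_self h
  -- Morera: vanishing rectangle integrals give a primitive on the disc.
  exact (hcons.isExactOn_ball hc).differentiableOn Metric.isOpen_ball

lemma dense_compl_gamma {D : ℕ} (hD : 2 ≤ D) : Dense (gamma D)ᶜ := by
  have h : ∀ x ≠ 0, x ∈ closure (gamma D)ᶜ := by
    intro x hx
    by_cases hg : x ∈ gamma D
    · have := neBot_leftSide (D := D) hx
      rw [mem_closure_iff_nhdsWithin_neBot, nhdsWithin_compl_gamma hD ⟨hg, hx⟩]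
      infer_instance
    · exact subset_closure hg
  have h2 : Dense ({0}ᶜ : Set ℂ) := dense_compl_singleton 0
  exact dense_closure.1 (h2.mono fun x hx => h x hx)

/-- A function that is analytic off `Γ`, has equal limits on both sides, is bounded near `0` and
tends to `0` at infinity vanishes. -/
theorem eq_zero_of_no_jump {D : ℕ} (hD : 2 ≤ D) {g : ℂ → ℂ}
    (hd : DifferentiableOn ℂ g (gamma D)ᶜ)
    (hj : ∀ x ∈ gamma D \ {0}, ∃ l, Tendsto g (𝓝[leftSide D x] x) (𝓝 l) ∧
      Tendsto g (𝓝[rightSide D x] x) (𝓝 l))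
    (hb : ∃ M : ℝ, ∀ᶠ z in 𝓝[(gamma D)ᶜ] 0, ‖g z‖ ≤ M)
    (hi : Tendsto g (atInf D) (𝓝 0)) : ∀ z ∈ (gamma D)ᶜ, g z = 0 := by
  have hdense := dense_compl_gamma hD
  have hopen := isOpen_compl_gamma D
  set G := extendFrom (gamma D)ᶜ g with hG
  have hlim : ∀ x ∈ ({0}ᶜ : Set ℂ), ∃ y, Tendsto g (𝓝[(gamma D)ᶜ] x) (𝓝 y) := by
    intro x hx
    by_cases hg : x ∈ gamma D
    · obtain ⟨l, h1, h2⟩ := hj x ⟨hg, hx⟩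
      exact ⟨l, by rw [nhdsWithin_compl_gamma hD ⟨hg, hx⟩]; exact h1.sup h2⟩
    · exact ⟨g x, (hd.continuousOn x hg)⟩
  have hGc : ContinuousOn G {0}ᶜ := continuousOn_extendFrom (fun x _ => hdense x) hlim
  have hGg : ∀ x ∈ (gamma D)ᶜ, G x = g x := fun x hx =>
    extendFrom_eq (hdense x) (hd.continuousOn x hx)
  have hGd0 : DifferentiableOn ℂ G (gamma D)ᶜ := hd.congr hGg
  have hGd : ∀ x ≠ 0, DifferentiableAt ℂ G x := by
    intro x hx
    by_cases hg : x ∈ gamma D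
    -- Multiplication by `x` carries a neighbourhood of `1` to one of `x` and the real axis to the
    -- line that `Γ` is there, so the removability lemma for the real axis applies.
    · have hev := eventually_mem_gamma_iff hD (x := x) ⟨hg, hx⟩
      have hcont : Tendsto (fun w : ℂ => x * w) (𝓝 1) (𝓝 x) := by
        have : ContinuousAt (fun w : ℂ => x * w) 1 := by fun_prop
        simpa [ContinuousAt] using this
      obtain ⟨r, hr, hball⟩ := Metric.eventually_nhds_iff_ball.1
        (hcont.eventually (hev.and (isOpen_compl_singleton.mem_nhds hx)))
      have hH : DifferentiableOn ℂ (fun w => G (x * w)) (Metric.ball 1 r) := by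
        apply differentiableOn_ball_of_off_real
        · exact hGc.comp (by fun_prop) fun w hw => (hball w hw).2
        · refine hGd0.comp (by fun_prop) fun w hw => ?_
          have := (hball w hw.1).1.1
          rw [mul_div_cancel_left₀ _ hx] at this
          exact fun h => hw.2 (this.1 h)
      have h1 : DifferentiableAt ℂ (fun w => G (x * w)) 1 :=
        (hH 1 (Metric.mem_ball_self hr)).differentiableAt (Metric.ball_mem_nhds 1 hr)
      have h2 : G = (fun w => G (x * w)) ∘ fun y => y / x := by
        ext y; simp [mul_div_cancel₀ _ hx]
      rw [h2]
      apply DifferentiableAt.comp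
      · simpa [div_self hx] using h1
      · fun_prop
    · exact (hGd0 x hg).differentiableAt (hopen.mem_nhds hg)
  -- the origin
  obtain ⟨M, hM⟩ := hb
  obtain ⟨r, hr, hball⟩ := Metric.eventually_nhds_iff_ball.1 (eventually_nhdsWithin_iff.1 hM)
  -- Bounds known only off `Γ` pass to the points of `Γ \ {0}` by density. This serves at the
  -- origin, a removable singularity, and at infinity.
  have hclos : ∀ (U : Set ℂ) (B : ℝ), IsOpen U → (∀ z ∈ U ∩ (gamma D)ᶜ, ‖g z‖ ≤ B) →
      ∀ z ∈ U \ {0}, ‖G z‖ ≤ B := by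
    intro U B hU hUb z hz
    have hcon : ContinuousAt G z := (hGd z hz.2).continuousAt
    have hne : (𝓝[(gamma D)ᶜ] z).NeBot := mem_closure_iff_nhdsWithin_neBot.1 (hdense z)
    refine le_of_tendsto ((hcon.norm).tendsto.mono_left (nhdsWithin_le_nhds (s := (gamma D)ᶜ))) ?_
    filter_upwards [self_mem_nhdsWithin, nhdsWithin_le_nhds (hU.mem_nhds hz.1)] with y h1 h2
    rw [hGg y h1]
    exact hUb y ⟨h2, h1⟩
  have hb0 : ∀ z ∈ Metric.ball (0 : ℂ) r \ {0}, ‖G z‖ ≤ M :=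
    hclos _ M Metric.isOpen_ball fun z hz => hball z hz.1 hz.2
  set E := Function.update G 0 (limUnder (𝓝[≠] (0 : ℂ)) G) with hE
  have hEG : ∀ z ≠ 0, E z = G z := fun z hz => Function.update_of_ne hz _ _
  have hEd : Differentiable ℂ E := by
    have h0 : DifferentiableOn ℂ E (Metric.ball 0 r) := by
      apply differentiableOn_update_limUnder_of_bddAbove (Metric.ball_mem_nhds 0 hr)
      · exact fun z hz => (hGd z hz.2).differentiableWithinAt
      · refine ⟨M, ?_⟩
        rintro _ ⟨z, hz, rfl⟩
        exact hb0 z hz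
    intro z
    by_cases hz : z = 0
    · rw [hz]
      exact (h0 0 (Metric.mem_ball_self hr)).differentiableAt (Metric.ball_mem_nhds 0 hr)
    · refine (hGd z hz).congr_of_eventuallyEq ?_
      filter_upwards [isOpen_compl_singleton.mem_nhds hz] with y hy using hEG y hy
  -- infinity
  have hE0 : Tendsto E (Bornology.cobounded ℂ) (𝓝 0) := by
    rw [Metric.tendsto_nhds]
    intro ε hε
    have h1 := (Metric.tendsto_nhds.1 hi) (ε / 2) (half_pos hε)
    rw [atInf, eventually_inf_principal, (Metric.hasBasis_cobounded_compl_closedBall 0).eventually_iff] at h1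
    obtain ⟨R, -, hR⟩ := h1
    rw [(Metric.hasBasis_cobounded_compl_closedBall (0 : ℂ)).eventually_iff]
    refine ⟨max R 0, trivial, fun z hz => ?_⟩
    have hz' : max R 0 < ‖z‖ := by simpa using hz
    have hz0 : z ≠ 0 := norm_pos_iff.1 ((le_max_right R 0).trans_lt hz')
    have := hclos (Metric.closedBall 0 R)ᶜ (ε / 2) Metric.isClosed_closedBall.isOpen_compl
      (fun y hy => by simpa using (hR hy.1 hy.2).le) z
      ⟨by simpa using (le_max_left R 0).trans_lt hz', hz0⟩
    rw [dist_zero_right, hEG z hz0]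
    linarith
  intro z hz
  have hz0 : z ≠ 0 := by
    rintro rfl
    exact hz ((mem_gamma_iff hD).2 ⟨0, by omega, by simp [mem_ray_zero]⟩)
  have hEz : ∀ y, E y = 0 := fun y => hEd.apply_eq_of_tendsto_cocompact y
    (by rwa [← Metric.cobounded_eq_cocompact])
  rw [← hGg z hz, ← hEG z hz0, hEz z]

/-! ### Polynomial densities on rays -/

/-- The potential `Q` has degree `D` and positive leading coefficient. -/
structure Confining (D : ℕ) (Q : ℝ[X]) : Prop where
  natDegree_eq : Q.natDegree = D
  lead_pos : 0 < Q.leadingCoeff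

/-- The density `p e^{-Q}`. -/
def dens (Q : ℝ[X]) (p : ℂ[X]) (x : ℂ) : ℂ := p.eval x * exp (-aeval x Q)

/-- The integral `∫ f(x) dx` over the ray `ω [0, ∞)`, oriented away from the origin. -/
def rayInt (ω : ℂ) (f : ℂ → ℂ) : ℂ := ∫ r in Set.Ioi (0 : ℝ), ω * f (ω * r)

lemma Confining.add {D : ℕ} {Q W : ℝ[X]} (hQ : Confining D Q) (hW : W.natDegree < D) (s : ℝ) :
    Confining D (Q + C s * W) := by
  have h1 : (C s * W).degree < Q.degree := by
    have hQ0 : Q ≠ 0 := by rintro rfl; simpa using hQ.lead_pos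
    rw [degree_eq_natDegree hQ0, hQ.natDegree_eq]
    exact (degree_le_natDegree.trans (Nat.cast_le.2 (natDegree_C_mul_le s W))).trans_lt
      (Nat.cast_lt.2 hW)
  exact ⟨by rw [natDegree_add_eq_left_of_degree_lt h1, hQ.natDegree_eq],
    by rw [leadingCoeff_add_of_degree_lt' h1]; exact hQ.lead_pos⟩

lemma Confining.smul {D : ℕ} {Q : ℝ[X]} (hQ : Confining D Q) {c : ℝ} (hc : 0 < c) :
    Confining D (C c * Q) :=
  ⟨by rw [natDegree_C_mul hc.ne', hQ.natDegree_eq],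
    by rw [leadingCoeff_mul, leadingCoeff_C]; exact mul_pos hc hQ.lead_pos⟩

lemma norm_eval_le_of_natDegree_le (p : ℂ[X]) {N : ℕ} (hN : p.natDegree ≤ N) :
    ∃ B : ℝ, 0 ≤ B ∧ ∀ x, ‖p.eval x‖ ≤ B * (1 + ‖x‖) ^ N := by
  refine ⟨∑ i ∈ Finset.range (p.natDegree + 1), ‖p.coeff i‖,
    Finset.sum_nonneg fun _ _ => norm_nonneg _, fun x => ?_⟩
  rw [eval_eq_sum_range, Finset.sum_mul]
  refine (norm_sum_le _ _).trans (Finset.sum_le_sum fun i hi => ?_)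
  rw [norm_mul, norm_pow]
  refine mul_le_mul_of_nonneg_left ?_ (norm_nonneg _)
  have h1 : ‖x‖ ^ i ≤ (1 + ‖x‖) ^ i := pow_le_pow_left₀ (norm_nonneg _) (by linarith) _
  have h2 : (1 + ‖x‖) ^ i ≤ (1 + ‖x‖) ^ N :=
    pow_le_pow_right₀ (by linarith [norm_nonneg x]) (by grind)
  exact h1.trans h2

lemma norm_aeval_le_of_natDegree_le (p : ℝ[X]) {N : ℕ} (hN : p.natDegree ≤ N) :
    ∃ B : ℝ, 0 ≤ B ∧ ∀ x : ℂ, ‖aeval x p‖ ≤ B * (1 + ‖x‖) ^ N := by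
  obtain ⟨B, hB, h⟩ := norm_eval_le_of_natDegree_le (p.map (algebraMap ℝ ℂ))
    ((natDegree_map_le).trans hN)
  exact ⟨B, hB, fun x => by rw [aeval_def, eval₂_eq_eval_map]; exact h x⟩

lemma norm_ray_le {ω : ℂ} (hω : ‖ω‖ = 1) {α β : ℝ} (hα : 0 ≤ α) (hβ : |β| ≤ 1) :
    ‖ω * (α + β * I)‖ ≤ 1 + α := by
  rw [norm_mul, hω, one_mul]
  refine (norm_add_le _ _).trans ?_
  rw [norm_mul, norm_I, norm_real, norm_real, Real.norm_eq_abs, Real.norm_eq_abs, abs_of_nonneg hα]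
  linarith

lemma norm_add_pow_sub_le {α β : ℝ} (hα : 0 ≤ α) (hβ : |β| ≤ 1) (D : ℕ) :
    ‖((α : ℂ) + β * I) ^ (D + 1) - (α : ℂ) ^ (D + 1)‖ ≤ (D + 1) * (2 + α) ^ D := by
  have hx : ‖(α : ℂ) + β * I‖ ≤ 2 + α := by
    have := norm_ray_le (ω := 1) norm_one hα hβ
    rw [one_mul] at this; linarith
  have ha : ‖(α : ℂ)‖ ≤ 2 + α := by
    rw [norm_real, Real.norm_eq_abs, abs_of_nonneg hα]; linarith
  rw [← (Commute.all ((α : ℂ) + β * I) (α : ℂ)).mul_geom_sum₂, add_sub_cancel_left, norm_mul]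
  have h1 : ‖(β : ℂ) * I‖ ≤ 1 := by simpa using hβ
  have h2 : ‖∑ i ∈ Finset.range (D + 1), ((α : ℂ) + β * I) ^ i * (α : ℂ) ^ (D + 1 - 1 - i)‖ ≤
      (D + 1) * (2 + α) ^ D := by
    refine (norm_sum_le _ _).trans ?_
    have : ∀ i ∈ Finset.range (D + 1),
        ‖((α : ℂ) + β * I) ^ i * (α : ℂ) ^ (D + 1 - 1 - i)‖ ≤ (2 + α) ^ D := by
      intro i hi
      rw [norm_mul, norm_pow, norm_pow]
      calc _ ≤ (2 + α) ^ i * (2 + α) ^ (D + 1 - 1 - i) := by gcongr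
        _ = (2 + α) ^ D := by rw [← pow_add]; congr 1; grind
    refine (Finset.sum_le_card_nsmul _ _ _ this).trans ?_
    simp
  calc _ ≤ 1 * ((D + 1) * (2 + α) ^ D) := mul_le_mul h1 h2 (norm_nonneg _) zero_le_one
    _ = _ := one_mul _

/-- Beyond the threshold `A` one has `a α ≥ B 2^(d+1) + 2` and `2 + α ≤ 2 α`, so the difference is
at least `2 α^(d+1) ≥ 2 α`. Below `A` everything is bounded and the constant absorbs it. -/
lemma pow_sub_pow_lower_bound {a : ℝ} (ha : 0 < a) {B : ℝ} (hB : 0 ≤ B) (d : ℕ) :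
    ∃ K : ℝ, ∀ α : ℝ, 0 ≤ α → 2 * α - K ≤ a * α ^ (d + 2) - B * (2 + α) ^ (d + 1) := by
  set A := max 2 ((B * 2 ^ (d + 1) + 2) / a) with hA
  have hA2 : 2 ≤ A := le_max_left _ _
  refine ⟨B * (2 + A) ^ (d + 1) + 2 * A, fun α hα => ?_⟩
  rcases le_total α A with h | h
  · have h1 : (2 + α) ^ (d + 1) ≤ (2 + A) ^ (d + 1) := by gcongr
    have h2 := mul_le_mul_of_nonneg_left h1 hB
    have h3 : 0 ≤ a * α ^ (d + 2) := by positivity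
    linarith
  · have h2 : 2 ≤ α := hA2.trans h
    have h3 : B * 2 ^ (d + 1) + 2 ≤ a * α := by
      have := (le_max_right 2 ((B * 2 ^ (d + 1) + 2) / a)).trans h
      rw [div_le_iff₀ ha] at this
      linarith
    have h4 : (2 + α) ^ (d + 1) ≤ 2 ^ (d + 1) * α ^ (d + 1) := by
      rw [← mul_pow]; gcongr; linarith
    have h5 : α ≤ α ^ (d + 1) := le_self_pow₀ (by linarith) (by omega)
    have h6 : 0 ≤ α ^ (d + 1) := by positivity
    have h7 := mul_le_mul_of_nonneg_left h4 hB
    have h8 := mul_le_mul_of_nonneg_right h3 h6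
    have h9 : 0 ≤ B * (2 + A) ^ (d + 1) + 2 * A := by positivity
    have h10 : a * α ^ (d + 2) = a * α * α ^ (d + 1) := by ring
    nlinarith

/-- Since `ω^D = 1`, the leading term at `ω α` is the positive number `a α^D`. The lower-order
terms, `sW` and the transversal shift `β` cost only a multiple of `(2 + α)^(D-1)`. The rate `2`
instead of `1` leaves a factor `e^{-α}` to spare for a polynomial prefactor. -/
lemma re_aeval_lower_bound {D : ℕ} (hD : 2 ≤ D) {Q W : ℝ[X]} (hQ : Confining D Q)
    (hW : W.natDegree < D) {ω : ℂ} (hω : ω ^ D = 1) (R : ℝ) :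
    ∃ K : ℝ, ∀ s : ℝ, |s| ≤ R → ∀ α β : ℝ, 0 ≤ α → |β| ≤ 1 →
      2 * α - K ≤ (aeval (ω * (α + β * I)) (Q + C s * W)).re := by
  obtain ⟨d, rfl⟩ : ∃ d, D = d + 2 := ⟨D - 2, by omega⟩
  have hω1 : ‖ω‖ = 1 := norm_eq_one_of_pow_eq_one hω (by omega)
  have hQ1 : Q.eraseLead.natDegree ≤ d + 1 := by
    have := eraseLead_natDegree_le Q
    rw [hQ.natDegree_eq] at this; omega
  obtain ⟨B1, hB1, h1⟩ := norm_aeval_le_of_natDegree_le _ hQ1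
  obtain ⟨B2, hB2, h2⟩ := norm_aeval_le_of_natDegree_le W (N := d + 1) (by omega)
  have ha := hQ.lead_pos
  set a := Q.leadingCoeff with ha_def
  obtain ⟨K, hK⟩ := pow_sub_pow_lower_bound ha
    (B := B1 + |R| * B2 + a * ((d + 1 : ℕ) + 1)) (by positivity) d
  refine ⟨K, fun s hs α β hα hβ => (hK α hα).trans ?_⟩
  set x := ω * (α + β * I) with hx
  have hxn : 1 + ‖x‖ ≤ 2 + α := by linarith [norm_ray_le hω1 hα hβ]
  have hsplit : aeval x (Q + C s * W) =
      (a : ℂ) * (α : ℂ) ^ (d + 2) + (aeval x Q.eraseLead + s * aeval x W +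
        a * (((α : ℂ) + β * I) ^ (d + 2) - (α : ℂ) ^ (d + 2))) := by
    conv_lhs => rw [← eraseLead_add_C_mul_X_pow Q, hQ.natDegree_eq]
    simp only [map_add, map_mul, aeval_C, map_pow, aeval_X, coe_algebraMap, ← ha_def]
    rw [hx, mul_pow, hω]
    ring
  have hpow : (1 + ‖x‖) ^ (d + 1) ≤ (2 + α) ^ (d + 1) := by gcongr
  have e1 : ‖aeval x Q.eraseLead‖ ≤ B1 * (2 + α) ^ (d + 1) := (h1 x).trans (by gcongr)
  have e2 : ‖(s : ℂ) * aeval x W‖ ≤ |R| * B2 * (2 + α) ^ (d + 1) := by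
    rw [norm_mul, norm_real, Real.norm_eq_abs, mul_assoc]
    exact mul_le_mul (hs.trans (le_abs_self R)) ((h2 x).trans (by gcongr)) (norm_nonneg _)
      (abs_nonneg _)
  have e3 : ‖(a : ℂ) * (((α : ℂ) + β * I) ^ (d + 2) - (α : ℂ) ^ (d + 2))‖ ≤
      a * ((d + 1 : ℕ) + 1) * (2 + α) ^ (d + 1) := by
    rw [norm_mul, norm_real, Real.norm_eq_abs, abs_of_pos ha, mul_assoc]
    exact mul_le_mul_of_nonneg_left (by exact_mod_cast norm_add_pow_sub_le hα hβ (d + 1)) ha.le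
  have e4 := (norm_add_le _ _).trans (add_le_add ((norm_add_le _ _).trans (add_le_add e1 e2)) e3)
  have e5 := (abs_le.1 ((abs_re_le_norm _).trans e4)).1
  rw [hsplit, add_re]
  have e6 : ((a : ℂ) * (α : ℂ) ^ (d + 2)).re = a * α ^ (d + 2) := by
    rw [← ofReal_pow, ← ofReal_mul, ofReal_re]
  rw [e6]
  linarith

/-- Uniform exponential decay of `p e^{-(Q+sW)}` in a strip around the ray. -/
lemma dens_decay_uniform {D : ℕ} (hD : 2 ≤ D) {Q W : ℝ[X]} (hQ : Confining D Q)
    (hW : W.natDegree < D) {ω : ℂ} (hω : ω ^ D = 1) (p : ℂ[X]) (R : ℝ) :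
    ∃ B : ℝ, 0 ≤ B ∧ ∀ s : ℝ, |s| ≤ R → ∀ α β : ℝ, 0 ≤ α → |β| ≤ 1 →
      ‖dens (Q + C s * W) p (ω * (α + β * I))‖ ≤ B * Real.exp (-α) := by
  have hω1 : ‖ω‖ = 1 := norm_eq_one_of_pow_eq_one hω (by omega)
  obtain ⟨K, hK⟩ := re_aeval_lower_bound hD hQ hW hω R
  obtain ⟨B, hB, hp⟩ := norm_eval_le_of_natDegree_le p le_rfl
  set N := p.natDegree
  refine ⟨B * (N.factorial * Real.exp 2) * Real.exp K, by positivity, fun s hs α β hα hβ => ?_⟩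
  rw [dens, norm_mul, norm_exp, neg_re]
  have h1 : ‖eval (ω * (α + β * I)) p‖ ≤ B * (N.factorial * Real.exp (2 + α)) := by
    refine (hp _).trans (mul_le_mul_of_nonneg_left ?_ hB)
    have h2 : (1 + ‖ω * (α + β * I)‖) ^ N ≤ (2 + α) ^ N := by
      refine pow_le_pow_left₀ (by positivity) ?_ _
      linarith [norm_ray_le hω1 hα hβ]
    have h3 := Real.pow_div_factorial_le_exp (2 + α) (by linarith) N
    rw [div_le_iff₀ (by positivity)] at h3
    linarith
  have h4 : Real.exp (-(aeval (ω * (α + β * I)) (Q + C s * W)).re) ≤ Real.exp (K - 2 * α) :=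
    Real.exp_le_exp.2 (by linarith [hK s hs α β hα hβ])
  refine (mul_le_mul h1 h4 (Real.exp_pos _).le (by positivity)).trans_eq ?_
  -- One factor `e^{-α}` pays for the factor `e^α` in the bound of the polynomial; the other is the
  -- decay that remains.
  rw [show K - 2 * α = K + (-α) + (-α) by ring, Real.exp_add, Real.exp_add, Real.exp_add]
  have : Real.exp α * Real.exp (-α) = 1 := by rw [← Real.exp_add]; simp
  linear_combination B * N.factorial * Real.exp 2 * Real.exp K * Real.exp (-α) * this

/-- An entire function with exponential decay, together with its derivative, in a strip around the
ray `ω [0, ∞)`. -/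
structure StripDecay (ω : ℂ) (f : ℂ → ℂ) : Prop where
  differentiable : Differentiable ℂ f
  bound : ∃ B : ℝ, 0 ≤ B ∧ ∀ α β : ℝ, 0 ≤ α → |β| ≤ 1 →
    ‖f (ω * (α + β * I))‖ ≤ B * Real.exp (-α) ∧ ‖deriv f (ω * (α + β * I))‖ ≤ B * Real.exp (-α)

/-- The polynomial `p' - Q' p`, so that `(p e^{-Q})' = (p' - Q' p) e^{-Q}`. -/
def twist (Q : ℝ[X]) (p : ℂ[X]) : ℂ[X] :=
  derivative p - (derivative Q).map (algebraMap ℝ ℂ) * p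

lemma hasDerivAt_dens (Q : ℝ[X]) (p : ℂ[X]) (x : ℂ) :
    HasDerivAt (dens Q p) (dens Q (twist Q p) x) x := by
  have h1 := p.hasDerivAt x
  have h2 : HasDerivAt (fun y : ℂ => aeval y Q) (aeval x (derivative Q)) x := Q.hasDerivAt_aeval x
  refine HasDerivAt.congr_deriv (f := dens Q p) (h1.mul h2.neg.cexp) ?_
  simp only [dens, twist, eval_sub, eval_mul, ← eval₂_eq_eval_map, ← aeval_def, Pi.neg_apply]
  ring

lemma dens_decay {D : ℕ} (hD : 2 ≤ D) {Q : ℝ[X]} (hQ : Confining D Q) {ω : ℂ} (hω : ω ^ D = 1)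
    (p : ℂ[X]) : ∃ B : ℝ, 0 ≤ B ∧ ∀ α β : ℝ, 0 ≤ α → |β| ≤ 1 →
      ‖dens Q p (ω * (α + β * I))‖ ≤ B * Real.exp (-α) := by
  obtain ⟨B, hB, h⟩ := dens_decay_uniform hD hQ (W := 0) (by simp; omega) hω p 0
  exact ⟨B, hB, fun α β hα hβ => by simpa using h 0 (by simp) α β hα hβ⟩

lemma stripDecay_dens {D : ℕ} (hD : 2 ≤ D) {Q : ℝ[X]} (hQ : Confining D Q) {ω : ℂ}
    (hω : ω ^ D = 1) (p : ℂ[X]) : StripDecay ω (dens Q p) := by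
  refine ⟨fun x => (hasDerivAt_dens Q p x).differentiableAt, ?_⟩
  obtain ⟨B1, hB1, h1⟩ := dens_decay hD hQ hω p
  obtain ⟨B2, hB2, h2⟩ := dens_decay hD hQ hω (twist Q p)
  refine ⟨B1 + B2, by positivity, fun α β hα hβ => ?_⟩
  have he := (Real.exp_pos (-α)).le
  rw [(hasDerivAt_dens Q p _).deriv]
  constructor
  · exact (h1 α β hα hβ).trans (by nlinarith)
  · exact (h2 α β hα hβ).trans (by nlinarith)

lemma integrableOn_exp_neg : MeasureTheory.IntegrableOn (fun r : ℝ => Real.exp (-r)) (Set.Ioi 0) := by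
  simpa using exp_neg_integrableOn_Ioi 0 one_pos

lemma StripDecay.bound_ray {ω : ℂ} {f : ℂ → ℂ} (hf : StripDecay ω f) :
    ∃ B : ℝ, 0 ≤ B ∧ ∀ r : ℝ, 0 ≤ r → ‖f (ω * r)‖ ≤ B * Real.exp (-r) := by
  obtain ⟨B, hB, h⟩ := hf.bound
  exact ⟨B, hB, fun r hr => by simpa using (h r 0 hr (by simp)).1⟩

/-- A bounded measurable multiple of a decaying function is integrable along the ray. -/
lemma StripDecay.integrableOn_mul {ω : ℂ} {f : ℂ → ℂ} (hf : StripDecay ω f) {S : Set ℝ}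
    (hS : MeasurableSet S) (hS0 : S ⊆ Set.Ioi 0) {g : ℝ → ℂ}
    (hg : MeasureTheory.AEStronglyMeasurable g (MeasureTheory.volume.restrict S)) {M : ℝ}
    (hM : ∀ r ∈ S, ‖g r‖ ≤ M) :
    MeasureTheory.IntegrableOn (fun r : ℝ => g r * f (ω * r)) S := by
  obtain ⟨B, hB, h⟩ := hf.bound_ray
  refine MeasureTheory.Integrable.mono' ((integrableOn_exp_neg.mono_set hS0).const_mul (M * B)) ?_ ?_
  · exact hg.mul ((hf.differentiable.continuous.comp (by fun_prop)).aestronglyMeasurable)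
  · refine (MeasureTheory.ae_restrict_iff' hS).2 (MeasureTheory.ae_of_all _ fun r hr => ?_)
    rw [norm_mul, mul_assoc]
    exact mul_le_mul (hM r hr) (h r (hS0 hr).le) (norm_nonneg _) ((norm_nonneg _).trans (hM r hr))

lemma StripDecay.integrableOn {ω : ℂ} {f : ℂ → ℂ} (hf : StripDecay ω f) :
    MeasureTheory.IntegrableOn (fun r : ℝ => ω * f (ω * r)) (Set.Ioi 0) :=
  hf.integrableOn_mul measurableSet_Ioi subset_rfl MeasureTheory.aestronglyMeasurable_const
    (M := ‖ω‖) fun _ _ => le_rfl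

/-- Integration by parts on a ray. -/
lemma rayInt_twist {D : ℕ} (hD : 2 ≤ D) {Q : ℝ[X]} (hQ : Confining D Q) {ω : ℂ}
    (hω : ω ^ D = 1) (p : ℂ[X]) : rayInt ω (dens Q (twist Q p)) = -dens Q p 0 := by
  obtain ⟨B, hB, h⟩ := (stripDecay_dens hD hQ hω p).bound_ray
  have hder : ∀ r ∈ Set.Ici (0 : ℝ), HasDerivAt (fun r : ℝ => dens Q p (ω * r))
      (ω * dens Q (twist Q p) (ω * r)) r := by
    intro r _
    have h1 : HasDerivAt (fun r : ℝ => ω * (r : ℂ)) ω r := by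
      simpa using (ofRealCLM.hasDerivAt (x := r)).const_mul ω
    have := (hasDerivAt_dens Q p (ω * r)).comp r h1
    rwa [mul_comm] at this
  have hlim : Tendsto (fun r : ℝ => dens Q p (ω * r)) atTop (𝓝 0) := by
    refine squeeze_zero_norm' (a := fun r => B * Real.exp (-r)) ?_ ?_
    · filter_upwards [eventually_ge_atTop 0] with r hr using h r hr
    · simpa using (Real.tendsto_exp_neg_atTop_nhds_zero).const_mul B
  rw [rayInt, MeasureTheory.integral_Ioi_of_hasDerivAt_of_tendsto' hder
    (stripDecay_dens hD hQ hω (twist Q p)).integrableOn hlim]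
  simp

/-- Differentiation of ray integrals with respect to the potential. -/
lemma hasDerivAt_rayInt {D : ℕ} (hD : 2 ≤ D) {Q W : ℝ[X]} (hQ : Confining D Q)
    (hW : W.natDegree < D) {ω : ℂ} (hω : ω ^ D = 1) (p : ℂ[X]) {g : ℂ → ℂ}
    (hg : MeasureTheory.AEStronglyMeasurable (fun r : ℝ => g (ω * r))
      (MeasureTheory.volume.restrict (Set.Ioi 0))) {M : ℝ}
    (hM : ∀ r : ℝ, 0 < r → ‖g (ω * r)‖ ≤ M) (s : ℝ) :
    HasDerivAt (fun s : ℝ => rayInt ω fun x => g x * dens (Q + C s * W) p x)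
      (-rayInt ω fun x => g x * dens (Q + C s * W) (W.map (algebraMap ℝ ℂ) * p) x) s := by
  set Wp := W.map (algebraMap ℝ ℂ) * p with hWp
  -- The dominating function has to serve the whole unit ball around `s`, hence the radius `|s| +
  -- 1`.
  obtain ⟨B, hB, hdec⟩ := dens_decay_uniform hD hQ hW hω Wp (|s| + 1)
  have hmeas : ∀ (s : ℝ) (q : ℂ[X]), MeasureTheory.AEStronglyMeasurable
      (fun r : ℝ => ω * (g (ω * r) * dens (Q + C s * W) q (ω * r)))
      (MeasureTheory.volume.restrict (Set.Ioi 0)) := by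
    intro s q
    have hc : Continuous (dens (Q + C s * W) q) :=
      (show Differentiable ℂ _ from fun x => (hasDerivAt_dens _ q x).differentiableAt).continuous
    exact (hg.mul ((hc.comp (by fun_prop)).aestronglyMeasurable)).const_mul ω
  have hneg : (-rayInt ω fun x => g x * dens (Q + C s * W) Wp x) =
      ∫ r in Set.Ioi (0 : ℝ), -(ω * (g (ω * r) * dens (Q + C s * W) Wp (ω * r))) := by
    rw [MeasureTheory.integral_neg, rayInt]
  rw [hneg]
  refine (hasDerivAt_integral_of_dominated_loc_of_deriv_le
    (F' := fun (s : ℝ) (r : ℝ) => -(ω * (g (ω * r) * dens (Q + C s * W) Wp (ω * r))))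
    (bound := fun r => ‖ω‖ * (M * (B * Real.exp (-r))))
    (Metric.ball_mem_nhds s one_pos) (Eventually.of_forall fun s => hmeas s p) ?_
    (hmeas s Wp).neg ?_ ?_ ?_).2
  · have := (stripDecay_dens hD (hQ.add hW s) hω p).integrableOn_mul measurableSet_Ioi subset_rfl
      (hg.const_mul ω) (M := ‖ω‖ * M) fun r hr => by
        rw [norm_mul]; exact mul_le_mul_of_nonneg_left (hM r hr) (norm_nonneg _)
    simpa only [mul_assoc] using this.integrable
  · refine (MeasureTheory.ae_restrict_iff' measurableSet_Ioi).2 (MeasureTheory.ae_of_all _ fun r hr s' hs' => ?_)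
    rw [norm_neg, norm_mul, norm_mul]
    have hs1 : |s'| ≤ |s| + 1 := by
      have := (Metric.mem_ball.1 hs').le
      rw [Real.dist_eq] at this
      have h2 := abs_sub_abs_le_abs_sub s' s
      linarith
    have h1 := hdec s' hs1 r 0 hr.le (by simp)
    simp only [ofReal_zero, zero_mul, add_zero] at h1
    exact mul_le_mul_of_nonneg_left (mul_le_mul (hM r hr) h1 (norm_nonneg _)
      ((norm_nonneg _).trans (hM r hr))) (norm_nonneg _)
  · exact ((integrableOn_exp_neg.const_mul B).const_mul M).const_mul ‖ω‖
  · refine MeasureTheory.ae_of_all _ fun r s' _ => ?_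
    have h1 : HasDerivAt (fun s : ℝ => aeval (ω * r) (Q + C s * W)) (aeval (ω * (r : ℂ)) W) s' := by
      have : (fun s : ℝ => aeval (ω * (r : ℂ)) (Q + C s * W)) =
          fun s : ℝ => aeval (ω * (r : ℂ)) Q + s * aeval (ω * (r : ℂ)) W := by
        ext s; simp
      rw [this]
      simpa using ((ofRealCLM.hasDerivAt (x := s')).mul_const _).const_add
        (aeval (ω * (r : ℂ)) Q)
    refine HasDerivAt.congr_deriv
      (f := fun s => ω * (g (ω * r) * dens (Q + C s * W) p (ω * r)))
      (((h1.neg.cexp.const_mul (p.eval (ω * r))).const_mul (g (ω * r))).const_mul ω) ?_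
    simp only [dens, hWp, eval_mul, ← eval₂_eq_eval_map, ← aeval_def, Pi.neg_apply]
    ring

/-! ### Cauchy transforms along a ray -/

/-- The Cauchy transform `∫ f(x) / (x - z) dx` over the part of the ray `ω [0, ∞)` given by `S`. -/
def rayCauchyOn (S : Set ℝ) (ω : ℂ) (f : ℂ → ℂ) (z : ℂ) : ℂ :=
  ∫ r in S, ω * ((ω * r - z)⁻¹ * f (ω * r))

/-- The Cauchy transform `∫ f(x) / (x - z) dx` over the ray `ω [0, ∞)`. -/
def rayCauchy (ω : ℂ) (f : ℂ → ℂ) (z : ℂ) : ℂ := rayInt ω fun x => (x - z)⁻¹ * f x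

lemma rayCauchy_eq (ω : ℂ) (f : ℂ → ℂ) (z : ℂ) :
    rayCauchy ω f z = rayCauchyOn (Set.Ioi 0) ω f z := rfl

lemma rayCauchy_integrableOn {ω : ℂ} {f : ℂ → ℂ} (hf : StripDecay ω f) {S : Set ℝ}
    (hS : MeasurableSet S) (hS0 : S ⊆ Set.Ioi 0) {z : ℂ} {δ : ℝ} (hδ : 0 < δ)
    (h : ∀ r ∈ S, δ ≤ ‖ω * r - z‖) :
    IntegrableOn (fun r : ℝ => ω * ((ω * r - z)⁻¹ * f (ω * r))) S := by
  have := hf.integrableOn_mul hS hS0 (g := fun r => ω * (ω * r - z)⁻¹) (M := ‖ω‖ * δ⁻¹) ?_ ?_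
  · simpa only [mul_assoc] using this
  · exact (Measurable.aestronglyMeasurable (by fun_prop))
  · intro r hr
    rw [norm_mul, norm_inv]
    have := h r hr
    gcongr

/-- The Cauchy transform is differentiable at points with positive distance from the contour. -/
lemma differentiableAt_rayCauchyOn {ω : ℂ} {f : ℂ → ℂ} (hf : StripDecay ω f) {S : Set ℝ}
    (hS : MeasurableSet S) (hS0 : S ⊆ Set.Ioi 0) {z : ℂ} {δ : ℝ} (hδ : 0 < δ)
    (h : ∀ r ∈ S, δ ≤ ‖ω * r - z‖) : DifferentiableAt ℂ (rayCauchyOn S ω f) z := by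
  have hball : ∀ y ∈ Metric.ball z (δ / 2), ∀ r ∈ S, δ / 2 ≤ ‖ω * r - y‖ := by
    intro y hy r hr
    have h1 := h r hr
    rw [Metric.mem_ball, dist_eq_norm] at hy
    have h2 := norm_sub_norm_le (ω * r - z) (y - z)
    rw [sub_sub_sub_cancel_right] at h2
    linarith
  have hcont : Continuous fun r : ℝ => f (ω * r) := hf.differentiable.continuous.comp (by fun_prop)
  obtain ⟨B, hB, hbd⟩ := hf.bound_ray
  refine (hasDerivAt_integral_of_dominated_loc_of_deriv_le (μ := volume.restrict S)
    (F := fun y (r : ℝ) => ω * ((ω * r - y)⁻¹ * f (ω * r)))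
    (F' := fun y (r : ℝ) => ω * (((ω * r - y) ^ 2)⁻¹ * f (ω * r)))
    (bound := fun r => ‖ω‖ * (((δ / 2) ^ 2)⁻¹ * (B * Real.exp (-r))))
    (Metric.ball_mem_nhds z (half_pos hδ)) ?_ ?_ ?_ ?_ ?_ ?_).2.differentiableAt
  · refine Eventually.of_forall fun y => ?_
    exact ((Measurable.aestronglyMeasurable (by fun_prop)).mul
      hcont.aestronglyMeasurable).const_mul ω
  · exact rayCauchy_integrableOn hf hS hS0 hδ h
  · exact ((Measurable.aestronglyMeasurable (by fun_prop)).mul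
      hcont.aestronglyMeasurable).const_mul ω
  · refine (ae_restrict_iff' hS).2 (ae_of_all _ fun r hr y hy => ?_)
    have h1 := hball y hy r hr
    have h2 := hbd r (hS0 hr).le
    rw [norm_mul, norm_mul, norm_inv, norm_pow]
    have h3 : 0 < δ / 2 := half_pos hδ
    gcongr
  · exact (((integrableOn_exp_neg.mono_set hS0).const_mul B).const_mul _).const_mul _
  · refine (ae_restrict_iff' hS).2 (ae_of_all _ fun r hr y hy => ?_)
    have h1 : ω * r - y ≠ 0 := by
      have := hball y hy r hr
      exact norm_pos_iff.1 (by linarith)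
    have h2 : HasDerivAt (fun y : ℂ => ω * r - y) (-1) y := by
      simpa using (hasDerivAt_id y).const_sub (ω * r)
    have h3 := ((h2.inv h1).mul_const (f (ω * r))).const_mul ω
    refine h3.congr_deriv ?_
    rw [neg_neg, one_div]

lemma norm_ray_sub {ω : ℂ} (hω : ‖ω‖ = 1) (z : ℂ) (r : ℝ) : ‖ω * r - z‖ = ‖(r : ℂ) - z / ω‖ := by
  have h0 : ω ≠ 0 := norm_pos_iff.1 (by rw [hω]; exact one_pos)
  rw [← one_mul ‖(r : ℂ) - z / ω‖, ← hω, ← norm_mul, mul_sub, mul_div_cancel₀ _ h0]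

lemma exists_le_norm_ray_sub {ω : ℂ} (hω : ‖ω‖ = 1) {z : ℂ} (hz : -(z / ω) ∈ slitPlane) :
    ∃ δ > 0, ∀ r : ℝ, 0 ≤ r → δ ≤ ‖ω * r - z‖ := by
  simp only [norm_ray_sub hω]
  set a := z / ω
  rw [mem_slitPlane_iff, neg_re, neg_im] at hz
  by_cases him : a.im = 0
  · refine ⟨-a.re, hz.resolve_right (by simp [him]), fun r hr => ?_⟩
    have := re_le_norm ((r : ℂ) - a)
    rw [sub_re, ofReal_re] at this
    linarith
  · refine ⟨|a.im|, abs_pos.2 him, fun r _ => ?_⟩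
    have := abs_im_le_norm ((r : ℂ) - a)
    rwa [sub_im, ofReal_im, zero_sub, abs_neg] at this

lemma rayCauchy_differentiableAt {ω : ℂ} (hω : ‖ω‖ = 1) {f : ℂ → ℂ} (hf : StripDecay ω f) {z : ℂ}
    (hz : -(z / ω) ∈ slitPlane) : DifferentiableAt ℂ (rayCauchy ω f) z := by
  obtain ⟨δ, hδ, h⟩ := exists_le_norm_ray_sub hω hz
  exact differentiableAt_rayCauchyOn hf measurableSet_Ioi subset_rfl hδ fun r hr => h r hr.le

/-- The difference quotient `(f(x) - f(z)) / (x - z)`, as an average of `f'`. -/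
def diffQuot (f : ℂ → ℂ) (z x : ℂ) : ℂ := ∫ s in (0 : ℝ)..1, deriv f (z + s * (x - z))

lemma sub_mul_diffQuot {f : ℂ → ℂ} (hf : Differentiable ℂ f) (z x : ℂ) :
    (x - z) * diffQuot f z x = f x - f z := by
  have hcont : Continuous (deriv f) := hf.deriv.continuous
  have hder : ∀ s ∈ Set.uIcc (0 : ℝ) 1, HasDerivAt (fun s : ℝ => f (z + s * (x - z)))
      ((x - z) * deriv f (z + s * (x - z))) s := by
    intro s _
    have h1 : HasDerivAt (fun s : ℝ => z + (s : ℂ) * (x - z)) (x - z) s := by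
      simpa using ((ofRealCLM.hasDerivAt (x := s)).mul_const (x - z)).const_add z
    have := (hf (z + s * (x - z))).hasDerivAt.comp s h1
    rwa [mul_comm] at this
  have := intervalIntegral.integral_eq_sub_of_hasDerivAt hder
    (Continuous.intervalIntegrable (by fun_prop) _ _)
  rw [intervalIntegral.integral_const_mul] at this
  simpa [diffQuot] using this

lemma continuous_diffQuot {f : ℂ → ℂ} (hf : Differentiable ℂ f) :
    Continuous fun q : ℂ × ℂ => diffQuot f q.1 q.2 := by
  have hcont : Continuous (deriv f) := hf.deriv.continuous
  apply intervalIntegral.continuous_parametric_intervalIntegral_of_continuous'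
  fun_prop

lemma sub_mem_slitPlane {a : ℂ} (ha : -a ∈ slitPlane) {r : ℝ} (hr : 0 ≤ r) :
    (r : ℂ) - a ∈ slitPlane := by
  rw [mem_slitPlane_iff, neg_re, neg_im] at ha
  rw [mem_slitPlane_iff, sub_re, sub_im, ofReal_re, ofReal_im]
  rcases ha with h | h
  · left; linarith
  · right; simpa using h

/-- The part of the Cauchy transform over a segment of the ray, with its singular part split off. -/
lemma rayCauchyOn_Ioc {ω : ℂ} (hω : ‖ω‖ = 1) {f : ℂ → ℂ} (hf : Differentiable ℂ f) {z : ℂ}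
    (hz : -(z / ω) ∈ slitPlane) {r₁ r₂ : ℝ} (h₁ : 0 ≤ r₁) (h₁₂ : r₁ ≤ r₂) :
    rayCauchyOn (Set.Ioc r₁ r₂) ω f z = (∫ r in r₁..r₂, ω * diffQuot f z (ω * r)) +
      f z * (log (r₂ - z / ω) - log (r₁ - z / ω)) := by
  have h0 : ω ≠ 0 := norm_pos_iff.1 (by rw [hω]; exact one_pos)
  have hsl : ∀ r ∈ Set.uIcc r₁ r₂, (r : ℂ) - z / ω ∈ slitPlane := by
    intro r hr
    rw [Set.uIcc_of_le h₁₂] at hr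
    exact sub_mem_slitPlane hz (h₁.trans hr.1)
  have hne : ∀ r ∈ Set.uIcc r₁ r₂, (r : ℂ) - z / ω ≠ 0 := fun r hr =>
    slitPlane_ne_zero (hsl r hr)
  have hq : Continuous fun r : ℝ => ω * diffQuot f z (ω * r) := by
    have := continuous_diffQuot hf
    have h2 : Continuous fun r : ℝ => diffQuot f z (ω * r) :=
      this.comp (f := fun r : ℝ => (z, ω * r)) (by fun_prop)
    fun_prop
  have hlog : (∫ r in r₁..r₂, ((r : ℂ) - z / ω)⁻¹) = log (r₂ - z / ω) - log (r₁ - z / ω) := by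
    apply intervalIntegral.integral_eq_sub_of_hasDerivAt (f := fun r : ℝ => log (r - z / ω))
    · intro r hr
      have h1 : HasDerivAt (fun s : ℝ => (s : ℂ) - z / ω) 1 r := by
        simpa using (ofRealCLM.hasDerivAt (x := r)).sub_const (z / ω)
      simpa using h1.clog_real (hsl r hr)
    · apply ContinuousOn.intervalIntegrable
      exact ContinuousOn.inv₀ (by fun_prop) hne
  rw [rayCauchyOn, ← intervalIntegral.integral_of_le h₁₂, ← hlog,
    ← intervalIntegral.integral_const_mul, ← intervalIntegral.integral_add]
  · apply intervalIntegral.integral_congr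
    intro r hr
    have h1 : ω * r - z = ω * (r - z / ω) := by rw [mul_sub, mul_div_cancel₀ _ h0]
    have h2 := hne r hr
    have h3 := sub_mul_diffQuot hf z (ω * r)
    rw [h1] at h3
    have h4 : f (ω * r) = ω * (r - z / ω) * diffQuot f z (ω * r) + f z := by
      linear_combination -h3
    simp only
    rw [h1, h4, mul_inv]
    have h5 : ω * ω⁻¹ = 1 := mul_inv_cancel₀ h0
    have h6 := mul_inv_cancel₀ h2
    linear_combination (((r : ℂ) - z / ω)⁻¹ * (ω * (r - z / ω) * diffQuot f z (ω * r) + f z)) * h5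
      + ω * diffQuot f z (ω * r) * h6
  · exact hq.intervalIntegrable _ _
  · apply ContinuousOn.intervalIntegrable
    exact continuousOn_const.mul (ContinuousOn.inv₀ (by fun_prop) hne)

lemma continuous_integral_diffQuot {f : ℂ → ℂ} (hf : Differentiable ℂ f) (ω : ℂ) (r₁ r₂ : ℝ) :
    Continuous fun z => ∫ r in r₁..r₂, ω * diffQuot f z (ω * r) := by
  apply intervalIntegral.continuous_parametric_intervalIntegral_of_continuous'
  have := continuous_diffQuot hf
  have h2 : Continuous fun q : ℂ × ℝ => diffQuot f q.1 (ω * q.2) :=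
    this.comp (f := fun q : ℂ × ℝ => (q.1, ω * q.2)) (by fun_prop)
  exact continuous_const.mul h2

/-- Up to the function `f(z) log(-z/ω)`, the Cauchy transform extends continuously to discs around
the origin. -/
lemma rayCauchy_eq_regular_sub_log {ω : ℂ} (hω : ‖ω‖ = 1) {f : ℂ → ℂ} (hf : StripDecay ω f)
    {R : ℝ} (hR : 0 < R) : ∃ K : ℂ → ℂ, (∀ z, ‖z‖ < R → ContinuousAt K z) ∧
      ∀ z, -(z / ω) ∈ slitPlane → rayCauchy ω f z = K z - f z * log (-(z / ω)) := by
  have h0 : ω ≠ 0 := norm_pos_iff.1 (by rw [hω]; exact one_pos)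
  -- The segment `[0, R]` contributes a difference quotient, which is regular, and the logarithms of
  -- its two ends. For `‖z‖ < R` the one at `R` stays in the slit plane and the tail keeps positive
  -- distance from `z`, so only the logarithm at the origin is singular.
  refine ⟨fun z => (∫ r in (0 : ℝ)..R, ω * diffQuot f z (ω * r)) + f z * log (R - z / ω) +
    rayCauchyOn (Set.Ioi R) ω f z, fun z hz => ?_, fun z hz => ?_⟩
  · have h1 : (R : ℂ) - z / ω ∈ slitPlane := by
      left
      rw [sub_re, ofReal_re]
      have := re_le_norm (z / ω)
      rw [norm_div, hω, div_one] at this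
      linarith
    have hfz : ContinuousAt f z := hf.differentiable.continuous.continuousAt
    have h2 : ContinuousAt (fun z => log ((R : ℂ) - z / ω)) z :=
      ContinuousAt.clog (by fun_prop) h1
    have h3 : ContinuousAt (rayCauchyOn (Set.Ioi R) ω f) z := by
      refine (differentiableAt_rayCauchyOn hf measurableSet_Ioi (Set.Ioi_subset_Ioi hR.le)
        (sub_pos.2 hz) fun r hr => ?_).continuousAt
      have h4 := norm_sub_norm_le (ω * r) z
      rw [norm_mul, hω, one_mul, norm_real, Real.norm_eq_abs] at h4
      have h5 := le_abs_self r
      have h6 : R < r := hr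
      linarith
    exact (((continuous_integral_diffQuot hf.differentiable ω 0 R).continuousAt).add
      (hfz.mul h2)).add h3
  · obtain ⟨δ, hδ, h⟩ := exists_le_norm_ray_sub hω hz
    have hcint := rayCauchy_integrableOn hf measurableSet_Ioi subset_rfl hδ fun r hr => h r hr.le
    have hsplit : rayCauchy ω f z = rayCauchyOn (Set.Ioc 0 R) ω f z +
        rayCauchyOn (Set.Ioi R) ω f z := by
      rw [rayCauchy_eq, rayCauchyOn, ← Set.Ioc_union_Ioi_eq_Ioi hR.le]
      exact setIntegral_union (Set.Ioc_disjoint_Ioi le_rfl) measurableSet_Ioi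
        (hcint.mono_set Set.Ioc_subset_Ioi_self) (hcint.mono_set (Set.Ioi_subset_Ioi hR.le))
    rw [hsplit, rayCauchyOn_Ioc hω hf.differentiable hz le_rfl hR.le]
    simp only [ofReal_zero, zero_sub]
    ring

/-- The one-sided boundary values of the Cauchy transform on the ray. -/
lemma rayCauchy_boundary {ω : ℂ} (hω : ‖ω‖ = 1) {f : ℂ → ℂ} (hf : StripDecay ω f) {x : ℂ}
    (him : (x / ω).im = 0) (hre : 0 < (x / ω).re) : ∃ K : ℂ,
      Tendsto (rayCauchy ω f) (𝓝[{z | 0 < (z / ω).im}] x) (𝓝 (K + Real.pi * I * f x)) ∧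
      Tendsto (rayCauchy ω f) (𝓝[{z | (z / ω).im < 0}] x) (𝓝 (K - Real.pi * I * f x)) := by
  obtain ⟨K, hK, hT⟩ := rayCauchy_eq_regular_sub_log hω hf (R := ‖x‖ + 1) (by positivity)
  have hKx := hK x (by linarith)
  have hfx : ContinuousAt f x := hf.differentiable.continuous.continuousAt
  have hcont : ContinuousAt (fun z : ℂ => -(z / ω)) x := by fun_prop
  have hre' : (-(x / ω)).re < 0 := by rw [neg_re]; linarith
  have him' : (-(x / ω)).im = 0 := by rw [neg_im, him, neg_zero]
  -- All of the jump sits in `-f(z) log(-z/ω)`: the imaginary part of the logarithm tends to `-π`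
  -- from the side `Im (z/ω) > 0` and to `π` from the other side.
  refine ⟨K x - f x * Real.log ‖-(x / ω)‖, ?_, ?_⟩
  · have hl := (tendsto_log_nhdsWithin_im_neg_of_re_neg_of_im_zero hre' him').comp
      (tendsto_nhdsWithin_iff.2 ⟨hcont.tendsto.mono_left nhdsWithin_le_nhds,
        (eventually_mem_nhdsWithin (a := x) (s := {z : ℂ | 0 < (z / ω).im})).mono
          fun z hz => by
            have hz' : 0 < (z / ω).im := hz
            rw [Set.mem_ofPred_eq, neg_im]; linarith⟩)
    have h2 := (hKx.tendsto.mono_left nhdsWithin_le_nhds).sub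
      ((hfx.tendsto.mono_left nhdsWithin_le_nhds).mul hl)
    convert h2.congr' ?_ using 2
    · ring
    · filter_upwards [self_mem_nhdsWithin] with z hz
      have hz' : 0 < (z / ω).im := hz
      exact (hT z (Or.inr (by rw [neg_im]; linarith))).symm
  · have hl := (tendsto_log_nhdsWithin_im_nonneg_of_re_neg_of_im_zero hre' him').comp
      (tendsto_nhdsWithin_iff.2 ⟨hcont.tendsto.mono_left nhdsWithin_le_nhds,
        (eventually_mem_nhdsWithin (a := x) (s := {z : ℂ | (z / ω).im < 0})).mono
          fun z hz => by
            have hz' : (z / ω).im < 0 := hz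
            rw [Set.mem_ofPred_eq, neg_im]; linarith⟩)
    have h2 := (hKx.tendsto.mono_left nhdsWithin_le_nhds).sub
      ((hfx.tendsto.mono_left nhdsWithin_le_nhds).mul hl)
    convert h2.congr' ?_ using 2
    · ring
    · filter_upwards [self_mem_nhdsWithin] with z hz
      have hz' : (z / ω).im < 0 := hz
      exact (hT z (Or.inr (by rw [neg_im]; linarith))).symm

lemma norm_log_le {w : ℂ} : ‖log w‖ ≤ |Real.log ‖w‖| + Real.pi := by
  have h := norm_le_abs_re_add_abs_im (log w)
  rw [log_re, log_im] at h
  exact h.trans (by linarith [abs_arg_le_pi w])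

/-- The singularities at the origin of the Cauchy transforms over two rays cancel. -/
lemma rayCauchy_sub_bounded_near_zero {ω₁ ω₂ : ℂ} (hω₁ : ‖ω₁‖ = 1) (hω₂ : ‖ω₂‖ = 1) {f : ℂ → ℂ}
    (hf₁ : StripDecay ω₁ f) (hf₂ : StripDecay ω₂ f) : ∃ M : ℝ, ∀ᶠ z in 𝓝 0,
      -(z / ω₁) ∈ slitPlane → -(z / ω₂) ∈ slitPlane →
        ‖rayCauchy ω₁ f z - rayCauchy ω₂ f z‖ ≤ M := by
  obtain ⟨K₁, hK₁, h₁⟩ := rayCauchy_eq_regular_sub_log hω₁ hf₁ one_pos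
  obtain ⟨K₂, hK₂, h₂⟩ := rayCauchy_eq_regular_sub_log hω₂ hf₂ one_pos
  have hK : ContinuousAt (fun z => ‖K₁ z - K₂ z‖ + ‖f z‖ * (2 * Real.pi)) 0 :=
    ((hK₁ 0 (by simp)).sub (hK₂ 0 (by simp))).norm.add
      (hf₁.differentiable.continuous.continuousAt.norm.mul continuousAt_const)
  refine ⟨‖K₁ 0 - K₂ 0‖ + ‖f 0‖ * (2 * Real.pi) + 1, ?_⟩
  filter_upwards [hK.eventually_le_const (lt_add_one _)] with z hz hz1 hz2
  refine le_trans ?_ hz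
  rw [h₁ z hz1, h₂ z hz2]
  -- As `‖ω₁‖ = ‖ω₂‖ = 1`, the two logarithms have the same real part and only their arguments
  -- differ.
  have hlog : ‖log (-(z / ω₁)) - log (-(z / ω₂))‖ ≤ 2 * Real.pi := by
    have hre : (log (-(z / ω₁)) - log (-(z / ω₂))).re = 0 := by
      rw [sub_re, log_re, log_re, norm_neg, norm_neg, norm_div, norm_div, hω₁, hω₂, sub_self]
    have h := norm_le_abs_re_add_abs_im (log (-(z / ω₁)) - log (-(z / ω₂)))
    rw [hre, abs_zero, zero_add, sub_im, log_im, log_im] at h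
    have h3 := abs_sub (-(z / ω₁)).arg (-(z / ω₂)).arg
    linarith [abs_arg_le_pi (-(z / ω₁)), abs_arg_le_pi (-(z / ω₂))]
  have : K₁ z - f z * log (-(z / ω₁)) - (K₂ z - f z * log (-(z / ω₂))) =
      (K₁ z - K₂ z) - f z * (log (-(z / ω₁)) - log (-(z / ω₂))) := by ring
  rw [this]
  refine (norm_sub_le _ _).trans ?_
  rw [norm_mul]
  gcongr

lemma norm_rayCauchyOn_le {ω : ℂ} (hω : ‖ω‖ = 1) {f : ℂ → ℂ} {B : ℝ}
    (hB : ∀ r : ℝ, 0 ≤ r → ‖f (ω * r)‖ ≤ B * Real.exp (-r)) {S : Set ℝ} (hS : MeasurableSet S)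
    (hS0 : S ⊆ Set.Ioi 0) {z : ℂ} (h : ∀ r ∈ S, 1 ≤ ‖ω * r - z‖) :
    ‖rayCauchyOn S ω f z‖ ≤ B := by
  have hB0 : 0 ≤ B := by simpa using (norm_nonneg _).trans (hB 0 le_rfl)
  have h1 : ‖rayCauchyOn S ω f z‖ ≤ ∫ r in S, B * Real.exp (-r) := by
    apply norm_integral_le_of_norm_le ((integrableOn_exp_neg.mono_set hS0).const_mul B)
    refine (ae_restrict_iff' hS).2 (ae_of_all _ fun r hr => ?_)
    rw [norm_mul, hω, one_mul, norm_mul, norm_inv]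
    have h2 := hB r (hS0 hr).le
    have h3 : ‖ω * r - z‖⁻¹ ≤ 1 := inv_le_one_of_one_le₀ (h r hr)
    calc _ ≤ 1 * (B * Real.exp (-r)) := mul_le_mul h3 h2 (norm_nonneg _) zero_le_one
      _ = _ := one_mul _
  have h2 : ∫ r in S, B * Real.exp (-r) ≤ ∫ r in Set.Ioi (0 : ℝ), B * Real.exp (-r) := by
    apply setIntegral_mono_set (integrableOn_exp_neg.const_mul B)
    · exact ae_of_all _ fun r => by positivity
    · exact LE.le.eventuallyLE hS0
  have h3 : ∫ r in Set.Ioi (0 : ℝ), B * Real.exp (-r) = B := by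
    rw [integral_const_mul, integral_exp_neg_Ioi_zero, mul_one]
  exact h1.trans (h2.trans_eq h3)

/-- The Cauchy transform is bounded away from the origin, uniformly up to the ray. -/
lemma rayCauchy_bounded {ω : ℂ} (hω : ‖ω‖ = 1) {f : ℂ → ℂ} (hf : StripDecay ω f) :
    ∃ M : ℝ, ∀ z, 2 ≤ ‖z‖ → -(z / ω) ∈ slitPlane → ‖rayCauchy ω f z‖ ≤ M := by
  have h0 : ω ≠ 0 := norm_pos_iff.1 (by rw [hω]; exact one_pos)
  obtain ⟨B, hB, hbd⟩ := hf.bound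
  have hray : ∀ r : ℝ, 0 ≤ r → ‖f (ω * r)‖ ≤ B * Real.exp (-r) := fun r hr => by
    simpa using (hbd r 0 hr (by simp)).1
  have hstrip : ∀ α β : ℝ, 0 ≤ α → |β| ≤ 1 →
      ‖f (ω * (α + β * I))‖ ≤ B ∧ ‖deriv f (ω * (α + β * I))‖ ≤ B := by
    intro α β hα hβ
    have h1 : Real.exp (-α) ≤ 1 := Real.exp_le_one_iff.2 (by linarith)
    have h2 : B * Real.exp (-α) ≤ B := mul_le_of_le_one_right hB h1
    exact ⟨(hbd α β hα hβ).1.trans h2, (hbd α β hα hβ).2.trans h2⟩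
  refine ⟨B + (2 * B + B * (2 * (Real.log 2 + Real.pi))) + B, fun z hz hsl => ?_⟩
  have hlogpos : 0 ≤ Real.log 2 := Real.log_nonneg (by norm_num)
  have hpi := Real.pi_pos
  by_cases hfar : ∀ r ∈ Set.Ioi (0 : ℝ), 1 ≤ ‖ω * r - z‖
  · have := norm_rayCauchyOn_le hω hray measurableSet_Ioi subset_rfl hfar
    rw [rayCauchy_eq]
    have h1 : 0 ≤ B * (2 * (Real.log 2 + Real.pi)) := by positivity
    linarith
  push Not at hfar
  obtain ⟨r', hr', hnear⟩ := hfar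
  replace hr' : 0 < r' := hr'
  rw [norm_ray_sub hω] at hnear
  set a := z / ω with ha
  have hza : z = ω * a := (mul_div_cancel₀ z h0).symm
  have hna : 2 ≤ ‖a‖ := by rw [ha, norm_div, hω, div_one]; exact hz
  have him : |a.im| ≤ 1 := by
    have := abs_im_le_norm ((r' : ℂ) - a)
    rw [sub_im, ofReal_im, zero_sub, abs_neg] at this
    linarith
  have hre1 : -1 < a.re := by
    have := (abs_le.1 (abs_re_le_norm ((r' : ℂ) - a))).2
    rw [sub_re, ofReal_re] at this
    have h2 := (abs_le.1 (abs_re_le_norm ((r' : ℂ) - a))).1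
    rw [sub_re, ofReal_re] at h2
    linarith
  -- Here `‖z‖ ≥ 2` is needed: it makes the window `[α - 1, α + 1]` below lie in `[0, ∞)`.
  have hre : 1 ≤ a.re := by
    have h1 := norm_le_abs_re_add_abs_im a
    have h2 : 1 ≤ |a.re| := by linarith
    rcases le_abs.1 h2 with h | h
    · exact h
    · linarith
  set α := a.re with hα
  set β := a.im with hβ
  have haeq : a = α + β * I := (re_add_im a).symm
  obtain ⟨δ, hδ, hdist⟩ := exists_le_norm_ray_sub hω hsl
  have hcint := rayCauchy_integrableOn hf measurableSet_Ioi subset_rfl hδ fun r hr => hdist r hr.le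
  -- Outside the window of radius `1` around the projection of `z` the kernel is at most `1`. Inside
  -- it the singular part is `f z` times logarithms of numbers with real part `±1`, bounded
  -- uniformly up to the ray.
  have hsplit : rayCauchy ω f z = rayCauchyOn (Set.Ioc 0 (α - 1)) ω f z +
      rayCauchyOn (Set.Ioc (α - 1) (α + 1)) ω f z + rayCauchyOn (Set.Ioi (α + 1)) ω f z := by
    have e1 : Set.Ioi (0 : ℝ) = Set.Ioc 0 (α + 1) ∪ Set.Ioi (α + 1) :=
      (Set.Ioc_union_Ioi_eq_Ioi (by linarith)).symm
    have e2 : Set.Ioc (0 : ℝ) (α + 1) = Set.Ioc 0 (α - 1) ∪ Set.Ioc (α - 1) (α + 1) :=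
      (Set.Ioc_union_Ioc_eq_Ioc (by linarith) (by linarith)).symm
    rw [rayCauchy_eq, rayCauchyOn, e1, setIntegral_union (Set.Ioc_disjoint_Ioi le_rfl)
      measurableSet_Ioi (hcint.mono_set Set.Ioc_subset_Ioi_self)
      (hcint.mono_set (Set.Ioi_subset_Ioi (by linarith))), e2, setIntegral_union
      (Set.Ioc_disjoint_Ioc_of_le le_rfl) measurableSet_Ioc
      (hcint.mono_set Set.Ioc_subset_Ioi_self)
      (hcint.mono_set (Set.Ioc_subset_Ioi_self.trans (Set.Ioi_subset_Ioi (by linarith))))]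
    rfl
  have hdist1 : ∀ r : ℝ, 1 ≤ |r - α| → 1 ≤ ‖ω * r - z‖ := by
    intro r hr
    rw [norm_ray_sub hω]
    refine hr.trans ?_
    simpa using abs_re_le_norm ((r : ℂ) - a)
  have b1 : ‖rayCauchyOn (Set.Ioc 0 (α - 1)) ω f z‖ ≤ B :=
    norm_rayCauchyOn_le hω hray measurableSet_Ioc Set.Ioc_subset_Ioi_self fun r hr =>
      hdist1 r (by rw [abs_sub_comm]; exact le_trans (by linarith [hr.2]) (le_abs_self _))
  have b3 : ‖rayCauchyOn (Set.Ioi (α + 1)) ω f z‖ ≤ B :=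
    norm_rayCauchyOn_le hω hray measurableSet_Ioi (Set.Ioi_subset_Ioi (by linarith)) fun r hr =>
      hdist1 r (le_trans (by have : α + 1 < r := hr
                             linarith) (le_abs_self _))
  have b2 : ‖rayCauchyOn (Set.Ioc (α - 1) (α + 1)) ω f z‖ ≤
      2 * B + B * (2 * (Real.log 2 + Real.pi)) := by
    rw [rayCauchyOn_Ioc hω hf.differentiable hsl (by linarith) (by linarith)]
    refine (norm_add_le _ _).trans (add_le_add ?_ ?_)
    · have h1 : ∀ r ∈ Set.uIoc (α - 1) (α + 1), ‖ω * diffQuot f z (ω * r)‖ ≤ B := by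
        intro r hr
        rw [Set.uIoc_of_le (by linarith)] at hr
        rw [norm_mul, hω, one_mul, diffQuot]
        have h2 : ∀ s ∈ Set.uIoc (0 : ℝ) 1, ‖deriv f (z + s * (ω * r - z))‖ ≤ B := by
          intro s hs
          rw [Set.uIoc_of_le zero_le_one] at hs
          -- The segment from `z` to `ω r` stays in the half strip where `f'` is controlled: its
          -- abscissa is at least `α - 1 ≥ 0` and its height shrinks by `1 - s`.
          have h3 : z + s * (ω * r - z) =
              ω * (((α + s * (r - α) : ℝ) : ℂ) + (((1 - s) * β : ℝ) : ℂ) * I) := by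
            rw [hza, haeq]; push_cast; ring
          rw [h3]
          refine (hstrip _ _ ?_ ?_).2
          · have h4 : -1 ≤ s * (r - α) := by nlinarith [hs.1, hs.2, hr.1, hr.2]
            linarith
          · rw [abs_mul, abs_of_nonneg (by linarith [hs.2] : (0 : ℝ) ≤ 1 - s)]
            nlinarith [hs.1, hs.2, abs_nonneg β]
        simpa using intervalIntegral.norm_integral_le_of_norm_le_const h2
      have := intervalIntegral.norm_integral_le_of_norm_le_const h1
      rw [show α + 1 - (α - 1) = 2 by ring, abs_two] at this
      linarith
    · rw [norm_mul]
      have h1 : ‖f z‖ ≤ B := by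
        rw [hza, haeq]; exact (hstrip α β (by linarith) him).1
      have h2 : ∀ w : ℂ, |w.re| = 1 → |w.im| ≤ 1 → ‖log w‖ ≤ Real.log 2 + Real.pi := by
        intro w hw1 hw2
        refine norm_log_le.trans (add_le_add ?_ le_rfl)
        have h3 : 1 ≤ ‖w‖ := hw1 ▸ abs_re_le_norm w
        have h4 : ‖w‖ ≤ 2 := (norm_le_abs_re_add_abs_im w).trans (by linarith)
        rw [abs_of_nonneg (Real.log_nonneg h3)]
        exact Real.log_le_log (by linarith) h4
      have h3 : ‖log (((α + 1 : ℝ) : ℂ) - z / ω) - log (((α - 1 : ℝ) : ℂ) - z / ω)‖ ≤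
          2 * (Real.log 2 + Real.pi) := by
        refine (norm_sub_le _ _).trans ?_
        have h4 := h2 (((α + 1 : ℝ) : ℂ) - z / ω)
          (by rw [sub_re, ofReal_re, ← ha, ← hα]; simp)
          (by rw [sub_im, ofReal_im, ← ha, ← hβ, zero_sub, abs_neg]; exact him)
        have h5 := h2 (((α - 1 : ℝ) : ℂ) - z / ω)
          (by rw [sub_re, ofReal_re, ← ha, ← hα]; simp)
          (by rw [sub_im, ofReal_im, ← ha, ← hβ, zero_sub, abs_neg]; exact him)
        linarith
      exact mul_le_mul h1 h3 (norm_nonneg _) hB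
  rw [hsplit]
  exact (norm_add_le _ _).trans (add_le_add ((norm_add_le _ _).trans (add_le_add b1 b2)) b3)

/-! ### Moments over the contours -/

/-- The moment `∫ p e^{-Q} dx` over the contour `Γ_k`. -/
def mom (D : ℕ) (Q : ℝ[X]) (k : ℕ) (p : ℂ[X]) : ℂ :=
  rayInt (rt D 0) (dens Q p) - rayInt (rt D k) (dens Q p)

lemma dens_add (Q : ℝ[X]) (p q : ℂ[X]) (x : ℂ) : dens Q (p + q) x = dens Q p x + dens Q q x := by
  simp [dens, add_mul]

lemma dens_smul (Q : ℝ[X]) (c : ℂ) (p : ℂ[X]) (x : ℂ) : dens Q (c • p) x = c * dens Q p x := by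
  simp [dens, mul_assoc]

lemma rayInt_dens_add {D : ℕ} (hD : 2 ≤ D) {Q : ℝ[X]} (hQ : Confining D Q) {ω : ℂ}
    (hω : ω ^ D = 1) (p q : ℂ[X]) :
    rayInt ω (dens Q (p + q)) = rayInt ω (dens Q p) + rayInt ω (dens Q q) := by
  simp only [rayInt, dens_add, mul_add]
  exact integral_add (stripDecay_dens hD hQ hω p).integrableOn
    (stripDecay_dens hD hQ hω q).integrableOn

lemma rayInt_dens_smul (Q : ℝ[X]) (ω c : ℂ) (p : ℂ[X]) :
    rayInt ω (dens Q (c • p)) = c * rayInt ω (dens Q p) := by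
  simp only [rayInt, dens_smul, mul_left_comm ω c]
  exact integral_const_mul _ _

/-- The moment functional as a linear map. -/
def momL {D : ℕ} (hD : 2 ≤ D) {Q : ℝ[X]} (hQ : Confining D Q) (k : ℕ) : ℂ[X] →ₗ[ℂ] ℂ where
  toFun := mom D Q k
  map_add' p q := by
    rw [mom, rayInt_dens_add hD hQ (rt_pow_self (by omega) 0),
      rayInt_dens_add hD hQ (rt_pow_self (by omega) k), mom, mom]
    ring
  map_smul' c p := by
    simp only [mom, rayInt_dens_smul, RingHom.id_apply, smul_eq_mul]
    ring

lemma momL_apply {D : ℕ} (hD : 2 ≤ D) {Q : ℝ[X]} (hQ : Confining D Q) (k : ℕ) (p : ℂ[X]) :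
    momL hD hQ k p = mom D Q k p := rfl

lemma mom_twist {D : ℕ} (hD : 2 ≤ D) {Q : ℝ[X]} (hQ : Confining D Q) (k : ℕ) (p : ℂ[X]) :
    mom D Q k (twist Q p) = 0 := by
  rw [mom, rayInt_twist hD hQ (rt_pow_self (by omega) 0),
    rayInt_twist hD hQ (rt_pow_self (by omega) k), sub_self]

lemma hasDerivAt_mom {D : ℕ} (hD : 2 ≤ D) {Q W : ℝ[X]} (hQ : Confining D Q)
    (hW : W.natDegree < D) (k : ℕ) (p : ℂ[X]) (s : ℝ) :
    HasDerivAt (fun s : ℝ => mom D (Q + C s * W) k p)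
      (-mom D (Q + C s * W) k (W.map (algebraMap ℝ ℂ) * p)) s := by
  have h : ∀ k, HasDerivAt (fun s : ℝ => rayInt (rt D k) (dens (Q + C s * W) p))
      (-rayInt (rt D k) (dens (Q + C s * W) (W.map (algebraMap ℝ ℂ) * p))) s := fun k => by
    simpa using hasDerivAt_rayInt hD hQ hW (rt_pow_self (by omega) k) p (g := fun _ => 1)
      aestronglyMeasurable_const (M := 1) (by simp) s
  refine ((h 0).sub (h k)).congr_deriv ?_
  simp only [mom]; ring

/-! ### Reduction modulo exact forms -/

lemma twist_add (Q : ℝ[X]) (p q : ℂ[X]) : twist Q (p + q) = twist Q p + twist Q q := by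
  simp [twist]; ring

lemma twist_sub (Q : ℝ[X]) (p q : ℂ[X]) : twist Q (p - q) = twist Q p - twist Q q := by
  simp [twist]; ring

lemma twist_smul (Q : ℝ[X]) (c : ℂ) (p : ℂ[X]) : twist Q (c • p) = c • twist Q p := by
  simp [twist, smul_sub]

lemma degree_derivative_potential {D : ℕ} (hD : 2 ≤ D) {Q : ℝ[X]} (hQ : Confining D Q) :
    ((derivative Q).map (algebraMap ℝ ℂ)).degree = ((D - 1 : ℕ) : WithBot ℕ) := by
  rw [degree_map, degree_derivative (by rw [hQ.natDegree_eq]; omega), hQ.natDegree_eq]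

/-- Every polynomial is, modulo `q' - Q' q`, of degree less than `D - 1`. -/
lemma exists_twist_add {D : ℕ} (hD : 2 ≤ D) {Q : ℝ[X]} (hQ : Confining D Q) (N : ℕ) :
    ∀ p : ℂ[X], p.degree < N → ∃ q r : ℂ[X], p = twist Q q + r ∧
      q.degree < ((N - (D - 1) : ℕ) : WithBot ℕ) ∧ r.degree < ((D - 1 : ℕ) : WithBot ℕ) := by
  induction N with
  | zero =>
    intro p hp
    have : p = 0 := by
      rw [← degree_eq_bot]
      simpa using hp
    subst this
    exact ⟨0, 0, by simp [twist], by simp, by simp⟩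
  | succ N ih =>
    intro p hp
    set Q' := (derivative Q).map (algebraMap ℝ ℂ) with hQ'
    have hQ'd : Q'.degree = ((D - 1 : ℕ) : WithBot ℕ) := degree_derivative_potential hD hQ
    have hQ'0 : Q' ≠ 0 := by
      intro h; rw [h, degree_zero] at hQ'd; exact absurd hQ'd.symm (WithBot.coe_ne_bot)
    -- Division by `Q'` gives `p = Q' u + (p % Q') = -twist Q u + u' + (p % Q')`. The only term
    -- still to be reduced is `u'`, which satisfies the degree bound `N` of the induction
    -- hypothesis.
    set u := p / Q' with hu
    have hud : u.degree < ((N + 1 - (D - 1) : ℕ) : WithBot ℕ) := by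
      by_cases h : Q'.degree ≤ p.degree
      · have h1 := degree_add_div hQ'0 h
        by_cases hu0 : u = 0
        · rw [hu0, degree_zero]; exact WithBot.bot_lt_coe _
        · rw [← hu, hQ'd, degree_eq_natDegree hu0] at h1
          rw [← h1] at hp
          rw [degree_eq_natDegree hu0]
          have h2 : D - 1 + u.natDegree < N + 1 := by exact_mod_cast hp
          exact_mod_cast (by omega : u.natDegree < N + 1 - (D - 1))
      · have : u = 0 := (Polynomial.div_eq_zero_iff hQ'0).2 (not_le.1 h)
        rw [this, degree_zero]; exact WithBot.bot_lt_coe _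
    have hu'd : (derivative u).degree < ((N - (D - 1) : ℕ) : WithBot ℕ) ∨ derivative u = 0 := by
      by_cases h : derivative u = 0
      · exact Or.inr h
      · left
        have hu0 : u ≠ 0 := by rintro h0; exact h (by rw [h0, derivative_zero])
        have h1 := degree_derivative_lt hu0
        rw [degree_eq_natDegree hu0] at h1 hud
        rw [degree_eq_natDegree h] at h1 ⊢
        have h2 : u.natDegree < N + 1 - (D - 1) := by exact_mod_cast hud
        have h3 : (derivative u).natDegree < u.natDegree := by exact_mod_cast h1
        exact_mod_cast (by omega : (derivative u).natDegree < N - (D - 1))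
    have hu'N : (derivative u).degree < N := by
      rcases hu'd with h | h
      · exact h.trans_le (by exact_mod_cast Nat.sub_le _ _)
      · rw [h, degree_zero]; exact WithBot.bot_lt_coe _
    obtain ⟨q₁, r₁, h1, h2, h3⟩ := ih (derivative u) hu'N
    refine ⟨q₁ - u, r₁ + p % Q', ?_, ?_, ?_⟩
    · have hdm := EuclideanDomain.div_add_mod p Q'
      rw [← hu] at hdm
      have htu : twist Q u = derivative u - Q' * u := rfl
      rw [twist_sub, htu]
      linear_combination -hdm + h1
    · refine (degree_sub_le _ _).trans_lt (max_lt (h2.trans_le ?_) hud)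
      exact_mod_cast (by omega : N - (D - 1) ≤ N + 1 - (D - 1))
    · refine (degree_add_le _ _).trans_lt (max_lt h3 ?_)
      rw [← hQ'd]
      exact degree_mod_lt p hQ'0

/-- A functional vanishing on all `q' - Q' q` is controlled by its first `D - 1` moments,
uniformly for `Q = aX^D + sW`, `|s| ≤ 1`. -/
lemma exists_bound_of_vanish_twist {d : ℕ} {a : ℝ} (ha : 0 < a) {W : ℝ[X]}
    (hW : W.natDegree < d + 2) (N : ℕ) :
    ∃ K : ℝ, 0 ≤ K ∧ ∀ s : ℝ, |s| ≤ 1 → ∀ L : ℂ[X] →ₗ[ℂ] ℂ,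
      (∀ q, L (twist (C a * X ^ (d + 2) + C s * W) q) = 0) → ∀ Y : ℝ,
        (∀ l < d + 1, ‖L (X ^ l)‖ ≤ Y) → ‖L (X ^ N)‖ ≤ K * Y := by
  induction N using Nat.strong_induction_on with
  | _ N ih =>
  by_cases hN : N < d + 1
  · exact ⟨1, zero_le_one, fun s _ L _ Y hY => by simpa using hY N hN⟩
  obtain ⟨m, rfl⟩ : ∃ m, N = d + 1 + m := ⟨N - (d + 1), by omega⟩
  choose! K hK0 hK using ih
  set c := ((d + 2 : ℕ) : ℝ) * a with hc
  have hc0 : 0 < c := by positivity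
  set W' := derivative W with hW'
  -- Applying the functional to the twist of `X^m` expresses `c X^(d+1+m)` through the lower powers
  -- `X^(m-1)` and `X^(i+m)`, `i ≤ d`. The truncated `m - 1` at `m = 0` is harmless, as its
  -- coefficient is `m`.
  refine ⟨c⁻¹ * (m * K (m - 1) + ∑ i ∈ Finset.range (d + 1), |W'.coeff i| * K (i + m)), ?_, ?_⟩
  · have h1 : 0 ≤ (m : ℝ) * K (m - 1) := by
      rcases Nat.eq_zero_or_pos m with h | h
      · simp [h]
      · exact mul_nonneg (Nat.cast_nonneg _) (hK0 _ (by omega))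
    have h2 : 0 ≤ ∑ i ∈ Finset.range (d + 1), |W'.coeff i| * K (i + m) :=
      Finset.sum_nonneg fun i hi => mul_nonneg (abs_nonneg _)
        (hK0 _ (by have := Finset.mem_range.1 hi; omega))
    positivity
  intro s hs L hL Y hY
  have hY0 : 0 ≤ Y := (norm_nonneg _).trans (hY 0 (by omega))
  have hW'd : W'.natDegree < d + 1 := by
    rcases Nat.eq_zero_or_pos W.natDegree with h | h
    · rw [hW', natDegree_eq_zero.1 h |>.choose_spec.symm]; simp
    · have := natDegree_derivative_lt (p := W) (by omega)
      rw [hW']; omega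
  have hpoly : twist (C a * X ^ (d + 2) + C s * W) (X ^ m) =
      (m : ℂ) • X ^ (m - 1) - ((c : ℂ) • X ^ (d + 1 + m) +
        ∑ i ∈ Finset.range (d + 1), ((s * W'.coeff i : ℝ) : ℂ) • (X ^ (i + m) : ℂ[X])) := by
    have e1 : W'.map (algebraMap ℝ ℂ) =
        ∑ i ∈ Finset.range (d + 1), C ((W'.coeff i : ℝ) : ℂ) * X ^ i := by
      conv_lhs => rw [W'.as_sum_range' (d + 1) hW'd]
      simp [Polynomial.map_sum, ← C_mul_X_pow_eq_monomial]
    have e2 : (derivative (C a * X ^ (d + 2) + C s * W)).map (algebraMap ℝ ℂ) =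
        C (c : ℂ) * X ^ (d + 1) + C (s : ℂ) * W'.map (algebraMap ℝ ℂ) := by
      simp only [derivative_add, derivative_C_mul, derivative_X_pow, Polynomial.map_add,
        Polynomial.map_mul, map_C, Polynomial.map_pow, map_X, hc, hW', coe_algebraMap]
      push_cast
      simp only [map_mul, map_add, map_natCast, map_ofNat]
      ring
    rw [twist, e2, e1, derivative_X_pow, smul_eq_C_mul, smul_eq_C_mul, add_mul, Finset.mul_sum,
      Finset.sum_mul]
    congr 2
    · ring
    · refine Finset.sum_congr rfl fun i _ => ?_
      rw [smul_eq_C_mul]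
      push_cast
      rw [C_mul]; ring
  have h0 := hL (X ^ m)
  rw [hpoly, map_sub, map_add, map_sum, map_smul, map_smul] at h0
  simp only [map_smul, smul_eq_mul] at h0
  have hmain : (c : ℂ) * L (X ^ (d + 1 + m)) = m * L (X ^ (m - 1)) -
      ∑ i ∈ Finset.range (d + 1), ((s * W'.coeff i : ℝ) : ℂ) * L (X ^ (i + m)) := by
    linear_combination -h0
  have hn : c * ‖L (X ^ (d + 1 + m))‖ ≤
      (m * K (m - 1) + ∑ i ∈ Finset.range (d + 1), |W'.coeff i| * K (i + m)) * Y := by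
    have e : ‖(c : ℂ) * L (X ^ (d + 1 + m))‖ = c * ‖L (X ^ (d + 1 + m))‖ := by
      rw [norm_mul, norm_real, Real.norm_eq_abs, abs_of_pos hc0]
    rw [← e, hmain, add_mul, Finset.sum_mul]
    refine (norm_sub_le _ _).trans (add_le_add ?_ ((norm_sum_le _ _).trans
      (Finset.sum_le_sum fun i hi => ?_)))
    · rw [norm_mul, Complex.norm_natCast, mul_assoc]
      rcases Nat.eq_zero_or_pos m with h | h
      · simp [h]
      · exact mul_le_mul_of_nonneg_left (hK _ (by omega) s hs L hL Y hY) (Nat.cast_nonneg _)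
    · have hi' := Finset.mem_range.1 hi
      rw [norm_mul, norm_real, Real.norm_eq_abs, abs_mul]
      have h1 := hK (i + m) (by omega) s hs L hL Y hY
      calc |s| * |W'.coeff i| * ‖L (X ^ (i + m))‖
          ≤ 1 * |W'.coeff i| * (K (i + m) * Y) := by gcongr
        _ = _ := by ring
  rw [mul_assoc, inv_mul_eq_div, le_div_iff₀ hc0]
  linarith

/-! ### Nondegeneracy of the moments over `Γ_1, …, Γ_{D-1}` -/

lemma rt_injective {D : ℕ} (hD : 2 ≤ D) : Function.Injective fun k : Fin D => rt D k := by
  have h1 := Complex.isPrimitiveRoot_exp D (by omega)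
  have h2 : ∀ k : ℕ, rt D k = exp (2 * Real.pi * I / D) ^ k := by
    intro k
    rw [← exp_nat_mul, rt]
    congr 1; ring
  intro i j hij
  simp only [h2] at hij
  exact Fin.ext (h1.pow_inj i.2 j.2 hij)

/-- On the ray `ω [0, ∞)` with `ω^D = 1` the weight `e^{-aX^D}` does not see `ω`, so the integral of
`X^l` is `ω^(l+1)` times the positive number `∫ r^l e^{-a r^D} dr`. -/
lemma mom_monomial {D : ℕ} (hD : 2 ≤ D) {a : ℝ} (ha : 0 < a) (l : ℕ) :
    ∃ c : ℂ, c ≠ 0 ∧ ∀ k, mom D (C a * X ^ D) k (X ^ l) = c * (1 - rt D k ^ (l + 1)) := by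
  have hQ : Confining D (C a * X ^ D) := by
    refine ⟨natDegree_C_mul_X_pow D a ha.ne', ?_⟩
    rw [leadingCoeff_C_mul_X_pow]; exact ha
  set c : ℝ := ∫ r in Set.Ioi (0 : ℝ), r ^ l * Real.exp (-(a * r ^ D)) with hc
  have hcr : (c : ℂ) = ∫ r in Set.Ioi (0 : ℝ), dens (C a * X ^ D) (X ^ l) r := by
    rw [hc, ← integral_complex_ofReal]
    refine integral_congr_ae (ae_of_all _ fun r => ?_)
    simp [dens]
  have hray : ∀ k, rayInt (rt D k) (dens (C a * X ^ D) (X ^ l)) = rt D k ^ (l + 1) * c := by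
    intro k
    rw [rayInt, hcr, ← integral_const_mul]
    refine integral_congr_ae (ae_of_all _ fun r => ?_)
    have h1 := rt_pow_self (D := D) (by omega) k
    simp only [dens, map_mul, aeval_C, map_pow, aeval_X, eval_pow, eval_X, mul_pow, h1, one_mul]
    ring
  have hcint : IntegrableOn (fun r : ℝ => r ^ l * Real.exp (-(a * r ^ D))) (Set.Ioi 0) := by
    have h1 := (stripDecay_dens hD hQ (ω := 1) (by simp) (X ^ l)).integrableOn.re
    refine h1.congr (ae_of_all _ fun r => ?_)
    have : (1 : ℂ) * dens (C a * X ^ D) (X ^ l) (1 * r) =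
        ((r ^ l * Real.exp (-(a * r ^ D)) : ℝ) : ℂ) := by
      simp [dens]
    simp only [this]
    exact ofReal_re _
  have hpos : 0 < c := by
    rw [hc, setIntegral_pos_iff_support_of_nonneg_ae]
    · have : Set.Ioi (0 : ℝ) ⊆ Function.support (fun r : ℝ => r ^ l * Real.exp (-(a * r ^ D))) ∩
          Set.Ioi 0 := fun r hr => by
        have hr' : (0 : ℝ) < r := hr
        exact ⟨by simp [hr'.ne'], hr⟩
      refine lt_of_lt_of_le ?_ (measure_mono this)
      simp
    · refine (ae_restrict_iff' measurableSet_Ioi).2 (ae_of_all _ fun r hr => ?_)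
      have hr' : (0 : ℝ) < r := hr
      simp only [Pi.zero_apply]
      positivity
    · exact hcint
  refine ⟨c, by exact_mod_cast hpos.ne', fun k => ?_⟩
  rw [mom, hray, hray, rt_zero]
  ring

/-- The functionals `p ↦ ∫_{Γ_k} p e^{-aX^D}`, `1 ≤ k < D`, are independent on polynomials of
degree at most `D - 2`. -/
lemma monomial_moments_independent {d : ℕ} {a : ℝ} (ha : 0 < a) (u : Fin (d + 1) → ℂ)
    (h : ∀ l < d + 1, ∑ j, u j * mom (d + 2) (C a * X ^ (d + 2)) (j + 1) (X ^ l) = 0) : u = 0 := by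
  -- Giving the ray `C_0` the weight `-∑ u_j` makes the zeroth power sum vanish as well, so all `D`
  -- power sums at the `D` distinct roots of unity vanish and Vandermonde applies.
  set U : Fin (d + 2) → ℂ := Fin.cons (-∑ j, u j) u with hU
  have hz : U = 0 := by
    apply Matrix.eq_zero_of_forall_pow_sum_mul_pow_eq_zero (rt_injective (D := d + 2) (by omega))
    intro i
    rw [Fin.sum_univ_succ]
    simp only [hU, Fin.cons_zero, Fin.cons_succ, Fin.val_zero, Fin.val_succ, rt_zero, one_pow,
      mul_one]
    rcases Nat.eq_zero_or_pos (i : ℕ) with hi | hi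
    · simp [hi]
    · obtain ⟨l, hl⟩ : ∃ l, (i : ℕ) = l + 1 := ⟨i - 1, by omega⟩
      obtain ⟨c, hc, hm⟩ := mom_monomial (D := d + 2) (by omega) ha l
      have h1 := h l (by omega)
      simp only [hm] at h1
      have h2 : c * ∑ j, u j * (1 - rt (d + 2) (j + 1) ^ (l + 1)) = 0 := by
        rw [← h1, Finset.mul_sum]
        exact Finset.sum_congr rfl fun j _ => by ring
      have h3 := (mul_eq_zero.1 h2).resolve_left hc
      simp only [mul_sub, mul_one, Finset.sum_sub_distrib] at h3
      rw [hl]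
      linear_combination -h3
  ext j
  have := congrFun hz j.succ
  simpa [hU] using this

/-- The functionals `p ↦ ∫_{Γ_k} p e^{-Q}`, `1 ≤ k < D`, are independent on polynomials of degree
at most `D - 2`. -/
lemma moments_independent {d : ℕ} {Q : ℝ[X]} (hQ : Confining (d + 2) Q) (u : Fin (d + 1) → ℂ)
    (h : ∀ l < d + 1, ∑ j, u j * mom (d + 2) Q (j + 1) (X ^ l) = 0) : u = 0 := by
  have hD : 2 ≤ d + 2 := by omega
  set a := Q.leadingCoeff with ha_def
  have ha : 0 < a := hQ.lead_pos
  set W := Q.eraseLead with hWdef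
  have hW : W.natDegree < d + 2 := by
    have := eraseLead_natDegree_le Q
    rw [hQ.natDegree_eq] at this
    rw [hWdef]; omega
  have hQ0 : Confining (d + 2) (C a * X ^ (d + 2)) := by
    refine ⟨natDegree_C_mul_X_pow _ a ha.ne', ?_⟩
    rw [leadingCoeff_C_mul_X_pow]; exact ha
  have hQ1 : Q = C a * X ^ (d + 2) + C 1 * W := by
    conv_lhs => rw [← eraseLead_add_C_mul_X_pow Q, hQ.natDegree_eq]
    rw [C_1, one_mul, add_comm]
  set L : ℝ → ℂ[X] →ₗ[ℂ] ℂ := fun s => ∑ j : Fin (d + 1), u j • momL hD (hQ0.add hW s) (j + 1)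
    with hLdef
  have hLapp : ∀ s p, L s p =
      ∑ j : Fin (d + 1), u j * mom (d + 2) (C a * X ^ (d + 2) + C s * W) (j + 1) p := by
    intro s p
    simp [hLdef, momL_apply]
  have hLtw : ∀ s q, L s (twist (C a * X ^ (d + 2) + C s * W) q) = 0 := by
    intro s q
    rw [hLapp]
    exact Finset.sum_eq_zero fun j _ => by rw [mom_twist hD (hQ0.add hW s), mul_zero]
  have hLder : ∀ s p, HasDerivAt (fun s => L s p) (-L s (W.map (algebraMap ℝ ℂ) * p)) s := by
    intro s p
    simp only [hLapp]
    rw [← Finset.sum_neg_distrib]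
    refine HasDerivAt.fun_sum fun j _ => ?_
    rw [← mul_neg]
    exact (hasDerivAt_mom hD hQ0 hW (j + 1) p s).const_mul (u j)
  -- The parameter is reversed so that `y` starts at the given potential, where it is zero, and ends
  -- at the pure monomial. The derivative involves moments of `W X^l`, which reduction modulo exact
  -- forms bounds by `y` itself, so Grönwall's inequality keeps `y` at zero.
  set y : ℝ → Fin (d + 1) → ℂ := fun s l => L (1 - s) (X ^ (l : ℕ)) with hy
  set y' : ℝ → Fin (d + 1) → ℂ := fun s l => L (1 - s) (W.map (algebraMap ℝ ℂ) * X ^ (l : ℕ))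
    with hy'
  have hder : ∀ s, HasDerivAt y (y' s) s := by
    intro s
    rw [hasDerivAt_pi]
    intro l
    have h1 : HasDerivAt (fun s : ℝ => 1 - s) (-1) s := by
      simpa using (hasDerivAt_id s).const_sub 1
    have := (hLder (1 - s) (X ^ (l : ℕ))).scomp s h1
    simpa [hy, hy', Function.comp_def] using this
  have hy0 : y 0 = 0 := by
    ext l
    simp only [hy, sub_zero, hLapp, Pi.zero_apply]
    rw [← hQ1]
    exact h l l.2
  choose K hK0 hK using exists_bound_of_vanish_twist ha hW
  have hbound : ∀ s ∈ Set.Ico (0 : ℝ) 1, ‖y' s‖ ≤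
      (∑ i ∈ Finset.range (d + 2), ∑ l : Fin (d + 1), |W.coeff i| * K (i + l)) * ‖y s‖ := by
    intro s hs
    have hs1 : |1 - s| ≤ 1 := by
      rw [abs_le]; constructor <;> linarith [hs.1, hs.2]
    have hmo : ∀ N, ‖L (1 - s) (X ^ N)‖ ≤ K N * ‖y s‖ := fun N =>
      hK N (1 - s) hs1 (L (1 - s)) (hLtw _) _ fun l hl => norm_le_pi_norm (y s) ⟨l, hl⟩
    refine (pi_norm_le_iff_of_nonneg (mul_nonneg (Finset.sum_nonneg fun i _ =>
      Finset.sum_nonneg fun l _ => mul_nonneg (abs_nonneg _) (hK0 _)) (norm_nonneg _))).2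
      fun l => ?_
    have e1 : W.map (algebraMap ℝ ℂ) * X ^ (l : ℕ) =
        ∑ i ∈ Finset.range (d + 2), ((W.coeff i : ℝ) : ℂ) • (X ^ (i + (l : ℕ)) : ℂ[X]) := by
      conv_lhs => rw [W.as_sum_range' (d + 2) hW]
      rw [Polynomial.map_sum, Finset.sum_mul]
      refine Finset.sum_congr rfl fun i _ => ?_
      rw [smul_eq_C_mul, map_monomial, ← C_mul_X_pow_eq_monomial, mul_assoc, ← pow_add]
      rfl
    simp only [hy', e1, map_sum, map_smul, smul_eq_mul]
    rw [Finset.sum_mul]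
    refine (norm_sum_le _ _).trans (Finset.sum_le_sum fun i _ => ?_)
    rw [norm_mul, norm_real, Real.norm_eq_abs]
    calc |W.coeff i| * ‖L (1 - s) (X ^ (i + (l : ℕ)))‖
        ≤ |W.coeff i| * (K (i + l) * ‖y s‖) := by gcongr; exact hmo _
      _ = |W.coeff i| * K (i + l) * ‖y s‖ := by ring
      _ ≤ _ := by
        gcongr
        exact Finset.single_le_sum (f := fun l : Fin (d + 1) => |W.coeff i| * K (i + l))
          (fun l _ => mul_nonneg (abs_nonneg _) (hK0 _)) (Finset.mem_univ l)
  have hz := eq_zero_of_abs_deriv_le_mul_abs_self_of_eq_zero_right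
    (fun s _ => (hder s).continuousAt.continuousWithinAt) (fun s _ => (hder s).hasDerivWithinAt)
    hy0 hbound 1 ⟨zero_le_one, le_rfl⟩
  apply monomial_moments_independent ha u
  intro l hl
  have := congrFun hz ⟨l, hl⟩
  simpa [hy, hLapp] using this

/-- A polynomial of degree at most `D - 2` with vanishing moments over `Γ_1, …, Γ_{D-1}`
vanishes. -/
lemma eq_zero_of_moments {D : ℕ} (hD : 2 ≤ D) {Q : ℝ[X]} (hQ : Confining D Q) {r : ℂ[X]}
    (hr : r.degree < ((D - 1 : ℕ) : WithBot ℕ)) (h : ∀ j : Fin (D - 1), mom D Q (j + 1) r = 0) :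
    r = 0 := by
  obtain ⟨d, rfl⟩ : ∃ d, D = d + 2 := ⟨D - 2, by omega⟩
  simp only [show d + 2 - 1 = d + 1 by omega] at hr h
  set M : Matrix (Fin (d + 1)) (Fin (d + 1)) ℂ := fun j l => mom (d + 2) Q (j + 1) (X ^ (l : ℕ))
    with hM
  have hdet : M.det ≠ 0 := by
    intro h0
    -- Independence of the functionals is a statement on the left kernel of the square moment
    -- matrix; the right kernel is what the lemma needs.
    obtain ⟨u, hu, hu0⟩ := Matrix.exists_vecMul_eq_zero_iff.2 h0
    refine hu (moments_independent hQ u fun l hl => ?_)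
    exact congrFun hu0 ⟨l, hl⟩
  have hv : M.mulVec (fun l => r.coeff l) = 0 := by
    ext j
    have e := h j
    have hsum : r = ∑ l : Fin (d + 1), r.coeff l • (X ^ (l : ℕ) : ℂ[X]) := by
      by_cases hr0 : r = 0
      · simp [hr0]
      have hnd : r.natDegree < d + 1 := (natDegree_lt_iff_degree_lt hr0).2 hr
      conv_lhs => rw [r.as_sum_range' (d + 1) hnd, Finset.sum_range]
      exact Finset.sum_congr rfl fun l _ => by rw [smul_eq_C_mul, C_mul_X_pow_eq_monomial]
    rw [hsum, ← momL_apply (by omega) hQ, map_sum] at e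
    simp only [map_smul, momL_apply, smul_eq_mul] at e
    rw [Pi.zero_apply, ← e]
    simp only [Matrix.mulVec, dotProduct, hM]
    exact Finset.sum_congr rfl fun l _ => mul_comm _ _
  have hz := Matrix.eq_zero_of_mulVec_eq_zero hdet hv
  ext l
  by_cases hl : l < d + 1
  · exact congrFun hz ⟨l, hl⟩
  · rw [coeff_zero]
    exact coeff_eq_zero_of_degree_lt (hr.trans_le (by exact_mod_cast not_lt.1 hl))

/-- A polynomial with vanishing moments over `Γ_1, …, Γ_{D-1}` is of the form `q' - Q' q`. -/
lemma exists_eq_twist {D : ℕ} (hD : 2 ≤ D) {Q : ℝ[X]} (hQ : Confining D Q) {N : ℕ} {p : ℂ[X]}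
    (hp : p.degree < ((N + (D - 1) : ℕ) : WithBot ℕ))
    (h : ∀ j : Fin (D - 1), mom D Q (j + 1) p = 0) :
    ∃ q : ℂ[X], q.degree < (N : WithBot ℕ) ∧ p = twist Q q := by
  obtain ⟨q, r, h1, h2, h3⟩ := exists_twist_add hD hQ _ p hp
  have hr : r = 0 := eq_zero_of_moments hD hQ h3 fun j => by
    have := h j
    rw [h1, ← momL_apply hD hQ, map_add, momL_apply, momL_apply, mom_twist hD hQ, zero_add] at this
    exact this
  refine ⟨q, ?_, by rw [h1, hr, add_zero]⟩
  rwa [Nat.add_sub_cancel] at h2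

/-! ### The skew-symmetric form -/

/-- Because of this, for even `D`, the contour `Γ_{D/2}` is the real line, and integrals with weight
`e^{-2V}` over it are covered by `mom` and `cau` with index `D / 2`. -/
lemma rt_half {D : ℕ} (hD : 2 ≤ D) (he : Even D) : rt D (D / 2) = -1 := by
  obtain ⟨m, rfl⟩ := he
  have hm : (m : ℂ) ≠ 0 := by exact_mod_cast (by omega : m ≠ 0)
  rw [show (m + m) / 2 = m by omega, rt, ← exp_pi_mul_I]
  congr 1
  push_cast
  field_simp
  ring

lemma dens_ofReal (Q f : ℝ[X]) (r : ℝ) :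
    dens Q (f.map (algebraMap ℝ ℂ)) r = ((f.eval r * Real.exp (-Q.eval r) : ℝ) : ℂ) := by
  have h : ∀ g : ℝ[X], aeval (r : ℂ) g = ((g.eval r : ℝ) : ℂ) := fun g => by
    have := aeval_algebraMap_apply ℂ r g
    simpa using this
  rw [dens, ← eval₂_eq_eval_map, ← aeval_def, h, h]
  push_cast
  rfl

lemma mom_real {D : ℕ} (hD : 2 ≤ D) (he : Even D) (Q f : ℝ[X]) :
    mom D Q (D / 2) (f.map (algebraMap ℝ ℂ)) =
      (((∫ r in Set.Ioi (0 : ℝ), f.eval r * Real.exp (-Q.eval r)) +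
        ∫ r in Set.Ioi (0 : ℝ), f.eval (-r) * Real.exp (-Q.eval (-r)) : ℝ) : ℂ) := by
  have h1 : rayInt 1 (dens Q (f.map (algebraMap ℝ ℂ))) =
      ((∫ r in Set.Ioi (0 : ℝ), f.eval r * Real.exp (-Q.eval r) : ℝ) : ℂ) := by
    rw [rayInt, ← integral_complex_ofReal]
    refine integral_congr_ae (ae_of_all _ fun r => ?_)
    simp only [one_mul, dens_ofReal]
  have h2 : rayInt (-1) (dens Q (f.map (algebraMap ℝ ℂ))) =
      -((∫ r in Set.Ioi (0 : ℝ), f.eval (-r) * Real.exp (-Q.eval (-r)) : ℝ) : ℂ) := by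
    rw [rayInt, ← integral_complex_ofReal, ← integral_neg]
    refine integral_congr_ae (ae_of_all _ fun r => ?_)
    have := dens_ofReal Q f (-r)
    rw [ofReal_neg] at this
    simp only [neg_mul, one_mul, this]
  rw [mom, rt_zero, rt_half hD he, h1, h2]
  push_cast
  ring

lemma mom_sq_ne_zero {D : ℕ} (hD : 2 ≤ D) (he : Even D) {Q : ℝ[X]} (hQ : Confining D Q)
    {h : ℝ[X]} (h0 : h ≠ 0) : mom D Q (D / 2) ((h ^ 2).map (algebraMap ℝ ℂ)) ≠ 0 := by
  rw [mom_real hD he]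
  have hcint : IntegrableOn (fun r : ℝ => (h ^ 2).eval r * Real.exp (-Q.eval r)) (Set.Ioi 0) := by
    have h1 := (stripDecay_dens hD hQ (ω := 1) (by simp)
      ((h ^ 2).map (algebraMap ℝ ℂ))).integrableOn.re
    refine h1.congr (ae_of_all _ fun r => ?_)
    simp only [one_mul, dens_ofReal]
    exact ofReal_re _
  have hpos : 0 < ∫ r in Set.Ioi (0 : ℝ), (h ^ 2).eval r * Real.exp (-Q.eval r) := by
    rw [setIntegral_pos_iff_support_of_nonneg_ae _ hcint]
    · have hsub : Set.Ioi (0 : ℝ) \ (h.roots.toFinset : Set ℝ) ⊆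
          Function.support (fun r : ℝ => (h ^ 2).eval r * Real.exp (-Q.eval r)) ∩ Set.Ioi 0 := by
        rintro r ⟨hr, hr2⟩
        refine ⟨?_, hr⟩
        have : h.eval r ≠ 0 := fun hh => hr2 (by simp [h0, hh])
        simp [this]
      refine lt_of_lt_of_le ?_ (measure_mono hsub)
      rw [measure_sdiff_null (Finset.measure_zero _ _)]
      simp
    · refine ae_of_all _ fun r => ?_
      simp only [Pi.zero_apply, eval_pow]
      positivity
  have hnn : 0 ≤ ∫ r in Set.Ioi (0 : ℝ), (h ^ 2).eval (-r) * Real.exp (-Q.eval (-r)) := by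
    refine integral_nonneg fun r => ?_
    simp only [Pi.zero_apply, eval_pow]
    positivity
  exact_mod_cast (by linarith : (0 : ℝ) < _).ne'

lemma exists_root_of_odd_natDegree {f : ℝ[X]} (hf : Odd f.natDegree) : ∃ r, f.eval r = 0 := by
  have key : ∀ g : ℝ[X], Odd g.natDegree → 0 < g.leadingCoeff → ∃ r, g.eval r = 0 := by
    intro g hg hl
    have hg0 : 0 < g.degree := natDegree_pos_iff_degree_pos.1 hg.pos
    have h1 := tendsto_atTop_of_leadingCoeff_nonneg g hg0 hl.le
    have hcomp : (-(g.comp (-X))).natDegree = g.natDegree := by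
      rw [natDegree_neg, natDegree_comp]; simp
    have hlc : (-(g.comp (-X))).leadingCoeff = g.leadingCoeff := by
      rw [leadingCoeff_neg, leadingCoeff_comp (by simp), leadingCoeff_neg, leadingCoeff_X,
        hg.neg_one_pow]
      ring
    have h2 := tendsto_atTop_of_leadingCoeff_nonneg (-(g.comp (-X)))
      (natDegree_pos_iff_degree_pos.1 (by rw [hcomp]; exact hg.pos)) (by rw [hlc]; exact hl.le)
    obtain ⟨a, ha⟩ := (h1.eventually_ge_atTop 0).exists
    obtain ⟨b, hb⟩ := (h2.eventually_ge_atTop 0).exists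
    have hb' : g.eval (-b) ≤ 0 := by
      simp only [eval_neg, eval_comp, eval_X] at hb; linarith
    exact mem_range_of_exists_le_of_exists_ge g.continuous ⟨-b, hb'⟩ ⟨a, ha⟩
  rcases lt_trichotomy f.leadingCoeff 0 with h | h | h
  · obtain ⟨r, hr⟩ := key (-f) (by rwa [natDegree_neg]) (by rw [leadingCoeff_neg]; linarith)
    exact ⟨r, by simpa using hr⟩
  · rw [leadingCoeff_eq_zero] at h
    rw [h] at hf; simp at hf
  · exact key f hf h

/-- The form `S(q,s) = ∫_ℝ (q' - V' q) s e^{-2V}` is skew-symmetric. -/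
lemma skew_form {D : ℕ} (hD : 2 ≤ D) {V : ℝ[X]} (hV : Confining D V) (k : ℕ) (q s : ℂ[X]) :
    mom D (C 2 * V) k (twist V q * s) = -mom D (C 2 * V) k (twist V s * q) := by
  have hV2 := hV.smul (two_pos : (0 : ℝ) < 2)
  have h := mom_twist hD hV2 k (q * s)
  -- The doubled potential supplies one `V'` to each factor of the product rule, so the symmetrised
  -- form is the integral of an exact density.
  have e : twist (C 2 * V) (q * s) = twist V q * s + twist V s * q := by
    have e2 : (C (2 : ℝ)).map (algebraMap ℝ ℂ) = 2 := by
      rw [map_C, coe_algebraMap, ofReal_ofNat]; exact map_ofNat C 2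
    rw [twist, derivative_C_mul, Polynomial.map_mul, e2, derivative_mul, twist, twist]
    ring
  rw [e, ← momL_apply hD hV2, map_add, momL_apply, momL_apply] at h
  linear_combination h

lemma skew_form_self {D : ℕ} (hD : 2 ≤ D) {V : ℝ[X]} (hV : Confining D V) (k : ℕ) (q : ℂ[X]) :
    mom D (C 2 * V) k (twist V q * q) = 0 := by
  have := skew_form hD hV k q q
  linear_combination this / 2

/-- Moments against monomials determine moments against polynomials. -/
lemma mom_mul_eq_sum {D : ℕ} (hD : 2 ≤ D) {Q : ℝ[X]} (hQ : Confining D Q) (k : ℕ) (p s : ℂ[X])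
    {N : ℕ} (hs : s.degree < N) :
    mom D Q k (p * s) = ∑ l ∈ Finset.range N, s.coeff l * mom D Q k (p * X ^ l) := by
  have hsum : p * s = ∑ l ∈ Finset.range N, s.coeff l • (p * X ^ l) := by
    by_cases hs0 : s = 0
    · simp [hs0]
    conv_lhs => rw [s.as_sum_range' N ((natDegree_lt_iff_degree_lt hs0).2 hs), Finset.mul_sum]
    exact Finset.sum_congr rfl fun l _ => by
      rw [smul_eq_C_mul, ← C_mul_X_pow_eq_monomial]; ring
  rw [hsum, ← momL_apply hD hQ, map_sum]
  simp [momL_apply]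

/-- By skew-symmetry, twice the form at `(f, s)` is `∫ (f's - fs') e^{-2V}`, and `s` is chosen to
make the Wronskian a square up to sign. If `f = (X - r) g`, then `s = g` gives `g²`. If `f` has no
real root, its degree is even and below `2n`, hence at most `2n - 2`, so `s = X f` is admissible and
gives `-f²`. -/
lemma skew_nondegenerate_real {D : ℕ} (hD : 2 ≤ D) (he : Even D) {V : ℝ[X]} (hV : Confining D V)
    {n : ℕ} {f : ℝ[X]} (hf : f.degree < ((2 * n : ℕ) : WithBot ℕ))
    (h : ∀ k < 2 * n,
      mom D (C 2 * V) (D / 2) (twist V (f.map (algebraMap ℝ ℂ)) * X ^ k) = 0) : f = 0 := by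
  have hV2 := hV.smul (two_pos : (0 : ℝ) < 2)
  by_contra hf0
  have hfd : f.natDegree < 2 * n := (natDegree_lt_iff_degree_lt hf0).2 hf
  have hall : ∀ s : ℝ[X], s.degree < ((2 * n : ℕ) : WithBot ℕ) →
      mom D (C 2 * V) (D / 2) ((derivative f * s - f * derivative s).map (algebraMap ℝ ℂ)) = 0 := by
    intro s hs
    have h1 : mom D (C 2 * V) (D / 2)
        (twist V (f.map (algebraMap ℝ ℂ)) * s.map (algebraMap ℝ ℂ)) = 0 := by
      rw [mom_mul_eq_sum hD hV2 _ _ _ (by rwa [degree_map] : _ < ((2 * n : ℕ) : WithBot ℕ))]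
      exact Finset.sum_eq_zero fun l hl => by rw [h l (Finset.mem_range.1 hl), mul_zero]
    have h2 := skew_form hD hV (D / 2) (f.map (algebraMap ℝ ℂ)) (s.map (algebraMap ℝ ℂ))
    rw [h1] at h2
    have e : (derivative f * s - f * derivative s).map (algebraMap ℝ ℂ) =
        twist V (f.map (algebraMap ℝ ℂ)) * s.map (algebraMap ℝ ℂ) +
          (-1 : ℂ) • (twist V (s.map (algebraMap ℝ ℂ)) * f.map (algebraMap ℝ ℂ)) := by
      simp only [twist, Polynomial.map_sub, Polynomial.map_mul, derivative_map, neg_smul, one_smul]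
      ring
    rw [e, ← momL_apply hD hV2, map_add, map_smul, momL_apply, momL_apply, h1]
    linear_combination -h2
  by_cases hroot : ∃ r, f.eval r = 0
  · obtain ⟨r, hr⟩ := hroot
    obtain ⟨g, hg⟩ := dvd_iff_isRoot.2 hr
    have hg0 : g ≠ 0 := by rintro rfl; exact hf0 (by rw [hg, mul_zero])
    have hgd : g.degree < ((2 * n : ℕ) : WithBot ℕ) := by
      rw [← natDegree_lt_iff_degree_lt hg0]
      rw [hg, natDegree_mul (X_sub_C_ne_zero r) hg0] at hfd
      omega
    have h1 := hall g hgd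
    have e : derivative f * g - f * derivative g = g ^ 2 := by
      rw [hg]; simp only [derivative_mul, derivative_sub, derivative_X, derivative_C]; ring
    rw [e] at h1
    exact mom_sq_ne_zero hD he hV2 hg0 h1
  · have heven : Even f.natDegree := by
      by_contra hodd
      exact hroot (exists_root_of_odd_natDegree (Nat.not_even_iff_odd.1 hodd))
    have hd : (X * f).degree < ((2 * n : ℕ) : WithBot ℕ) := by
      rw [← natDegree_lt_iff_degree_lt (mul_ne_zero X_ne_zero hf0), natDegree_X_mul hf0]
      obtain ⟨m, hm⟩ := heven
      omega
    have h1 := hall (X * f) hd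
    have e : derivative f * (X * f) - f * derivative (X * f) = -f ^ 2 := by
      simp only [derivative_mul, derivative_X]; ring
    rw [e] at h1
    have e2 : (-f ^ 2).map (algebraMap ℝ ℂ) = (-1 : ℂ) • (f ^ 2).map (algebraMap ℝ ℂ) := by
      simp
    rw [e2, ← momL_apply hD hV2, map_smul, momL_apply] at h1
    exact mom_sq_ne_zero hD he hV2 hf0 (by simpa using h1)

/-- The skew form is nondegenerate on polynomials of degree less than `2n`. -/
lemma skew_nondegenerate {D : ℕ} (hD : 2 ≤ D) (he : Even D) {V : ℝ[X]} (hV : Confining D V)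
    {n : ℕ} {q : ℂ[X]} (hq : q.degree < ((2 * n : ℕ) : WithBot ℕ))
    (h : ∀ k < 2 * n, mom D (C 2 * V) (D / 2) (twist V q * X ^ k) = 0) : q = 0 := by
  have hV2 := hV.smul (two_pos : (0 : ℝ) < 2)
  set f : ℝ[X] := ∑ k ∈ Finset.range (2 * n), C (q.coeff k).re * X ^ k with hf
  set g : ℝ[X] := ∑ k ∈ Finset.range (2 * n), C (q.coeff k).im * X ^ k with hg
  have hdeg : ∀ c : ℕ → ℝ, (∑ k ∈ Finset.range (2 * n), C (c k) * X ^ k : ℝ[X]).degree <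
      ((2 * n : ℕ) : WithBot ℕ) := by
    intro c
    refine (degree_sum_le _ _).trans_lt ((Finset.sup_lt_iff (WithBot.bot_lt_coe _)).2 fun k hk => ?_)
    exact (degree_C_mul_X_pow_le k _).trans_lt (by exact_mod_cast Finset.mem_range.1 hk)
  have hqfg : q = f.map (algebraMap ℝ ℂ) + I • g.map (algebraMap ℝ ℂ) := by
    have hs : q = ∑ l ∈ Finset.range (2 * n), C (q.coeff l) * X ^ l := by
      by_cases hq0 : q = 0
      · simp [hq0]
      conv_lhs => rw [q.as_sum_range_C_mul_X_pow' ((natDegree_lt_iff_degree_lt hq0).2 hq)]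
    conv_lhs => rw [hs]
    rw [hf, hg, Polynomial.map_sum, Polynomial.map_sum, Finset.smul_sum, ← Finset.sum_add_distrib]
    refine Finset.sum_congr rfl fun l _ => ?_
    simp only [Polynomial.map_mul, map_C, Polynomial.map_pow, map_X, coe_algebraMap,
      smul_eq_C_mul, ← mul_assoc, ← C_mul, ← add_mul, ← C_add]
    congr 2
    rw [mul_comm I]
    exact (re_add_im _).symm
  -- The form is real on real polynomials, so the conditions on `q = f + i g` separate into those on
  -- `f` and on `g`.
  have hreal : ∀ (u : ℝ[X]) (k : ℕ), ∃ c : ℝ,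
      mom D (C 2 * V) (D / 2) (twist V (u.map (algebraMap ℝ ℂ)) * X ^ k) = c := by
    intro u k
    have : twist V (u.map (algebraMap ℝ ℂ)) * X ^ k =
        ((derivative u - derivative V * u) * X ^ k).map (algebraMap ℝ ℂ) := by
      simp [twist, derivative_map]
    rw [this, mom_real hD he]
    exact ⟨_, rfl⟩
  have hboth : ∀ k < 2 * n,
      mom D (C 2 * V) (D / 2) (twist V (f.map (algebraMap ℝ ℂ)) * X ^ k) = 0 ∧
      mom D (C 2 * V) (D / 2) (twist V (g.map (algebraMap ℝ ℂ)) * X ^ k) = 0 := by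
    intro k hk
    have h1 := h k hk
    obtain ⟨c₁, hc₁⟩ := hreal f k
    obtain ⟨c₂, hc₂⟩ := hreal g k
    rw [hqfg, twist_add, twist_smul, add_mul, smul_mul_assoc, ← momL_apply hD hV2, map_add,
      map_smul, momL_apply, momL_apply, hc₁, hc₂, smul_eq_mul] at h1
    rw [hc₁, hc₂]
    have hre := congrArg Complex.re h1
    have him := congrArg Complex.im h1
    simp at hre him
    simp [hre, him]
  have hf0 : f = 0 := skew_nondegenerate_real hD he hV (hdeg _) fun k hk => (hboth k hk).1
  have hg0 : g = 0 := skew_nondegenerate_real hD he hV (hdeg _) fun k hk => (hboth k hk).2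
  rw [hqfg, hf0, hg0]
  simp

/-- Unique solvability of the linear system for the polynomials of the first column. -/
theorem eq_zero_of_all_moments {D : ℕ} (hD : 2 ≤ D) (he : Even D) {V : ℝ[X]} (hV : Confining D V)
    {n : ℕ} {p : ℂ[X]} (hp : p.degree < ((2 * n + (D - 1) : ℕ) : WithBot ℕ))
    (h1 : ∀ j : Fin (D - 1), mom D V (j + 1) p = 0)
    (h2 : ∀ k < 2 * n, mom D (C 2 * V) (D / 2) (p * X ^ k) = 0) : p = 0 := by
  obtain ⟨q, hq, rfl⟩ := exists_eq_twist hD hV hp h1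
  rw [skew_nondegenerate hD he hV hq h2]
  simp [twist]

/-! ### Cauchy transforms over the contours `Γ_k` -/

/-- The Cauchy transform of `p e^{-Q}` over `Γ_k`. -/
def cau (D : ℕ) (Q : ℝ[X]) (k : ℕ) (p : ℂ[X]) (z : ℂ) : ℂ :=
  (2 * Real.pi * I)⁻¹ * (rayCauchy (rt D 0) (dens Q p) z - rayCauchy (rt D k) (dens Q p) z)

lemma slit_of_not_mem_ray {D k : ℕ} {z : ℂ} (hz : z ∉ ray D k) : -(z / rt D k) ∈ slitPlane := by
  rw [mem_ray_iff, not_and_or] at hz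
  rw [mem_slitPlane_iff, neg_re, neg_im]
  rcases hz with h | h
  · exact Or.inr (neg_ne_zero.2 h)
  · exact Or.inl (by linarith [not_le.1 h])

lemma not_mem_ray_of_not_mem_gamma {D k : ℕ} (hD : 2 ≤ D) (hk : k < D) {z : ℂ}
    (hz : z ∈ (gamma D)ᶜ) : z ∉ ray D k :=
  fun h => hz ((mem_gamma_iff hD).2 ⟨k, hk, h⟩)

lemma slit_of_not_mem_gamma {D k : ℕ} (hD : 2 ≤ D) (hk : k < D) {z : ℂ} (hz : z ∈ (gamma D)ᶜ) :
    -(z / rt D k) ∈ slitPlane := slit_of_not_mem_ray (not_mem_ray_of_not_mem_gamma hD hk hz)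

lemma rt_pow {D : ℕ} (hD : 2 ≤ D) (k : ℕ) : rt D k ^ D = 1 := rt_pow_self (by omega) k

lemma rayCauchy_dens_integrableOn {D : ℕ} (hD : 2 ≤ D) {Q : ℝ[X]} (hQ : Confining D Q) {k : ℕ}
    (hk : k < D) (p : ℂ[X]) {z : ℂ} (hz : z ∈ (gamma D)ᶜ) :
    IntegrableOn (fun r : ℝ => rt D k * ((rt D k * r - z)⁻¹ * dens Q p (rt D k * r)))
      (Set.Ioi 0) := by
  obtain ⟨δ, hδ, h⟩ := exists_le_norm_ray_sub (norm_rt D k) (slit_of_not_mem_gamma hD hk hz)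
  exact rayCauchy_integrableOn (stripDecay_dens hD hQ (rt_pow hD k) p) measurableSet_Ioi
    subset_rfl hδ fun r hr => h r hr.le

lemma rayCauchy_dens_add {D : ℕ} (hD : 2 ≤ D) {Q : ℝ[X]} (hQ : Confining D Q) {k : ℕ}
    (hk : k < D) (p q : ℂ[X]) {z : ℂ} (hz : z ∈ (gamma D)ᶜ) :
    rayCauchy (rt D k) (dens Q (p + q)) z =
      rayCauchy (rt D k) (dens Q p) z + rayCauchy (rt D k) (dens Q q) z := by
  simp only [rayCauchy, rayInt, dens_add, mul_add]
  exact integral_add (rayCauchy_dens_integrableOn hD hQ hk p hz)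
    (rayCauchy_dens_integrableOn hD hQ hk q hz)

lemma rayCauchy_dens_smul (Q : ℝ[X]) (ω c : ℂ) (p : ℂ[X]) (z : ℂ) :
    rayCauchy ω (dens Q (c • p)) z = c * rayCauchy ω (dens Q p) z := by
  simp only [rayCauchy, rayInt, dens_smul, ← integral_const_mul]
  refine integral_congr_ae (ae_of_all _ fun r => ?_)
  simp only
  ring

/-- From `x / (x - z) = z / (x - z) + 1`. Iterating this identity produces the expansion at
infinity, with moments as coefficients. -/
lemma rayCauchy_dens_X_mul {D : ℕ} (hD : 2 ≤ D) {Q : ℝ[X]} (hQ : Confining D Q) {k : ℕ}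
    (hk : k < D) (p : ℂ[X]) {z : ℂ} (hz : z ∈ (gamma D)ᶜ) :
    rayCauchy (rt D k) (dens Q (X * p)) z =
      z * rayCauchy (rt D k) (dens Q p) z + rayInt (rt D k) (dens Q p) := by
  have h1 := rayCauchy_dens_integrableOn hD hQ hk p hz
  have h2 := (stripDecay_dens hD hQ (rt_pow hD k) p).integrableOn
  simp only [rayCauchy, rayInt]
  rw [← integral_const_mul, ← integral_add (h1.const_mul z) h2]
  refine setIntegral_congr_fun measurableSet_Ioi fun r hr => ?_
  have hne : rt D k * r - z ≠ 0 := by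
    intro h
    refine not_mem_ray_of_not_mem_gamma hD hk hz ⟨r, le_of_lt hr, ?_⟩
    rw [mul_comm]
    exact (sub_eq_zero.1 h).symm
  have e : dens Q (X * p) (rt D k * r) = rt D k * r * dens Q p (rt D k * r) := by
    simp [dens, mul_assoc]
  simp only [e]
  have h3 := inv_mul_cancel₀ hne
  linear_combination rt D k * dens Q p (rt D k * r) * h3

lemma cau_add {D : ℕ} (hD : 2 ≤ D) {Q : ℝ[X]} (hQ : Confining D Q) {k : ℕ} (hk : k < D)
    (p q : ℂ[X]) {z : ℂ} (hz : z ∈ (gamma D)ᶜ) :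
    cau D Q k (p + q) z = cau D Q k p z + cau D Q k q z := by
  rw [cau, rayCauchy_dens_add hD hQ (by omega) p q hz, rayCauchy_dens_add hD hQ hk p q hz, cau, cau]
  ring

lemma cau_smul (D : ℕ) (Q : ℝ[X]) (k : ℕ) (c : ℂ) (p : ℂ[X]) (z : ℂ) :
    cau D Q k (c • p) z = c * cau D Q k p z := by
  simp only [cau, rayCauchy_dens_smul]
  ring

lemma cau_X_mul {D : ℕ} (hD : 2 ≤ D) {Q : ℝ[X]} (hQ : Confining D Q) {k : ℕ} (hk : k < D)
    (p : ℂ[X]) {z : ℂ} (hz : z ∈ (gamma D)ᶜ) :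
    cau D Q k (X * p) z = z * cau D Q k p z + (2 * Real.pi * I)⁻¹ * mom D Q k p := by
  rw [cau, rayCauchy_dens_X_mul hD hQ (by omega) p hz, rayCauchy_dens_X_mul hD hQ hk p hz, cau, mom]
  ring

lemma cau_differentiableAt {D : ℕ} (hD : 2 ≤ D) {Q : ℝ[X]} (hQ : Confining D Q) {k : ℕ}
    (hk : k < D) (p : ℂ[X]) {z : ℂ} (hz : z ∈ (gamma D)ᶜ) :
    DifferentiableAt ℂ (cau D Q k p) z := by
  have h : ∀ l < D, DifferentiableAt ℂ (rayCauchy (rt D l) (dens Q p)) z := fun l hl =>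
    rayCauchy_differentiableAt (norm_rt D l) (stripDecay_dens hD hQ (rt_pow hD l) p)
      (slit_of_not_mem_gamma hD hl hz)
  exact ((h 0 (by omega)).sub (h k hk)).const_mul _

lemma hasDerivAt_cau {D : ℕ} (hD : 2 ≤ D) {Q W : ℝ[X]} (hQ : Confining D Q)
    (hW : W.natDegree < D) {k : ℕ} (hk : k < D) (p : ℂ[X]) {z : ℂ} (hz : z ∈ (gamma D)ᶜ) (s : ℝ) :
    HasDerivAt (fun s : ℝ => cau D (Q + C s * W) k p z)
      (-cau D (Q + C s * W) k (W.map (algebraMap ℝ ℂ) * p) z) s := by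
  have h : ∀ l < D, HasDerivAt (fun s : ℝ => rayCauchy (rt D l) (dens (Q + C s * W) p) z)
      (-rayCauchy (rt D l) (dens (Q + C s * W) (W.map (algebraMap ℝ ℂ) * p)) z) s := by
    intro l hl
    obtain ⟨δ, hδ, hd⟩ := exists_le_norm_ray_sub (norm_rt D l) (slit_of_not_mem_gamma hD hl hz)
    refine hasDerivAt_rayInt hD hQ hW (rt_pow hD l) p (g := fun x => (x - z)⁻¹)
      (Measurable.aestronglyMeasurable (by fun_prop)) (M := δ⁻¹) (fun r hr => ?_) s
    rw [norm_inv]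
    have := hd r hr.le
    gcongr
  refine (((h 0 (by omega)).sub (h k hk)).const_mul (2 * Real.pi * I : ℂ)⁻¹).congr_deriv ?_
  simp only [cau]; ring

lemma cau_bounded_near_zero {D : ℕ} (hD : 2 ≤ D) {Q : ℝ[X]} (hQ : Confining D Q) {k : ℕ}
    (hk : k < D) (p : ℂ[X]) : ∃ M : ℝ, ∀ᶠ z in 𝓝[(gamma D)ᶜ] 0, ‖cau D Q k p z‖ ≤ M := by
  obtain ⟨M, hM⟩ := rayCauchy_sub_bounded_near_zero (norm_rt D 0) (norm_rt D k)
    (stripDecay_dens hD hQ (rt_pow hD 0) p) (stripDecay_dens hD hQ (rt_pow hD k) p)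
  refine ⟨‖(2 * Real.pi * I : ℂ)⁻¹‖ * M, ?_⟩
  filter_upwards [hM.filter_mono nhdsWithin_le_nhds, self_mem_nhdsWithin] with z h hz
  rw [cau, norm_mul]
  exact mul_le_mul_of_nonneg_left (h (slit_of_not_mem_gamma hD (by omega) hz)
    (slit_of_not_mem_gamma hD hk hz)) (norm_nonneg _)

lemma eventually_atInf (D : ℕ) (R : ℝ) : ∀ᶠ z in atInf D, R < ‖z‖ ∧ z ∈ (gamma D)ᶜ := by
  rw [atInf, eventually_inf_principal]
  filter_upwards [eventually_cobounded_le_norm (E := ℂ) (R + 1)] with z hz hzg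
  exact ⟨by linarith, hzg⟩

lemma cau_isBigO_one {D : ℕ} (hD : 2 ≤ D) {Q : ℝ[X]} (hQ : Confining D Q) {k : ℕ}
    (hk : k < D) (p : ℂ[X]) : cau D Q k p =O[atInf D] fun _ => (1 : ℂ) := by
  have h : ∀ l < D, rayCauchy (rt D l) (dens Q p) =O[atInf D] fun _ => (1 : ℂ) := by
    intro l hl
    obtain ⟨M, hM⟩ := rayCauchy_bounded (norm_rt D l) (stripDecay_dens hD hQ (rt_pow hD l) p)
    refine IsBigO.of_bound M ?_
    filter_upwards [eventually_atInf D 2] with z hz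
    simpa using hM z hz.1.le (slit_of_not_mem_gamma hD hl hz.2)
  exact ((h 0 (by omega)).sub (h k hk)).const_mul_left _

/-- `z^N` times the Cauchy transform. -/
lemma pow_mul_cau {D : ℕ} (hD : 2 ≤ D) {Q : ℝ[X]} (hQ : Confining D Q) {k : ℕ} (hk : k < D)
    (p : ℂ[X]) {z : ℂ} (hz : z ∈ (gamma D)ᶜ) (N : ℕ) :
    z ^ N * cau D Q k p z = cau D Q k (p * X ^ N) z -
      (2 * Real.pi * I)⁻¹ * ∑ m ∈ Finset.range N, mom D Q k (p * X ^ m) * z ^ (N - 1 - m) := by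
  induction N with
  | zero => simp
  | succ N ih =>
    rw [pow_succ', mul_assoc, ih, mul_sub, Finset.sum_range_succ, Nat.add_sub_cancel, Nat.sub_self,
      show p * X ^ (N + 1) = X * (p * X ^ N) by ring, cau_X_mul hD hQ hk _ hz]
    have : ∑ m ∈ Finset.range N, mom D Q k (p * X ^ m) * z ^ (N - m) =
        z * ∑ m ∈ Finset.range N, mom D Q k (p * X ^ m) * z ^ (N - 1 - m) := by
      rw [Finset.mul_sum]
      refine Finset.sum_congr rfl fun m hm => ?_
      have hm' := Finset.mem_range.1 hm
      rw [show N - m = N - 1 - m + 1 by omega, pow_succ]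
      ring
    rw [this]
    ring

lemma disjoint_ray_zero {D k : ℕ} (hD : 2 ≤ D) (hk0 : 0 < k) (hk : k < D) {x : ℂ} (hx : x ≠ 0)
    (h0 : x ∈ ray D 0) : x ∉ ray D k := by
  intro hxk
  have h1 : (1 : ℂ) ∈ ray D 0 := by rw [mem_ray_zero]; simp
  rw [ray_eq_of_mem hx h0, ← ray_eq_of_mem hx hxk] at h1
  obtain ⟨r, hr, h⟩ := h1
  change 1 = r * rt D k at h
  have hn := congrArg norm h
  rw [norm_one, norm_mul, norm_rt, mul_one, norm_real, Real.norm_eq_abs, abs_of_nonneg hr] at hn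
  rw [← hn, ofReal_one, one_mul, ← rt_zero D] at h
  have := rt_injective hD (a₁ := ⟨0, by omega⟩) (a₂ := ⟨k, hk⟩) h
  simp only [Fin.mk.injEq] at this
  omega

open Classical in
/-- One-sided limits on `Γ \ {0}` of the Cauchy transform over a ray. -/
lemma rayCauchy_limits {D : ℕ} (hD : 2 ≤ D) {Q : ℝ[X]} (hQ : Confining D Q) (l : ℕ)
    (p : ℂ[X]) {x : ℂ} (hx : x ∈ gamma D \ {0}) :
    ∃ K : ℂ, Tendsto (rayCauchy (rt D l) (dens Q p)) (𝓝[leftSide D x] x)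
      (𝓝 (K + (if x ∈ ray D l then if x ∈ ray D 0 then 1 else -1 else 0) *
        (Real.pi * I * dens Q p x))) ∧
      Tendsto (rayCauchy (rt D l) (dens Q p)) (𝓝[rightSide D x] x)
      (𝓝 (K - (if x ∈ ray D l then if x ∈ ray D 0 then 1 else -1 else 0) *
        (Real.pi * I * dens Q p x))) := by
  have hx0 : x ≠ 0 := hx.2
  have hs := stripDecay_dens hD hQ (rt_pow hD l) p
  by_cases hxl : x ∈ ray D l
  · obtain ⟨r, hr, hxr⟩ := id hxl
    change x = r * rt D l at hxr
    have hr0 : 0 < r := by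
      rcases hr.lt_or_eq with h | h
      · exact h
      · exact absurd (by rw [hxr, ← h]; simp) hx0
    have hxdiv : x / rt D l = r := by rw [hxr, mul_div_cancel_right₀ _ (rt_ne_zero D l)]
    have hdiv : ∀ z, (z / x).im = r⁻¹ * (z / rt D l).im := fun z => by
      rw [← im_ofReal_mul, hxr]
      congr 1
      have := rt_ne_zero D l
      push_cast
      field_simp
    have hri : 0 < r⁻¹ := inv_pos.2 hr0
    obtain ⟨K, h1, h2⟩ := rayCauchy_boundary (norm_rt D l) hs (x := x) (by rw [hxdiv]; simp)
      (by rw [hxdiv]; simpa using hr0)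
    have hp : ∀ b : ℝ, 0 < r⁻¹ * b ↔ 0 < b := fun b => mul_pos_iff_of_pos_left hri
    have hn : ∀ b : ℝ, r⁻¹ * b < 0 ↔ b < 0 := fun b => by
      rw [← neg_pos, ← mul_neg, hp, neg_pos]
    refine ⟨K, ?_⟩
    rw [leftSide_eq hx0, rightSide_eq hx0]
    -- On `C_0` the left side is `Im (z / ω) > 0`; the other rays are oriented inwards, which
    -- exchanges the sides and reverses the sign.
    by_cases h0 : x ∈ ray D 0
    · simp only [h0, hxl, if_true, hdiv, hp, hn, one_mul]
      exact ⟨h1, h2⟩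
    · simp only [h0, hxl, if_true, if_false, hdiv, neg_pos, neg_lt_zero, hp, hn, neg_mul, one_mul,
        sub_neg_eq_add, ← sub_eq_add_neg]
      exact ⟨h2, h1⟩
  · have hc := (rayCauchy_differentiableAt (norm_rt D l) hs
      (slit_of_not_mem_ray hxl)).continuousAt.tendsto
    refine ⟨rayCauchy (rt D l) (dens Q p) x, ?_, ?_⟩
    · simpa [hxl] using hc.mono_left nhdsWithin_le_nhds
    · simpa [hxl] using hc.mono_left nhdsWithin_le_nhds

/-- The jump of the Cauchy transform over `Γ_k`. -/
lemma cau_limits {D : ℕ} (hD : 2 ≤ D) {Q : ℝ[X]} (hQ : Confining D Q) {k : ℕ} (hk0 : 0 < k)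
    (hk : k < D) (p : ℂ[X]) {x : ℂ} (hx : x ∈ gamma D \ {0}) :
    ∃ fp fm : ℂ, Tendsto (cau D Q k p) (𝓝[leftSide D x] x) (𝓝 fp) ∧
      Tendsto (cau D Q k p) (𝓝[rightSide D x] x) (𝓝 fm) ∧
      fp = fm + p.eval x * (gammaK D k).indicator (fun y => exp (-aeval y Q)) x := by
  classical
  obtain ⟨K₀, h1, h2⟩ := rayCauchy_limits hD hQ 0 p hx
  obtain ⟨K₁, h3, h4⟩ := rayCauchy_limits hD hQ k p hx
  refine ⟨_, _, (h1.sub h3).const_mul _, (h2.sub h4).const_mul _, ?_⟩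
  have hx0 : x ≠ 0 := hx.2
  have hpi : (2 * Real.pi * I : ℂ) ≠ 0 := two_pi_I_ne_zero
  have hinv := inv_mul_cancel₀ hpi
  rw [dens]
  -- A nonzero point lies on at most one of `C_0` and `C_k`. The minus sign in front of the integral
  -- over `C_k` compensates its reversed sides, so the jump is `+p e^{-Q}` on both.
  by_cases hr0 : x ∈ ray D 0
  · have hrk := disjoint_ray_zero hD hk0 hk hx0 hr0
    rw [Set.indicator_of_mem (show x ∈ gammaK D k from Or.inl hr0)]
    simp only [hr0, hrk, if_true, if_false]
    linear_combination eval x p * exp (-aeval x Q) * hinv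
  · by_cases hrk : x ∈ ray D k
    · rw [Set.indicator_of_mem (show x ∈ gammaK D k from Or.inr hrk)]
      simp only [hr0, hrk, if_true, if_false]
      linear_combination eval x p * exp (-aeval x Q) * hinv
    · rw [Set.indicator_of_notMem (show x ∉ gammaK D k from fun h => h.elim hr0 hrk)]
      simp only [hr0, hrk, if_false]
      ring

lemma realLine_eq_gammaK {D : ℕ} (hD : 2 ≤ D) (he : Even D) : realLine = gammaK D (D / 2) := by
  ext x
  rw [gammaK, Set.mem_union, mem_ray_zero, mem_ray_iff, rt_half hD he, div_neg, div_one, neg_im,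
    neg_re, neg_eq_zero]
  constructor
  · intro h
    have h' : x.im = 0 := h
    rcases le_total 0 x.re with h1 | h1
    · exact Or.inl ⟨h', h1⟩
    · exact Or.inr ⟨h', by linarith⟩
  · rintro (h | h)
    · exact h.1
    · exact h.1

/-! ### Rows with the prescribed jump -/

/-- A row vector that is analytic off `Γ`, is bounded near `0` and has the jump `jumpMatrix`. -/
structure GoodRow (D : ℕ) (V : ℝ[X]) (f : ℂ → Idx D → ℂ) : Prop where
  analytic : ∀ j, DifferentiableOn ℂ (fun z => f z j) (gamma D)ᶜ
  jump : ∀ x ∈ gamma D \ {0}, ∃ fp fm : Idx D → ℂ,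
    (∀ j, Tendsto (fun z => f z j) (𝓝[leftSide D x] x) (𝓝 (fp j))) ∧
    (∀ j, Tendsto (fun z => f z j) (𝓝[rightSide D x] x) (𝓝 (fm j))) ∧
    ∀ j, fp j = fm j + fm (.inl 0) * jumpRow D V x j
  bounded : ∀ j, ∃ M : ℝ, ∀ᶠ z in 𝓝[(gamma D)ᶜ] 0, ‖f z j‖ ≤ M

lemma GoodRow.add {D : ℕ} {V : ℝ[X]} {f g : ℂ → Idx D → ℂ} (hf : GoodRow D V f)
    (hg : GoodRow D V g) : GoodRow D V fun z j => f z j + g z j where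
  analytic j := (hf.analytic j).add (hg.analytic j)
  jump x hx := by
    obtain ⟨fp, fm, h1, h2, h3⟩ := hf.jump x hx
    obtain ⟨gp, gm, h4, h5, h6⟩ := hg.jump x hx
    exact ⟨fun j => fp j + gp j, fun j => fm j + gm j, fun j => (h1 j).add (h4 j),
      fun j => (h2 j).add (h5 j), fun j => by simp only [h3 j, h6 j]; ring⟩
  bounded j := by
    obtain ⟨M₁, h1⟩ := hf.bounded j
    obtain ⟨M₂, h2⟩ := hg.bounded j
    refine ⟨M₁ + M₂, ?_⟩
    filter_upwards [h1, h2] with z h3 h4 using norm_add_le_of_le h3 h4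

/-- Rows of entire functions with vanishing first entry have no jump. -/
lemma GoodRow.of_entire {D : ℕ} {V : ℝ[X]} {f : ℂ → Idx D → ℂ}
    (hf : ∀ j, Differentiable ℂ fun z => f z j) (h0 : ∀ z, f z (.inl 0) = 0) : GoodRow D V f where
  analytic j := (hf j).differentiableOn
  jump x _ := ⟨f x, f x,
    fun j => ((hf j).continuous.continuousAt.tendsto).mono_left nhdsWithin_le_nhds,
    fun j => ((hf j).continuous.continuousAt.tendsto).mono_left nhdsWithin_le_nhds,
    fun j => by rw [h0]; ring⟩
  bounded j := by
    refine ⟨‖f 0 j‖ + 1, ?_⟩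
    exact ((hf j).continuous.continuousAt.norm.eventually_le_const (lt_add_one _)).filter_mono
      nhdsWithin_le_nhds

/-- The row `(p, C_ℝ[p e^{-2V}], C_{Γ_1}[p e^{-V}], …, C_{Γ_{D-1}}[p e^{-V}])`. -/
def rowOf (D : ℕ) (V : ℝ[X]) (p : ℂ[X]) (z : ℂ) : Idx D → ℂ :=
  Sum.elim ![p.eval z, cau D (C 2 * V) (D / 2) p z] fun j => cau D V (j + 1) p z

lemma goodRow_rowOf {D : ℕ} (hD : 2 ≤ D) (he : Even D) {V : ℝ[X]} (hV : Confining D V)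
    (p : ℂ[X]) : GoodRow D V (rowOf D V p) := by
  have hV2 := hV.smul (two_pos : (0 : ℝ) < 2)
  have hD2 : D / 2 < D := by omega
  refine ⟨?_, ?_, ?_⟩
  · rintro (j | j)
    · fin_cases j
      · exact p.differentiable.differentiableOn
      · exact fun z hz => (cau_differentiableAt hD hV2 hD2 p hz).differentiableWithinAt
    · exact fun z hz => (cau_differentiableAt hD hV (by omega) p hz).differentiableWithinAt
  · intro x hx
    obtain ⟨gp, gm, h1, h2, h3⟩ := cau_limits hD hV2 (by omega) hD2 p hx
    choose fp fm h4 h5 h6 using fun j : Fin (D - 1) =>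
      cau_limits hD hV (k := (j : ℕ) + 1) (by omega) (by omega) p hx
    refine ⟨Sum.elim ![p.eval x, gp] fp, Sum.elim ![p.eval x, gm] fm, ?_, ?_, ?_⟩
    · rintro (j | j)
      · fin_cases j
        · exact (p.continuous.continuousAt.tendsto).mono_left nhdsWithin_le_nhds
        · exact h1
      · exact h4 j
    · rintro (j | j)
      · fin_cases j
        · exact (p.continuous.continuousAt.tendsto).mono_left nhdsWithin_le_nhds
        · exact h2
      · exact h5 j
    · rintro (j | j)
      · fin_cases j
        · simp [jumpRow]
        · simp only [jumpRow, Sum.elim_inl]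
          change gp = gm + eval x p * realLine.indicator (fun y => exp (-2 * aeval y V)) x
          rw [h3, realLine_eq_gammaK hD he]
          simp
      · exact h6 j
  · rintro (j | j)
    · fin_cases j
      · refine ⟨‖p.eval 0‖ + 1, ?_⟩
        exact (p.continuous.continuousAt.norm.eventually_le_const (lt_add_one _)).filter_mono
          nhdsWithin_le_nhds
      · exact cau_bounded_near_zero hD hV2 hD2 p
    · exact cau_bounded_near_zero hD hV (by omega) p

/-! ### Products without jump -/

lemma det_jumpMatrix (D : ℕ) (V : ℝ[X]) (x : ℂ) : (jumpMatrix D V x).det = 1 := by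
  rw [jumpMatrix, Matrix.vecMulVec_eq Unit, Matrix.det_one_add_replicateCol_mul_replicateRow]
  simp [jumpRow]

lemma mul_jumpMatrix {D : ℕ} (V : ℝ[X]) (x : ℂ) (M : Mat D) (i j : Idx D) :
    (M * jumpMatrix D V x) i j = M i j + M i (.inl 0) * jumpRow D V x j := by
  rw [jumpMatrix, Matrix.mul_add, Matrix.mul_one, Matrix.add_apply, Matrix.mul_vecMulVec]
  simp [Matrix.vecMulVec_apply]

/-- All rows of the matrix have the prescribed jump. -/
def GoodMat (D : ℕ) (V : ℝ[X]) (A : ℂ → Mat D) : Prop := ∀ i, GoodRow D V fun z => A z i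

lemma GoodMat.limits {D : ℕ} {V : ℝ[X]} {A : ℂ → Mat D} (hA : GoodMat D V A) {x : ℂ}
    (hx : x ∈ gamma D \ {0}) : ∃ fp fm : Mat D, Tendsto A (𝓝[leftSide D x] x) (𝓝 fp) ∧
      Tendsto A (𝓝[rightSide D x] x) (𝓝 fm) ∧ fp = fm * jumpMatrix D V x := by
  choose fp fm h1 h2 h3 using fun i => (hA i).jump x hx
  refine ⟨fp, fm, tendsto_pi_nhds.2 fun i => tendsto_pi_nhds.2 (h1 i),
    tendsto_pi_nhds.2 fun i => tendsto_pi_nhds.2 (h2 i), ?_⟩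
  exact Matrix.ext fun i j => (h3 i j).trans (mul_jumpMatrix V x (Matrix.of fm) i j).symm

lemma IsEvenSolution.goodMat {D : ℕ} {V : ℝ[X]} {n : ℕ} {A : ℂ → Mat D}
    (hA : IsEvenSolution D V n A) : GoodMat D V A := by
  obtain ⟨Fp, Fm, -, -, h⟩ := hA.jump
  refine fun i => ⟨hA.analytic i, fun x hx => ?_, hA.bounded i⟩
  obtain ⟨h1, h2, h3⟩ := h x hx
  refine ⟨Fp x i, Fm x i, fun j => tendsto_pi_nhds.1 (tendsto_pi_nhds.1 h1 i) j,
    fun j => tendsto_pi_nhds.1 (tendsto_pi_nhds.1 h2 i) j, fun j => ?_⟩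
  rw [h3, mul_jumpMatrix]

lemma isEvenSolution_of_goodMat {D : ℕ} (hD : 2 ≤ D) {V : ℝ[X]} {n : ℕ} {A : ℂ → Mat D}
    (hA : GoodMat D V A) (hn : ∀ i j,
      (fun z => (A z * Matrix.diagonal (fun k => z ^ (-expo D n k)) - 1) i j)
        =O[atInf D] (fun z => z⁻¹)) : IsEvenSolution D V n A :=
  ⟨fun i => (hA i).analytic, HasJump.of_limits hD fun _ hx => hA.limits hx,
    fun i => (hA i).bounded, hn⟩

lemma differentiableWithinAt_det {𝕜 E ι : Type*} [NontriviallyNormedField 𝕜] [NormedAlgebra 𝕜 ℂ]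
    [NormedAddCommGroup E] [NormedSpace 𝕜 E] [Fintype ι] [DecidableEq ι] {M : E → Matrix ι ι ℂ}
    {s : Set E} {z : E} (h : ∀ i j, DifferentiableWithinAt 𝕜 (fun z => M z i j) s z) :
    DifferentiableWithinAt 𝕜 (fun z => (M z).det) s z := by
  simp only [Matrix.det_apply']
  refine DifferentiableWithinAt.fun_sum fun σ _ => ?_
  refine (differentiableWithinAt_const _).mul ?_
  induction (Finset.univ : Finset ι) using Finset.induction_on with
  | empty => simpa using differentiableWithinAt_const _
  | insert a u ha ih => simpa only [Finset.prod_insert ha] using (h _ _).fun_mul ih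

/-- The adjugate replaces the inverse throughout: it agrees with it once the determinant is `1`, and
being polynomial in the entries it inherits analyticity, limits and bounds. -/
lemma differentiableWithinAt_adjugate {𝕜 E ι : Type*} [NontriviallyNormedField 𝕜]
    [NormedAlgebra 𝕜 ℂ] [NormedAddCommGroup E] [NormedSpace 𝕜 E] [Fintype ι] [DecidableEq ι]
    {M : E → Matrix ι ι ℂ} {s : Set E} {z : E}
    (h : ∀ i j, DifferentiableWithinAt 𝕜 (fun z => M z i j) s z) (i j : ι) :
    DifferentiableWithinAt 𝕜 (fun z => (M z).adjugate i j) s z := by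
  simp only [Matrix.adjugate_apply]
  refine differentiableWithinAt_det fun k l => ?_
  by_cases hk : k = j
  · subst hk; simp only [Matrix.updateRow_self]; exact differentiableWithinAt_const _
  · simp only [Matrix.updateRow_ne hk]; exact h k l

lemma differentiableWithinAt_mul {𝕜 E ι : Type*} [NontriviallyNormedField 𝕜] [NormedAlgebra 𝕜 ℂ]
    [NormedAddCommGroup E] [NormedSpace 𝕜 E] [Fintype ι] {M N : E → Matrix ι ι ℂ}
    {s : Set E} {z : E} (h : ∀ i j, DifferentiableWithinAt 𝕜 (fun z => M z i j) s z)
    (h' : ∀ i j, DifferentiableWithinAt 𝕜 (fun z => N z i j) s z) (i j : ι) :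
    DifferentiableWithinAt 𝕜 (fun z => (M z * N z) i j) s z := by
  simp only [Matrix.mul_apply]
  exact DifferentiableWithinAt.fun_sum fun k _ => (h i k).mul (h' k j)

lemma isBigO_one_det {α ι : Type*} [Fintype ι] [DecidableEq ι] {l : Filter α}
    {M : α → Matrix ι ι ℂ} (h : ∀ i j, (fun z => M z i j) =O[l] fun _ => (1 : ℂ)) :
    (fun z => (M z).det) =O[l] fun _ => (1 : ℂ) := by
  simp only [Matrix.det_apply']
  refine IsBigO.fun_sum fun σ _ => IsBigO.const_mul_left ?_ _
  have := IsBigO.finsetProd (s := Finset.univ) (f := fun i z => M z (σ i) i)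
    (g := fun _ _ => (1 : ℂ)) (l := l) fun i _ => h (σ i) i
  simpa using this

lemma isBigO_one_adjugate {α ι : Type*} [Fintype ι] [DecidableEq ι] {l : Filter α}
    {M : α → Matrix ι ι ℂ} (h : ∀ i j, (fun z => M z i j) =O[l] fun _ => (1 : ℂ)) (i j : ι) :
    (fun z => (M z).adjugate i j) =O[l] fun _ => (1 : ℂ) := by
  simp only [Matrix.adjugate_apply]
  refine isBigO_one_det fun k m => ?_
  by_cases hk : k = j
  · subst hk; simp only [Matrix.updateRow_self]; exact isBigO_const_const _ one_ne_zero _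
  · simp only [Matrix.updateRow_ne hk]; exact h k m

lemma isBigO_one_of_bounded {α : Type*} {l : Filter α} {f : α → ℂ}
    (h : ∃ M : ℝ, ∀ᶠ z in l, ‖f z‖ ≤ M) : f =O[l] fun _ => (1 : ℂ) := by
  obtain ⟨M, hM⟩ := h
  exact IsBigO.of_bound M (hM.mono fun z hz => by simpa using hz)

lemma bounded_of_isBigO_one {α : Type*} {l : Filter α} {f : α → ℂ}
    (h : f =O[l] fun _ => (1 : ℂ)) : ∃ M : ℝ, ∀ᶠ z in l, ‖f z‖ ≤ M := by
  obtain ⟨M, hM⟩ := h.bound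
  exact ⟨M, hM.mono fun z hz => by simpa using hz⟩

/-- The determinant of a solution is identically `1` once it is so at infinity. -/
lemma det_eq_one_of_tendsto {D : ℕ} (hD : 2 ≤ D) {V : ℝ[X]} {A : ℂ → Mat D}
    (hA : GoodMat D V A) (hinf : Tendsto (fun z => (A z).det) (atInf D) (𝓝 1)) :
    ∀ z ∈ (gamma D)ᶜ, (A z).det = 1 := by
  have h := eq_zero_of_no_jump hD (g := fun z => (A z).det - 1) ?_ ?_ ?_ ?_
  · exact fun z hz => sub_eq_zero.1 (h z hz)
  · exact fun z hz => (differentiableWithinAt_det fun i j => (hA i).analytic j z hz).sub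
      (differentiableWithinAt_const _)
  · intro x hx
    obtain ⟨fp, fm, h1, h2, h3⟩ := hA.limits hx
    have hc : Continuous fun M : Mat D => M.det := continuous_id.matrix_det
    refine ⟨fm.det - 1, ?_, ((hc.tendsto fm).comp h2).sub_const 1⟩
    have := ((hc.tendsto fp).comp h1).sub_const 1
    rwa [h3, Matrix.det_mul, det_jumpMatrix, mul_one] at this
  · refine bounded_of_isBigO_one (IsBigO.sub (isBigO_one_det fun i j => ?_)
      (isBigO_const_const _ one_ne_zero _))
    exact isBigO_one_of_bounded ((hA i).bounded j)
  · simpa using hinf.sub_const 1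

/-- `B A^{-1}` has no jump: if it is asymptotic to a matrix of entire functions, it is equal to
it. -/
lemma mul_adjugate_eq_of_tendsto {D : ℕ} (hD : 2 ≤ D) {V : ℝ[X]} {A B : ℂ → Mat D}
    (hA : GoodMat D V A) (hB : GoodMat D V B) {R : ℂ → Mat D}
    (hR : ∀ i j, Differentiable ℂ fun z => R z i j)
    (hinf : ∀ i j, Tendsto (fun z => (B z * (A z).adjugate - R z) i j) (atInf D) (𝓝 0)) :
    ∀ z ∈ (gamma D)ᶜ, B z * (A z).adjugate = R z := by
  intro z hz
  ext i j
  have h := eq_zero_of_no_jump hD (g := fun z => (B z * (A z).adjugate - R z) i j) ?_ ?_ ?_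
    (hinf i j)
  · exact sub_eq_zero.1 (h z hz)
  · refine fun z hz => DifferentiableWithinAt.sub (differentiableWithinAt_mul
      (fun i j => (hB i).analytic j z hz) (fun i j => differentiableWithinAt_adjugate
        (fun i j => (hA i).analytic j z hz) i j) i j) (hR i j z).differentiableWithinAt
  · intro x hx
    obtain ⟨fp, fm, h1, h2, h3⟩ := hA.limits hx
    obtain ⟨gp, gm, h4, h5, h6⟩ := hB.limits hx
    have hc : Continuous fun M : Mat D × Mat D => M.1 * M.2.adjugate :=
      continuous_fst.matrix_mul continuous_snd.matrix_adjugate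
    have hent : ∀ {l : Filter ℂ} {M N : Mat D}, l ≤ 𝓝 x → Tendsto B l (𝓝 M) → Tendsto A l (𝓝 N) →
        Tendsto (fun z => (B z * (A z).adjugate - R z) i j) l
          (𝓝 ((M * N.adjugate) i j - R x i j)) := by
      intro l M N hl hM hN
      have e1 := (hc.tendsto (M, N)).comp (hM.prodMk_nhds hN)
      exact (tendsto_pi_nhds.1 (tendsto_pi_nhds.1 e1 i) j).sub
        ((hR i j).continuous.continuousAt.tendsto.mono_left hl)
    refine ⟨(gm * fm.adjugate) i j - R x i j, ?_, hent nhdsWithin_le_nhds h5 h2⟩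
    -- With `J` the jump matrix, `(B⁻ J) adj(A⁻ J) = B⁻ J adj(J) adj(A⁻) = B⁻ adj(A⁻)` because `det
    -- J = 1`.
    have := hent nhdsWithin_le_nhds h4 h1
    rwa [h3, h6, Matrix.adjugate_mul_distrib, Matrix.mul_assoc, ← Matrix.mul_assoc (jumpMatrix _ _ _),
      Matrix.mul_adjugate, det_jumpMatrix, one_smul, Matrix.one_mul] at this
  · refine bounded_of_isBigO_one ?_
    have e1 : ∀ i j, (fun z => B z i j) =O[𝓝[(gamma D)ᶜ] 0] fun _ => (1 : ℂ) := fun i j =>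
      isBigO_one_of_bounded ((hB i).bounded j)
    have e2 : ∀ i j, (fun z => (A z).adjugate i j) =O[𝓝[(gamma D)ᶜ] 0] fun _ => (1 : ℂ) :=
      fun i j => isBigO_one_adjugate (fun i j => isBigO_one_of_bounded ((hA i).bounded j)) i j
    have e3 : (fun z => R z i j) =O[𝓝[(gamma D)ᶜ] 0] fun _ => (1 : ℂ) :=
      (((hR i j).continuous.tendsto 0).mono_left nhdsWithin_le_nhds).isBigO_one ℂ
    simp only [Matrix.sub_apply, Matrix.mul_apply]
    refine IsBigO.sub (IsBigO.fun_sum fun k _ => ?_) e3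
    simpa using (e1 i k).mul (e2 k j)

/-! ### Linear functionals that depend on the deformation parameter -/

/-- A family of linear functionals on polynomials whose derivative in the parameter is
`p ↦ -κ F (X p)`. -/
structure MovingFunctional (κ : ℂ) (F : ℝ → ℂ[X] → ℂ) : Prop where
  linear : ∀ t, IsLinearMap ℂ (F t)
  deriv : ∀ p t, HasDerivAt (fun s => F s p) (-(κ * F t (X * p))) t

lemma MovingFunctional.const {f : ℂ[X] → ℂ} (hf : IsLinearMap ℂ f) :
    MovingFunctional 0 fun _ => f :=
  ⟨fun _ => hf, fun p t => (hasDerivAt_const t (f p)).congr_deriv (by simp)⟩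

lemma MovingFunctional.const_mul {κ : ℂ} {F : ℝ → ℂ[X] → ℂ} (h : MovingFunctional κ F) (a : ℂ) :
    MovingFunctional κ fun t p => a * F t p :=
  ⟨fun t => ⟨fun p q => by rw [(h.linear t).map_add, mul_add], fun c p => by
    rw [(h.linear t).map_smul, smul_eq_mul, smul_eq_mul]; ring⟩,
    fun p t => ((h.deriv p t).const_mul a).congr_deriv (by ring)⟩

lemma MovingFunctional.zero (κ : ℂ) : MovingFunctional κ fun _ _ => 0 :=
  ⟨fun _ => ⟨fun _ _ => by simp, fun _ _ => by simp⟩,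
    fun _ t => (hasDerivAt_const t (0 : ℂ)).congr_deriv (by simp)⟩

/-- The polynomial `q₀ + ∑ c_e X^e`. -/
def trialPoly {N : ℕ} (q₀ : ℂ[X]) (c : Fin N → ℂ) : ℂ[X] := q₀ + ∑ e, c e • X ^ (e : ℕ)

lemma IsLinearMap.map_trialPoly {f : ℂ[X] → ℂ} (hf : IsLinearMap ℂ f) {N : ℕ} (q₀ : ℂ[X])
    (c : Fin N → ℂ) : f (trialPoly q₀ c) = f q₀ + ∑ e, c e * f (X ^ (e : ℕ)) := by
  have h := (hf.mk' f).map_add q₀ (∑ e, c e • X ^ (e : ℕ))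
  rw [map_sum] at h
  simpa [trialPoly] using h

lemma degree_sum_smul_X_pow_lt {N : ℕ} (c : Fin N → ℂ) :
    (∑ e, c e • X ^ (e : ℕ) : ℂ[X]).degree < N := by
  refine (degree_sum_le _ _).trans_lt ((Finset.sup_lt_iff (WithBot.bot_lt_coe _)).2 fun k _ => ?_)
  refine (degree_smul_le _ _).trans_lt ?_
  rw [degree_X_pow]
  exact_mod_cast k.2

lemma coeff_sum_smul_X_pow {N : ℕ} (c : Fin N → ℂ) (e : Fin N) :
    (∑ e, c e • X ^ (e : ℕ) : ℂ[X]).coeff e = c e := by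
  rw [finsetSum_coeff, Finset.sum_eq_single e]
  · simp
  · intro b _ hb
    rw [coeff_smul, coeff_X_pow, if_neg (fun h => hb (Fin.ext h.symm)), smul_zero]
  · simp

/-- Product rule: the polynomial moves with derivative `trialPoly 0 c'`, and differentiating the
weight inserts `-κ X`. Applied to coefficients, moments and Cauchy transforms alike, it gives all
`t`-derivatives of the solution and of its expansion. -/
lemma MovingFunctional.hasDerivAt {κ : ℂ} {F : ℝ → ℂ[X] → ℂ} (h : MovingFunctional κ F) {N : ℕ}
    (q₀ : ℂ[X]) {c : ℝ → Fin N → ℂ} {c' : Fin N → ℂ} {t : ℝ}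
    (hc : ∀ e, HasDerivAt (fun s => c s e) (c' e) t) :
    HasDerivAt (fun s => F s (trialPoly q₀ (c s)))
      (F t (trialPoly 0 c' - κ • (X * trialPoly q₀ (c t)))) t := by
  have hl := h.linear t
  simp only [IsLinearMap.map_trialPoly (h.linear _)]
  refine ((h.deriv q₀ t).add (HasDerivAt.fun_sum (u := Finset.univ) fun e _ =>
    (hc e).mul (h.deriv (X ^ (e : ℕ)) t))).congr_deriv ?_
  have e1 : X * trialPoly q₀ (c t) = X * q₀ + ∑ e, c t e • (X * X ^ (e : ℕ)) := by
    rw [trialPoly, mul_add, Finset.mul_sum]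
    simp only [mul_smul_comm]
  have e2 := (hl.mk' _).map_add (X * q₀) (∑ e, c t e • (X * X ^ (e : ℕ)))
  rw [map_sum, ← e1] at e2
  simp only [IsLinearMap.mk'_apply, hl.map_smul, smul_eq_mul] at e2
  rw [hl.map_sub, hl.map_smul, IsLinearMap.map_trialPoly hl, hl.map_zero, e2,
    Finset.sum_add_distrib, smul_eq_mul, mul_add, Finset.mul_sum, zero_add]
  have e3 : ∑ e, c t e * -(κ * F t (X * X ^ (e : ℕ))) =
      -∑ e, κ * (c t e * F t (X * X ^ (e : ℕ))) := by
    rw [← Finset.sum_neg_distrib]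
    exact Finset.sum_congr rfl fun e _ => by ring
  rw [e3]
  ring

/-- A nondegenerate system of moving functionals can be solved differentiably in the parameter. -/
lemma exists_trialPoly {N : ℕ} {κ : Fin N → ℂ} {L : Fin N → ℝ → ℂ[X] → ℂ}
    (hL : ∀ e, MovingFunctional (κ e) (L e))
    (hnd : ∀ t (p : ℂ[X]), p.degree < N → (∀ e, L e t p = 0) → p = 0) (q₀ : ℂ[X])
    (β : Fin N → ℂ) : ∃ c c' : ℝ → Fin N → ℂ,
      (∀ t e, HasDerivAt (fun s => c s e) (c' t e) t) ∧
        ∀ t e, L e t (trialPoly q₀ (c t)) = β e := by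
  -- The system in the monomial basis. Nondegeneracy makes it invertible for every `t`, and Cramer's
  -- formula transfers differentiability to the solution.
  set M : ℝ → Matrix (Fin N) (Fin N) ℂ := fun t => Matrix.of fun e e' => L e t (X ^ (e' : ℕ))
    with hM
  have hdet : ∀ t, (M t).det ≠ 0 := by
    intro t h0
    obtain ⟨v, hv0, hv⟩ := Matrix.exists_mulVec_eq_zero_iff.2 h0
    have hp := hnd t _ (degree_sum_smul_X_pow_lt v) fun e => by
      have h1 := congrFun hv e
      have h2 := IsLinearMap.map_trialPoly ((hL e).linear t) 0 v
      rw [((hL e).linear t).map_zero, zero_add, trialPoly, zero_add] at h2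
      rw [h2]
      rw [Matrix.mulVec, dotProduct] at h1
      simpa only [hM, Matrix.of_apply, mul_comm, Pi.zero_apply] using h1
    exact hv0 (funext fun e => by rw [← coeff_sum_smul_X_pow v e, hp]; simp)
  have hMd : ∀ t e e', DifferentiableAt ℝ (fun s => M s e e') t := fun t e e' =>
    ((hL e).deriv (X ^ (e' : ℕ)) t).differentiableAt
  have hinv : ∀ t e e', DifferentiableAt ℝ (fun s => (M s)⁻¹ e e') t := by
    intro t e e'
    simp only [Matrix.inv_def, Ring.inverse_eq_inv', Matrix.smul_apply, smul_eq_mul]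
    have h1 : DifferentiableAt ℝ (fun s => (M s).det) t := by
      rw [← differentiableWithinAt_univ]
      exact differentiableWithinAt_det fun i j => (hMd t i j).differentiableWithinAt
    have h2 : DifferentiableAt ℝ (fun s => (M s).adjugate e e') t := by
      rw [← differentiableWithinAt_univ]
      exact differentiableWithinAt_adjugate (fun i j => (hMd t i j).differentiableWithinAt) e e'
    exact (h1.inv (hdet t)).mul h2
  refine ⟨fun t => (M t)⁻¹.mulVec fun e => β e - L e t q₀,
    fun t e => deriv (fun s => ((M s)⁻¹.mulVec fun e => β e - L e s q₀) e) t, fun t e => ?_,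
    fun t e => ?_⟩
  · refine DifferentiableAt.hasDerivAt ?_
    simp only [Matrix.mulVec, dotProduct]
    exact DifferentiableAt.fun_sum fun e' _ => (hinv t e e').mul
      ((differentiableAt_const _).sub ((hL e').deriv q₀ t).differentiableAt)
  · rw [IsLinearMap.map_trialPoly ((hL e).linear t)]
    have h1 : (M t).mulVec ((M t)⁻¹.mulVec fun e => β e - L e t q₀) = fun e => β e - L e t q₀ := by
      rw [Matrix.mulVec_mulVec, Matrix.mul_nonsing_inv _ (isUnit_iff_ne_zero.2 (hdet t)),
        Matrix.one_mulVec]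
    have h2 := congrFun h1 e
    rw [Matrix.mulVec, dotProduct] at h2
    simp only [hM, Matrix.of_apply] at h2
    simp only [mul_comm _ (L e t _)]
    rw [h2]
    ring

lemma confining_deform {D : ℕ} (hD : 2 ≤ D) {V₀ : ℝ[X]} (hV : Confining D V₀) (t : ℝ) :
    Confining D (deform V₀ t) :=
  hV.add (by rw [natDegree_X]; omega) t

lemma two_mul_deform (V₀ : ℝ[X]) (t : ℝ) :
    C 2 * deform V₀ t = C 2 * V₀ + C t * (C 2 * X) := by
  rw [deform]; ring

lemma map_C_two_mul_X : (C (2 : ℝ) * X : ℝ[X]).map (algebraMap ℝ ℂ) = (2 : ℂ) • X := by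
  rw [Polynomial.map_mul, map_C, map_X, smul_eq_C_mul]
  simp

lemma isLinearMap_mom {D : ℕ} (hD : 2 ≤ D) {V₀ : ℝ[X]} (hV : Confining D V₀)
    (k m : ℕ) : IsLinearMap ℂ fun p => mom D V₀ k (p * X ^ m) where
  map_add p q := by rw [add_mul]; exact map_add (momL hD hV k) _ _
  map_smul c p := by rw [smul_mul_assoc]; exact map_smul (momL hD hV k) _ _

lemma isLinearMap_cau {D : ℕ} (hD : 2 ≤ D) {V₀ : ℝ[X]} (hV : Confining D V₀)
    {k : ℕ} (hk : k < D) {z : ℂ} (hz : z ∈ (gamma D)ᶜ) :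
    IsLinearMap ℂ fun p => cau D V₀ k p z where
  map_add p q := cau_add hD hV hk p q hz
  map_smul c p := cau_smul D V₀ k c p z

lemma movingFunctional_mom {D : ℕ} (hD : 2 ≤ D) {V₀ : ℝ[X]} (hV : Confining D V₀)
    (k m : ℕ) :
    MovingFunctional 1 fun t p => mom D (deform V₀ t) k (p * X ^ m) where
  linear t := isLinearMap_mom hD (confining_deform hD hV t) k m
  deriv p t := by
    refine (hasDerivAt_mom hD hV (by rw [natDegree_X]; omega) k (p * X ^ m) t).congr_deriv ?_
    rw [map_X, one_mul, deform, mul_assoc]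

lemma movingFunctional_mom_two {D : ℕ} (hD : 2 ≤ D) {V₀ : ℝ[X]} (hV : Confining D V₀)
    (k m : ℕ) :
    MovingFunctional 2 fun t p => mom D (C 2 * deform V₀ t) k (p * X ^ m) where
  linear t := isLinearMap_mom hD ((confining_deform hD hV t).smul two_pos) k m
  deriv p t := by
    simp only [two_mul_deform]
    have hV2 := hV.smul (two_pos : (0 : ℝ) < 2)
    have hX : (C (2 : ℝ) * X).natDegree < D := by
      rw [natDegree_C_mul_X _ two_ne_zero]; omega
    refine (hasDerivAt_mom hD hV2 hX k (p * X ^ m) t).congr_deriv ?_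
    rw [map_C_two_mul_X, smul_mul_assoc, ← mul_assoc X p, ← momL_apply hD (hV2.add hX t), map_smul]
    rfl

lemma movingFunctional_cau {D : ℕ} (hD : 2 ≤ D) {V₀ : ℝ[X]} (hV : Confining D V₀)
    {k : ℕ} (hk : k < D) {z : ℂ} (hz : z ∈ (gamma D)ᶜ) :
    MovingFunctional 1 fun t p => cau D (deform V₀ t) k p z where
  linear t := isLinearMap_cau hD (confining_deform hD hV t) hk hz
  deriv p t := by
    refine (hasDerivAt_cau hD hV (by rw [natDegree_X]; omega) hk p hz t).congr_deriv ?_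
    rw [map_X, one_mul, deform]

lemma movingFunctional_cau_two {D : ℕ} (hD : 2 ≤ D) {V₀ : ℝ[X]} (hV : Confining D V₀)
    {k : ℕ} (hk : k < D) {z : ℂ} (hz : z ∈ (gamma D)ᶜ) :
    MovingFunctional 2 fun t p => cau D (C 2 * deform V₀ t) k p z where
  linear t := isLinearMap_cau hD ((confining_deform hD hV t).smul two_pos) hk hz
  deriv p t := by
    simp only [two_mul_deform]
    have hV2 := hV.smul (two_pos : (0 : ℝ) < 2)
    have hX : (C (2 : ℝ) * X).natDegree < D := by
      rw [natDegree_C_mul_X _ two_ne_zero]; omega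
    refine (hasDerivAt_cau hD hV2 hX hk p hz t).congr_deriv ?_
    rw [map_C_two_mul_X, smul_mul_assoc, cau_smul]

/-! ### Expansions at infinity -/

/-- The coefficient of `z^{-r}` in the entry `j` of `rowOf p`, normalised by `z^{-expo j}`. -/
def rowCoeff (D n : ℕ) (V : ℝ[X]) (j : Idx D) (r : ℕ) (p : ℂ[X]) : ℂ :=
  Sum.elim
    ![if r ≤ 2 * n + (D - 1) then p.coeff (2 * n + (D - 1) - r) else 0,
      -- A Cauchy transform has no constant term at infinity. Without this case the truncated
      -- subtraction below would insert the zeroth moment for `n = r = 0`.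
      if 2 * n + r = 0 then 0 else
        -(2 * Real.pi * I)⁻¹ * mom D (C 2 * V) (D / 2) (p * X ^ (2 * n + r - 1))]
    (fun k : Fin (D - 1) => -(2 * Real.pi * I)⁻¹ * mom D V ((k : ℕ) + 1) (p * X ^ r)) j

/-- The multiplicities `(0, 2, 1, …, 1)` of `V` in the weights. -/
def kap (D : ℕ) : Idx D → ℂ := Sum.elim ![0, 2] fun _ => 1

lemma movingFunctional_rowCoeff {D : ℕ} (hD : 2 ≤ D) {V₀ : ℝ[X]} (hV : Confining D V₀) (n : ℕ)
    (j : Idx D) (r : ℕ) :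
    MovingFunctional (kap D j) fun t => rowCoeff D n (deform V₀ t) j r := by
  rcases j with j | j
  · fin_cases j
    · by_cases h : r ≤ 2 * n + (D - 1)
      · have e : (fun t => rowCoeff D n (deform V₀ t) (.inl 0) r) = fun _ p =>
            p.coeff (2 * n + (D - 1) - r) := by
          funext t p; simp [rowCoeff, h]
        exact e ▸ MovingFunctional.const ⟨fun p q => coeff_add _ _ _, fun c p => coeff_smul _ _ _⟩
      · have e : (fun t => rowCoeff D n (deform V₀ t) (.inl 0) r) = fun _ _ => 0 := by
          funext t p; simp [rowCoeff, h]
        exact e ▸ MovingFunctional.zero _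
    · by_cases h : 2 * n + r = 0
      · have e : (fun t => rowCoeff D n (deform V₀ t) (.inl 1) r) = fun _ _ => 0 := by
          funext t p; simp [rowCoeff, h]
        exact e ▸ MovingFunctional.zero _
      · have e : (fun t => rowCoeff D n (deform V₀ t) (.inl 1) r) = fun t p =>
            -(2 * Real.pi * I)⁻¹ * mom D (C 2 * deform V₀ t) (D / 2) (p * X ^ (2 * n + r - 1)) := by
          funext t p; simp only [rowCoeff, Sum.elim_inl, Matrix.cons_val_one, h, if_false]
          rfl
        exact e ▸ (movingFunctional_mom_two hD hV _ _).const_mul _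
  · exact (movingFunctional_mom hD hV _ _).const_mul _

lemma movingFunctional_rowOf {D : ℕ} (hD : 2 ≤ D) {V₀ : ℝ[X]} (hV : Confining D V₀)
    {z : ℂ} (hz : z ∈ (gamma D)ᶜ) (j : Idx D) :
    MovingFunctional (kap D j) fun t p => rowOf D (deform V₀ t) p z j := by
  rcases j with j | j
  · fin_cases j
    · exact MovingFunctional.const ⟨fun p q => eval_add, fun c p => eval_smul _ _ _⟩
    · exact movingFunctional_cau_two hD hV (by omega) hz
  · exact movingFunctional_cau hD hV (by omega) hz

lemma inv_isBigO_one (D : ℕ) : (fun z : ℂ => z⁻¹) =O[atInf D] fun _ => (1 : ℂ) := by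
  refine IsBigO.of_bound 1 ?_
  filter_upwards [eventually_atInf D 1] with z hz
  rw [norm_inv, norm_one, mul_one]
  exact inv_le_one_of_one_le₀ hz.1.le

lemma inv_pow_isBigO {D k l : ℕ} (h : k ≤ l) :
    (fun z : ℂ => z⁻¹ ^ l) =O[atInf D] fun z => z⁻¹ ^ k := by
  obtain ⟨m, rfl⟩ := Nat.exists_eq_add_of_le h
  have := (isBigO_refl (fun z : ℂ => z⁻¹ ^ k) (atInf D)).mul ((inv_isBigO_one D).pow m)
  simpa [pow_add] using this

/-- `pow_mul_cau` with exponent `d + 4` is exact, and its remainder is a Cauchy transform, bounded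
at infinity. Dividing by `z^4` leaves the expansion; the vanishing low moments are those that would
produce positive powers of `z`. -/
lemma cau_expansion {D : ℕ} (hD : 2 ≤ D) {Q : ℝ[X]} (hQ : Confining D Q) {k : ℕ} (hk : k < D)
    (p : ℂ[X]) (d : ℕ) (hlow : ∀ m, m + 1 < d → mom D Q k (p * X ^ m) = 0) :
    (fun z => cau D Q k p z * z ^ d - ∑ r ∈ Finset.range 4, z⁻¹ ^ r *
      (if d + r = 0 then 0 else -(2 * Real.pi * I)⁻¹ * mom D Q k (p * X ^ (d + r - 1))))
      =O[atInf D] fun z => z⁻¹ ^ 4 := by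
  have h1 : (fun z => cau D Q k (p * X ^ (d + 4)) z * z⁻¹ ^ 4 -
      (2 * Real.pi * I)⁻¹ * mom D Q k (p * X ^ (d + 3)) * z⁻¹ ^ 4) =O[atInf D]
        fun z => z⁻¹ ^ 4 := by
    refine IsBigO.sub ?_ ((isBigO_refl _ _).const_mul_left _)
    simpa only [one_mul] using
      (cau_isBigO_one hD hQ hk (p * X ^ (d + 4))).mul (isBigO_refl (fun z : ℂ => z⁻¹ ^ 4) _)
  refine h1.congr' ?_ EventuallyEq.rfl
  filter_upwards [eventually_atInf D 0] with z hz
  have hz0 : z ≠ 0 := norm_pos_iff.1 hz.1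
  have h2 := pow_mul_cau hD hQ hk p hz.2 (d + 4)
  have h3 : cau D Q k p z * z ^ d = z⁻¹ ^ 4 * (z ^ (d + 4) * cau D Q k p z) := by
    rw [pow_add, inv_pow]; field_simp
  rw [h3, h2]
  rcases d with _ | d
  · simp [Finset.sum_range_succ]
    field_simp
    ring
  · have h4 : ∑ m ∈ Finset.range (d + 5), mom D Q k (p * X ^ m) * z ^ (d + 4 - m) =
        mom D Q k (p * X ^ d) * z ^ 4 + mom D Q k (p * X ^ (d + 1)) * z ^ 3 +
        mom D Q k (p * X ^ (d + 2)) * z ^ 2 + mom D Q k (p * X ^ (d + 3)) * z +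
        mom D Q k (p * X ^ (d + 4)) := by
      rw [Finset.sum_range_succ, Finset.sum_range_succ, Finset.sum_range_succ,
        Finset.sum_range_succ, Finset.sum_range_succ, Finset.sum_eq_zero, zero_add,
        show d + 4 - d = 4 by omega, show d + 4 - (d + 1) = 3 by omega,
        show d + 4 - (d + 2) = 2 by omega, show d + 4 - (d + 3) = 1 by omega, Nat.sub_self,
        pow_one, pow_zero, mul_one]
      intro m hm
      rw [hlow m (by have := Finset.mem_range.1 hm; omega), zero_mul]
    rw [show d + 1 + 4 = d + 5 by omega, show d + 5 - 1 = d + 4 by omega, h4]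
    simp only [Finset.sum_range_succ, Finset.sum_range_zero,
      show d + 1 + 0 ≠ 0 by omega, show d + 1 + 1 ≠ 0 by omega, show d + 1 + 2 ≠ 0 by omega,
      show d + 1 + 3 ≠ 0 by omega, if_false, show d + 1 + 0 - 1 = d by omega,
      show d + 1 + 1 - 1 = d + 1 by omega, show d + 1 + 2 - 1 = d + 2 by omega,
      show d + 1 + 3 - 1 = d + 3 by omega, show d + 1 + 3 = d + 4 by omega]
    field_simp
    ring

lemma eval_expansion (D : ℕ) {p : ℂ[X]} {N : ℕ} (hp : p.degree ≤ N) :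
    (fun z => p.eval z * z⁻¹ ^ N - ∑ r ∈ Finset.range 4, z⁻¹ ^ r *
      (if r ≤ N then p.coeff (N - r) else 0)) =O[atInf D] fun z => z⁻¹ ^ 4 := by
  have h1 : (fun z : ℂ => ∑ r ∈ Finset.range (N + 1), z⁻¹ ^ (4 + r) *
      (if 4 + r ≤ N then p.coeff (N - (4 + r)) else 0)) =O[atInf D] fun z => z⁻¹ ^ 4 := by
    refine IsBigO.fun_sum fun r _ => ?_
    simp only [mul_comm _ (ite _ _ _)]
    exact (inv_pow_isBigO (by omega)).const_mul_left _
  refine h1.congr' ?_ EventuallyEq.rfl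
  filter_upwards [eventually_atInf D 0] with z hz
  have hz0 : z ≠ 0 := norm_pos_iff.1 hz.1
  have h2 : p.eval z * z⁻¹ ^ N = ∑ r ∈ Finset.range (4 + (N + 1)), z⁻¹ ^ r *
      (if r ≤ N then p.coeff (N - r) else 0) := by
    rw [add_comm 4, Finset.sum_range_add, eval_eq_sum_range' (n := N + 1)
      (Nat.lt_succ_of_le (natDegree_le_iff_degree_le.2 hp)), ← Finset.sum_range_reflect,
      Finset.sum_mul, Finset.sum_eq_zero (s := Finset.range 4), add_zero]
    · refine Finset.sum_congr rfl fun r hr => ?_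
      have hr' : r ≤ N := Nat.lt_succ_iff.1 (Finset.mem_range.1 hr)
      rw [if_pos hr', show N + 1 - 1 - r = N - r by omega]
      obtain ⟨m, rfl⟩ := Nat.exists_eq_add_of_le hr'
      rw [Nat.add_sub_cancel_left, pow_add]
      have h3 : z ^ m * z⁻¹ ^ m = 1 := by rw [← mul_pow, mul_inv_cancel₀ hz0, one_pow]
      linear_combination p.coeff m * z⁻¹ ^ r * h3
    · intro r _
      rw [if_neg (by omega), mul_zero]
  rw [h2, Finset.sum_range_add _ 4 (N + 1), add_sub_cancel_left]

lemma rowOf_expansion {D : ℕ} (hD : 2 ≤ D) {V : ℝ[X]} (hV : Confining D V) (n : ℕ) (j : Idx D)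
    {p : ℂ[X]} (hdeg : j = .inl 0 → p.degree ≤ ((2 * n + (D - 1) : ℕ) : WithBot ℕ))
    (hlow : j = .inl 1 → ∀ m, m + 1 < 2 * n → mom D (C 2 * V) (D / 2) (p * X ^ m) = 0) :
    (fun z => rowOf D V p z j * z ^ (-expo D n j) -
      ∑ r ∈ Finset.range 4, z⁻¹ ^ r * rowCoeff D n V j r p) =O[atInf D] fun z => z⁻¹ ^ 4 := by
  rcases j with j | j
  · fin_cases j
    · refine (eval_expansion D (hdeg rfl)).congr (fun z => ?_) fun z => rfl
      have e : -expo D n (.inl 0) = -((2 * n + (D - 1) : ℕ) : ℤ) := by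
        simp only [expo, Sum.elim_inl, Matrix.cons_val_zero]
        push_cast [Nat.cast_sub (show 1 ≤ D by omega)]
        ring
      simp only [Fin.zero_eta, e, zpow_neg, zpow_natCast, inv_pow]
      rfl
    · refine (cau_expansion hD (hV.smul two_pos) (by omega) p (2 * n) (hlow rfl)).congr
        (fun z => ?_) fun z => rfl
      have e : -expo D n (.inl 1) = ((2 * n : ℕ) : ℤ) := by simp [expo]
      simp only [Fin.mk_one, e, zpow_natCast]
      rfl
  · refine (cau_expansion hD hV (k := j + 1) (by omega) p 1 (by omega)).congr
      (fun z => ?_) fun z => rfl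
    simp [rowOf, rowCoeff, expo]

lemma degree_twist_lt {D : ℕ} (hD : 2 ≤ D) {Q : ℝ[X]} (hQ : Confining D Q) {q : ℂ[X]} {m : ℕ}
    (hq : q.degree < m) : (twist Q q).degree < ((m + (D - 1) : ℕ) : WithBot ℕ) := by
  by_cases hq0 : q = 0
  · simp only [hq0, twist, derivative_zero, mul_zero, sub_zero, degree_zero]
    exact WithBot.bot_lt_coe _
  have h1 : q.natDegree < m := (natDegree_lt_iff_degree_lt hq0).2 hq
  refine (degree_sub_le _ _).trans_lt (max_lt ?_ ?_)
  · refine (degree_derivative_le.trans_lt hq).trans_le ?_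
    exact_mod_cast Nat.le_add_right _ _
  · rw [degree_mul, degree_derivative_potential hD hQ, degree_eq_natDegree hq0]
    exact_mod_cast (by omega : D - 1 + q.natDegree < m + (D - 1))

/-! ### The solution -/

/-- The polynomials of the first column of the solution, differentiable in the parameter. -/
lemma exists_rowPoly {D : ℕ} (hD : 2 ≤ D) (he : Even D) {V₀ : ℝ[X]} (hV : Confining D V₀) (n : ℕ) :
    ∃ P P' : Idx D → ℝ → ℂ[X],
      (∀ κ F, MovingFunctional κ F → ∀ i t,
        HasDerivAt (fun s => F s (P i s)) (F t (P' i t - κ • (X * P i t))) t) ∧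
      (∀ i t, (P i t - if i = Sum.inl 0 then X ^ (2 * n + (D - 1)) else 0).degree <
        ((2 * n + (D - 1) : ℕ) : WithBot ℕ)) ∧
      (∀ i t, (P' i t).degree < ((2 * n + (D - 1) : ℕ) : WithBot ℕ)) ∧
      (∀ i t, ∀ k < 2 * n, mom D (C 2 * deform V₀ t) (D / 2) (P i t * X ^ k) =
        if i = .inl 1 ∧ k + 1 = 2 * n then -(2 * Real.pi * I) else 0) ∧
      ∀ i t (j : Fin (D - 1)), mom D (deform V₀ t) (j + 1) (P i t) =
        if i = .inr j then -(2 * Real.pi * I) else 0 := by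
  -- There are `2n + (D - 1)` conditions for as many free coefficients. The factor `X ^ 0` gives
  -- both families the shape of moving functionals.
  set L : Fin (2 * n) ⊕ Fin (D - 1) → ℝ → ℂ[X] → ℂ :=
    Sum.elim (fun k t p => mom D (C 2 * deform V₀ t) (D / 2) (p * X ^ (k : ℕ)))
      (fun j t p => mom D (deform V₀ t) ((j : ℕ) + 1) (p * X ^ 0)) with hLdef
  have hL : ∀ e, MovingFunctional (Sum.elim (fun _ => 2) (fun _ => 1) e) (L e) := by
    rintro (k | j)
    · exact movingFunctional_mom_two hD hV _ _
    · exact movingFunctional_mom hD hV _ _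
  -- Leading coefficients of Cauchy transforms are `-(2πi)⁻¹` times moments, so the value `-2πi`
  -- produces the diagonal entry `1`. For `n = 0` the row with index `2` receives only zeros.
  set b : Idx D → Fin (2 * n) ⊕ Fin (D - 1) → ℂ := fun i =>
    Sum.elim (fun k => if i = .inl 1 ∧ (k : ℕ) + 1 = 2 * n then -(2 * Real.pi * I) else 0)
      (fun j => if i = .inr j then -(2 * Real.pi * I) else 0) with hb
  choose c c' hc hcL using fun i : Idx D =>
    exists_trialPoly (N := 2 * n + (D - 1)) (L := fun e => L (finSumFinEquiv.symm e))
      (fun e => hL (finSumFinEquiv.symm e)) (fun t p hp h => by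
        have h' : ∀ e, L e t p = 0 := fun e => by simpa using h (finSumFinEquiv e)
        exact eq_zero_of_all_moments hD he (confining_deform hD hV t) hp
          (fun j => by simpa [hLdef] using h' (.inr j)) fun k hk => h' (.inl ⟨k, hk⟩))
      (if i = .inl 0 then X ^ (2 * n + (D - 1)) else 0) (fun e => b i (finSumFinEquiv.symm e))
  have hcL' : ∀ i t e, L e t (trialPoly (if i = .inl 0 then X ^ (2 * n + (D - 1)) else 0) (c i t)) =
      b i e := fun i t e => by simpa using hcL i t (finSumFinEquiv e)
  refine ⟨fun i t => trialPoly (if i = .inl 0 then X ^ (2 * n + (D - 1)) else 0) (c i t),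
    fun i t => trialPoly 0 (c' i t), fun κ F hF i t => hF.hasDerivAt _ (hc i t), fun i t => ?_,
    fun i t => ?_, fun i t k hk => ?_, fun i t j => ?_⟩
  · simp only [trialPoly, add_sub_cancel_left]
    exact degree_sum_smul_X_pow_lt _
  · simp only [trialPoly, zero_add]
    exact degree_sum_smul_X_pow_lt _
  · exact hcL' i t (.inl ⟨k, hk⟩)
  · simpa [hLdef, hb] using hcL' i t (.inr j)

/-- The solutions of the even problem for all `t`, their derivatives in `t`, and their expansions
at infinity. -/
structure SolFamily (D : ℕ) (V₀ : ℝ[X]) (n : ℕ) where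
  A : ℝ → ℂ → Mat D
  A' : ℝ → ℂ → Mat D
  B : ℝ → ℂ → Mat D
  c : ℕ → ℝ → Mat D
  c' : ℕ → ℝ → Mat D
  good : ∀ t, GoodMat D (deform V₀ t) (A t)
  goodB : ∀ t, GoodMat D (deform V₀ t) (B t)
  -- The jump matrix depends on `t` by `∂_t J = z (J σ - σ J)`. So `∂_t A` alone does not satisfy
  -- the jump relation, but `∂_t A - z A σ` does, with the same `J`.
  B_eq : ∀ t, ∀ z ∈ (gamma D)ᶜ, B t z = A' t z - z • (A t z * sigma D)
  hasDerivAt : ∀ t, ∀ z ∈ (gamma D)ᶜ, ∀ i j, HasDerivAt (fun s => A s z i j) (A' t z i j) t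
  expand : ∀ t i j, (fun z => A t z i j * z ^ (-expo D n j) -
    ∑ r ∈ Finset.range 4, z⁻¹ ^ r * c r t i j) =O[atInf D] fun z => z⁻¹ ^ 4
  expand' : ∀ t i j, (fun z => A' t z i j * z ^ (-expo D n j) -
    ∑ r ∈ Finset.range 4, z⁻¹ ^ r * c' r t i j) =O[atInf D] fun z => z⁻¹ ^ 4
  c_zero : ∀ t, c 0 t = 1
  hasDerivAt_c : ∀ r t i j, HasDerivAt (fun s => c r s i j) (c' r t i j) t
  c_one_12 : ∀ t, c 1 t (.inl 0) (.inl 1) = 0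
  c_one_21 : ∀ t, c 1 t (.inl 1) (.inl 0) = 0
  c_of_zero : n = 0 → ∀ r t j, 0 < r → c r t (.inl 1) j = 0

lemma mul_sigma_apply {D : ℕ} (M : Mat D) (i j : Idx D) :
    (M * sigma D) i j = M i j * Sum.elim ![1, -1] (fun _ => 0) j := by
  rw [sigma, E1, E2, Matrix.mul_sub, Matrix.sub_apply, Matrix.mul_diagonal, Matrix.mul_diagonal,
    ← mul_sub]
  congr 1
  rcases j with j | j
  · fin_cases j <;> simp
  · simp

/-- The quadratic relation satisfied by the two distinguished rows. -/
lemma coeff_mul_mom_eq_zero {D : ℕ} (hD : 2 ≤ D) {V : ℝ[X]} (hV : Confining D V) {q : ℂ[X]} {m : ℕ}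
    (hq : q.degree < ((m + 1 : ℕ) : WithBot ℕ))
    (h : ∀ k < m, mom D (C 2 * V) (D / 2) (twist V q * X ^ k) = 0) :
    q.coeff m * mom D (C 2 * V) (D / 2) (twist V q * X ^ m) = 0 := by
  -- Expanding the second argument of the form at `(q, q)`, the hypotheses annihilate all terms but
  -- the one of the top coefficient.
  have h1 := skew_form_self hD hV (D / 2) q
  rw [mom_mul_eq_sum hD (hV.smul two_pos) _ _ _ hq, Finset.sum_range_succ, Finset.sum_eq_zero,
    zero_add] at h1
  · exact h1
  · intro k hk
    rw [h k (Finset.mem_range.1 hk), mul_zero]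

lemma degree_lt_of_coeff_eq_zero {q : ℂ[X]} {m : ℕ} (hq : q.degree < ((m + 1 : ℕ) : WithBot ℕ))
    (h : q.coeff m = 0) : q.degree < (m : WithBot ℕ) := by
  rw [degree_lt_iff_coeff_zero] at hq ⊢
  intro k hk
  rcases hk.eq_or_lt with rfl | hk
  · exact h
  · exact hq k hk

/-- Row `i` is `rowOf` of the polynomial found in `exists_rowPoly`, up to one constant entry for `n
= 0`. Jump and boundedness hold for any polynomial, the moment conditions give the normalisation,
and the `t`-derivative is again of the form `rowOf`, entry by entry. -/
theorem nonempty_solFamily {D : ℕ} (hD : 2 ≤ D) (he : Even D) {V₀ : ℝ[X]} (hV : Confining D V₀)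
    (n : ℕ) : Nonempty (SolFamily D V₀ n) := by
  obtain ⟨P, P', hmov, hdeg, hdeg', hmom2, hmom⟩ := exists_rowPoly hD he hV n
  have hVt := confining_deform hD hV
  have hpi : (2 * Real.pi * I : ℂ) ≠ 0 := two_pi_I_ne_zero
  set N := 2 * n + (D - 1) with hN
  -- For `n = 0` the entry `(2,2)` must tend to `1`, which the Cauchy transform cannot do since the
  -- polynomial of that row is `0`. The constant `1` is added, without effect on the jump.
  set exc : Idx D → Idx D → ℂ := fun i j => if n = 0 ∧ i = .inl 1 ∧ j = .inl 1 then 1 else 0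
    with hexc
  -- In the second column, the Cauchy transform of `X P` and `z` times that of `P` differ by a
  -- constant moment. This correction and the contribution of `exc` are entire in `z`, hence
  -- jump-free.
  set ent : ℝ → ℂ → Idx D → Idx D → ℂ := fun t z i => Sum.elim
    ![0, z * exc i (.inl 1) -
      (2 * Real.pi * I)⁻¹ * mom D (C 2 * deform V₀ t) (D / 2) (P i t)] fun _ => 0 with hent
  have hexc0 : ∀ i j, j ≠ .inl 1 → exc i j = 0 := fun i j hj => if_neg fun h => hj h.2.2
  have hdegle : ∀ i t, (P i t).degree ≤ (N : WithBot ℕ) := by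
    intro i t
    have h1 : P i t = (P i t - if i = .inl 0 then X ^ N else 0) + if i = .inl 0 then X ^ N else 0 := by
      ring
    rw [h1]
    refine (degree_add_le _ _).trans (max_le (hdeg i t).le ?_)
    split_ifs <;> simp
  have hdeg1 : ∀ i t, i ≠ .inl 0 → (P i t).degree < (N : WithBot ℕ) := by
    intro i t hi
    simpa [hi] using hdeg i t
  have hP0 : n = 0 → ∀ t, P (.inl 1) t = 0 := by
    intro h0 t
    refine eq_zero_of_all_moments hD he (hVt t) (hdeg1 _ t (by simp)) (fun j => ?_) fun k hk => ?_
    · rw [hmom]; simp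
    · omega
  refine ⟨
    { A := fun t z => Matrix.of fun i j => rowOf D (deform V₀ t) (P i t) z j + exc i j
      A' := fun t z => Matrix.of fun i j =>
        rowOf D (deform V₀ t) (P' i t - kap D j • (X * P i t)) z j
      B := fun t z => Matrix.of fun i j =>
        rowOf D (deform V₀ t) (P' i t - X * P i t) z j + ent t z i j
      c := fun r t => Matrix.of fun i j =>
        rowCoeff D n (deform V₀ t) j r (P i t) + if r = 0 then exc i j else 0
      c' := fun r t => Matrix.of fun i j =>
        rowCoeff D n (deform V₀ t) j r (P' i t - kap D j • (X * P i t))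
      good := ?_, goodB := ?_, B_eq := ?_, hasDerivAt := ?_, expand := ?_, expand' := ?_,
      c_zero := ?_, hasDerivAt_c := ?_, c_one_12 := ?_, c_one_21 := ?_, c_of_zero := ?_ }⟩
  · exact fun t i => (goodRow_rowOf hD he (hVt t) _).add (GoodRow.of_entire
      (fun j => differentiable_const _) fun z => hexc0 _ _ (by simp))
  · refine fun t i => (goodRow_rowOf hD he (hVt t) _).add (GoodRow.of_entire ?_ fun z => rfl)
    rintro (j | j)
    · fin_cases j
      · exact differentiable_const _
      · exact (differentiable_id.mul_const _).sub_const _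
    · exact differentiable_const _
  · intro t z hz
    ext i j
    rw [Matrix.sub_apply, Matrix.smul_apply, mul_sigma_apply]
    simp only [Matrix.of_apply]
    rcases j with j | j
    · fin_cases j
      · have := hexc0 i (.inl 0) (by simp)
        simp [rowOf, kap, hent, this]
      · have hl := isLinearMap_cau hD ((hVt t).smul two_pos) (k := D / 2) (by omega) hz
        have h1 := cau_X_mul hD ((hVt t).smul two_pos) (k := D / 2) (by omega) (P i t) hz
        have h2 := hl.map_sub (P' i t) (X * P i t)
        have h3 := hl.map_sub (P' i t) ((2 : ℂ) • (X * P i t))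
        have h4 := hl.map_smul 2 (X * P i t)
        simp only [smul_eq_mul] at h4
        simp only [Fin.mk_one, rowOf, hent, kap, Sum.elim_inl, Matrix.cons_val_one,
          Matrix.cons_val_fin_one, smul_eq_mul]
        linear_combination h2 - h3 + h4 + h1
    · have := hexc0 i (.inr j) (by simp)
      simp [rowOf, kap, hent]
  · intro t z hz i j
    exact (hmov _ _ (movingFunctional_rowOf hD hV hz j) i t).add_const _
  · intro t i j
    refine (rowOf_expansion hD (hVt t) n j (fun _ => hdegle i t) fun _ m hm => ?_).congr
      (fun z => ?_) fun z => rfl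
    · rw [hmom2 i t m (by omega), if_neg (by omega)]
    · have e1 : exc i j * z ^ (-expo D n j) = exc i j := by
        by_cases h : n = 0 ∧ i = .inl 1 ∧ j = .inl 1
        · rw [h.2.2, h.1]; simp [expo]
        · simp [hexc, h]
      simp only [Matrix.of_apply, add_mul, e1, mul_add, Finset.sum_add_distrib]
      simp
  · intro t i j
    refine rowOf_expansion hD (hVt t) n j (fun hj => ?_) fun hj m hm => ?_
    · subst hj
      rw [← hN]
      simpa [kap] using (hdeg' i t).le
    · subst hj
      -- The prescribed moments do not depend on `t`, so the corresponding moments of the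
      -- differentiated row vanish, which is the condition for the expansion of `∂_t A`.
      have h1 := hmov _ _ (movingFunctional_mom_two hD hV (D / 2) m) i t
      have h2 : (fun s => mom D (C 2 * deform V₀ s) (D / 2) (P i s * X ^ m)) =
          fun _ => if i = .inl 1 ∧ m + 1 = 2 * n then -(2 * Real.pi * I) else 0 :=
        funext fun s => hmom2 i s m (by omega)
      rw [h2] at h1
      exact h1.unique (hasDerivAt_const _ _)
  · intro t
    ext i j
    simp only [Matrix.of_apply, if_true]
    rcases j with j | j
    · fin_cases j
      · have h1 := hexc0 i (.inl 0) (by simp)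
        have h2 := (degree_lt_iff_coeff_zero _ _).1 (hdeg i t) N le_rfl
        rw [coeff_sub, sub_eq_zero] at h2
        simp only [Fin.zero_eta, h1, rowCoeff, Sum.elim_inl, Matrix.cons_val_zero, Nat.zero_le,
          if_true, Nat.sub_zero, ← hN, h2, add_zero, Matrix.one_apply]
        split_ifs <;> simp
      · by_cases hn : n = 0
        · simp [rowCoeff, hexc, hn, Matrix.one_apply]
        · have h1 : exc i (.inl 1) = 0 := if_neg fun h => hn h.1
          have h2 := hmom2 i t (2 * n - 1) (by omega)
          rw [show 2 * n - 1 + 1 = 2 * n by omega] at h2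
          simp only [Fin.mk_one, h1, rowCoeff, Sum.elim_inl, Matrix.cons_val_one,
            Matrix.cons_val_fin_one, add_zero, Matrix.one_apply, h2]
          rw [if_neg (by omega)]
          by_cases hi : i = .inl 1
          · simp only [hi, and_self, if_true]; field_simp
          · simp [hi]
    · have h1 := hexc0 i (.inr j) (by simp)
      simp only [h1, rowCoeff, Sum.elim_inr, pow_zero, mul_one, hmom, add_zero, Matrix.one_apply]
      by_cases hi : i = .inr j
      · simp only [hi, if_true]; field_simp
      · simp [hi]
  · intro r t i j
    exact (hmov _ _ (movingFunctional_rowCoeff hD hV n j r) i t).add_const _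
  · intro t
    -- The first polynomial is exact with primitive factor `q` of degree at most `2n`, and
    -- orthogonality reduces the form at `(q, q)` to `q_{2n}` times the next moment. Since `P` is
    -- monic of degree `N`, `q_{2n} ≠ 0`, so that moment vanishes.
    obtain ⟨q, hq, hPq⟩ := exists_eq_twist hD (hVt t) (N := 2 * n + 1) (p := P (.inl 0) t)
      ((hdegle _ t).trans_lt (by exact_mod_cast (by omega : N < 2 * n + 1 + (D - 1))))
      (fun j => by rw [hmom]; simp)
    have h1 := coeff_mul_mom_eq_zero hD (hVt t) hq fun k hk => by
      rw [← hPq, hmom2 _ t k hk]; simp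
    rcases mul_eq_zero.1 h1 with h2 | h2
    · exfalso
      have h3 := degree_twist_lt hD (hVt t) (degree_lt_of_coeff_eq_zero hq h2)
      rw [← hPq] at h3
      have h4 := (degree_lt_iff_coeff_zero _ _).1 h3 N le_rfl
      have h5 := (degree_lt_iff_coeff_zero _ _).1 (hdeg (.inl 0) t) N le_rfl
      simp [h4] at h5
    · rw [← hPq] at h2
      simp [rowCoeff, h2]
  · intro t
    -- The same relation with the roles exchanged: for `n > 0` the moment of order `2n - 1` is `-2πi
    -- ≠ 0`, so the top coefficient of `q` vanishes and the degree of `P` drops by one.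
    have h0 : (P (.inl 1) t).coeff (N - 1) = 0 := by
      by_cases hn : n = 0
      · rw [hP0 hn]; simp
      obtain ⟨q, hq, hPq⟩ := exists_eq_twist hD (hVt t) (N := 2 * n) (p := P (.inl 1) t)
        (hdeg1 _ t (by simp)) (fun j => by rw [hmom]; simp)
      obtain ⟨m, hm⟩ : ∃ m, 2 * n = m + 1 := ⟨2 * n - 1, by omega⟩
      rw [hm] at hq
      have h1 := coeff_mul_mom_eq_zero hD (hVt t) hq fun k hk => by
        rw [← hPq, hmom2 _ t k (by omega), if_neg (by omega)]
      rw [← hPq, hmom2 _ t m (by omega), if_pos ⟨rfl, hm.symm⟩] at h1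
      have h2 : q.coeff m = 0 := (mul_eq_zero.1 h1).resolve_right (neg_ne_zero.2 hpi)
      have h3 := degree_twist_lt hD (hVt t) (degree_lt_of_coeff_eq_zero hq h2)
      rw [← hPq] at h3
      exact (degree_lt_iff_coeff_zero _ _).1 h3 (N - 1) (by omega)
    simp [rowCoeff, ← hN, h0]
  · intro hn r t j hr
    have hl := (movingFunctional_rowCoeff hD hV n j r).linear t
    simp only [Matrix.of_apply, hP0 hn, hl.map_zero, hr.ne', if_false, add_zero]

/-! ### Matrix expansions in powers of `z⁻¹` -/

/-- All entries are `O(z^{-k})` at infinity. -/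
def MatO (D k : ℕ) (F : ℂ → Mat D) : Prop :=
  ∀ i j, (fun z => F z i j) =O[atInf D] fun z => z⁻¹ ^ k

lemma neBot_atInf {D : ℕ} (hD : 2 ≤ D) : (atInf D).NeBot := by
  rw [atInf, inf_principal_neBot_iff]
  intro U hU
  rw [← comap_norm_atTop, mem_comap] at hU
  obtain ⟨s, hs, hsU⟩ := hU
  obtain ⟨R, hR⟩ := mem_atTop_sets.1 hs
  obtain ⟨z, hz, hzg⟩ := (dense_compl_gamma hD).inter_open_nonempty {z : ℂ | R < ‖z‖}
    (isOpen_lt continuous_const continuous_norm)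
    ⟨((|R| + 1 : ℝ) : ℂ), by
      simp only [Set.mem_ofPred_eq, norm_real, Real.norm_eq_abs]
      exact (lt_of_le_of_lt (le_abs_self R) (lt_add_one _)).trans_le (le_abs_self _)⟩
  exact ⟨z, hsU (hR _ (le_of_lt hz)), hzg⟩

lemma eventually_ne_zero (D : ℕ) : ∀ᶠ z in atInf D, z ≠ 0 ∧ z ∈ (gamma D)ᶜ :=
  (eventually_atInf D 0).mono fun _ hz => ⟨norm_pos_iff.1 hz.1, hz.2⟩

lemma tendsto_inv_atInf (D : ℕ) : Tendsto (fun z : ℂ => z⁻¹) (atInf D) (𝓝 0) :=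
  tendsto_inv₀_cobounded.mono_left inf_le_left

lemma MatO.congr' {D k : ℕ} {F G : ℂ → Mat D} (h : MatO D k F) (he : F =ᶠ[atInf D] G) :
    MatO D k G := fun i j =>
  (h i j).congr' (he.mono fun z hz => by simp only [hz]) EventuallyEq.rfl

lemma MatO.add {D k : ℕ} {F G : ℂ → Mat D} (hF : MatO D k F) (hG : MatO D k G) :
    MatO D k fun z => F z + G z := fun i j => (hF i j).add (hG i j)

lemma MatO.sub {D k : ℕ} {F G : ℂ → Mat D} (hF : MatO D k F) (hG : MatO D k G) :
    MatO D k fun z => F z - G z := fun i j => (hF i j).sub (hG i j)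

lemma MatO.mono {D k l : ℕ} {F : ℂ → Mat D} (hF : MatO D l F) (h : k ≤ l) : MatO D k F :=
  fun i j => (hF i j).trans (inv_pow_isBigO h)

lemma MatO.mul {D k l : ℕ} {F G : ℂ → Mat D} (hF : MatO D k F) (hG : MatO D l G) :
    MatO D (k + l) fun z => F z * G z := fun i j => by
  simp only [Matrix.mul_apply, pow_add]
  exact IsBigO.fun_sum fun m _ => (hF i m).mul (hG m j)

lemma MatO.const {D : ℕ} (M : Mat D) : MatO D 0 fun _ => M := fun i j => by
  simpa using isBigO_const_const (M i j) (one_ne_zero (α := ℂ)) (atInf D)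

lemma MatO.smul {D k : ℕ} {F : ℂ → Mat D} (hF : MatO D k F) (m : ℕ) :
    MatO D (k + m) fun z => z⁻¹ ^ m • F z := fun i j => by
  simp only [Matrix.smul_apply, smul_eq_mul, pow_add, mul_comm _ (_ ^ m)]
  exact (isBigO_refl _ _).mul (hF i j)

lemma MatO.of_smul {D k m : ℕ} {F : ℂ → Mat D} (hF : MatO D (k + m) fun z => z⁻¹ ^ m • F z) :
    MatO D k F := fun i j => by
  refine ((isBigO_refl (fun z : ℂ => z ^ m) (atInf D)).mul (hF i j)).congr' ?_ ?_
  · filter_upwards [eventually_ne_zero D] with z hz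
    have := hz.1
    simp only [Matrix.smul_apply, smul_eq_mul]
    rw [← mul_assoc, ← mul_pow, mul_inv_cancel₀ this, one_pow, one_mul]
  · filter_upwards [eventually_ne_zero D] with z hz
    have := hz.1
    rw [pow_add, mul_left_comm, ← mul_pow, mul_inv_cancel₀ this, one_pow, mul_one]

lemma MatO.tendsto {D k : ℕ} {F : ℂ → Mat D} (hF : MatO D (k + 1) F) (i j : Idx D) :
    Tendsto (fun z => F z i j) (atInf D) (𝓝 0) := by
  have := (tendsto_inv_atInf D)
  refine ((hF.mono (Nat.le_add_left 1 k)) i j).trans_tendsto ?_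
  simpa using this

lemma MatO.eq_zero {D k : ℕ} (hD : 2 ≤ D) {M : Mat D} (h : MatO D (k + 1) fun z => z⁻¹ ^ k • M) :
    M = 0 := by
  have := neBot_atInf hD
  rw [add_comm] at h
  have h1 : MatO D (0 + 1) fun _ => M := MatO.of_smul h
  ext i j
  exact tendsto_nhds_unique tendsto_const_nhds (h1.tendsto i j)

/-- `F = ∑_{r < K} f_r z^{-r} + O(z^{-K})` at infinity. -/
def Expands (D K : ℕ) (F : ℂ → Mat D) (f : ℕ → Mat D) : Prop :=
  MatO D K fun z => F z - ∑ r ∈ Finset.range K, z⁻¹ ^ r • f r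

lemma MatO.sum_pow {D : ℕ} (f : ℕ → Mat D) (s : Finset ℕ) {k : ℕ} (hs : ∀ r ∈ s, k ≤ r) :
    MatO D k fun z => ∑ r ∈ s, z⁻¹ ^ r • f r := fun i j => by
  simp only [Matrix.sum_apply, Matrix.smul_apply, smul_eq_mul, mul_comm _ (f _ i j)]
  exact IsBigO.fun_sum fun r hr => (inv_pow_isBigO (hs r hr)).const_mul_left _

lemma Expands.congr' {D K : ℕ} {F G : ℂ → Mat D} {f : ℕ → Mat D} (h : Expands D K F f)
    (he : F =ᶠ[atInf D] G) : Expands D K G f :=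
  MatO.congr' h (he.mono fun z hz => by simp only [hz])

lemma Expands.mono {D K L : ℕ} {F : ℂ → Mat D} {f : ℕ → Mat D} (h : Expands D L F f)
    (hKL : K ≤ L) : Expands D K F f := by
  obtain ⟨m, rfl⟩ := Nat.exists_eq_add_of_le hKL
  have h1 : MatO D K fun z => ∑ r ∈ Finset.Ico K (K + m), z⁻¹ ^ r • f r :=
    MatO.sum_pow f _ fun r hr => (Finset.mem_Ico.1 hr).1
  refine ((MatO.mono h hKL).add h1).congr' (Eventually.of_forall fun z => ?_)
  simp only
  rw [Finset.sum_Ico_eq_sub _ hKL]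
  abel

lemma Expands.matO {D K : ℕ} {F : ℂ → Mat D} {f : ℕ → Mat D} (h : Expands D K F f) :
    MatO D 0 F := by
  simpa [Expands] using h.mono (Nat.zero_le K)

lemma Expands.sub {D K : ℕ} {F G : ℂ → Mat D} {f g : ℕ → Mat D} (hF : Expands D K F f)
    (hG : Expands D K G g) : Expands D K (fun z => F z - G z) fun r => f r - g r := by
  refine (MatO.sub hF hG).congr' (Eventually.of_forall fun z => ?_)
  simp only [smul_sub, Finset.sum_sub_distrib]
  abel

lemma Expands.sum_pow {D : ℕ} (f : ℕ → Mat D) (K : ℕ) :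
    Expands D K (fun z => ∑ r ∈ Finset.range K, z⁻¹ ^ r • f r) f := fun i j => by
  simpa using isBigO_zero _ _

lemma Expands.const {D K : ℕ} (M : Mat D) :
    Expands D K (fun _ => M) fun r => if r = 0 then M else 0 := by
  rcases K with _ | K
  · simpa [Expands] using MatO.const M
  · refine (Expands.sum_pow _ (K + 1)).congr' (Eventually.of_forall fun z => ?_)
    simp

lemma Expands.smul {D K : ℕ} {F : ℂ → Mat D} {f : ℕ → Mat D} (h : Expands D K F f) :
    Expands D (K + 1) (fun z => z⁻¹ • F z) fun r => if r = 0 then 0 else f (r - 1) := by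
  refine (MatO.smul h 1).congr' (Eventually.of_forall fun z => ?_)
  simp only [Finset.sum_range_succ', smul_sub, Finset.smul_sum, smul_smul, pow_succ']
  simp

lemma Expands.mul {D K : ℕ} {F G : ℂ → Mat D} {f g : ℕ → Mat D} (hF : Expands D K F f)
    (hG : Expands D K G g) : Expands D K (fun z => F z * G z)
      fun m => ∑ k ∈ Finset.range (m + 1), f k * g (m - k) := by
  -- The error of the product is the error of `F` times `G`, plus each term `z⁻¹ ^ r • f r` times
  -- the error of `G` truncated at order `K - r`.
  have h1 : MatO D K fun z => (F z - ∑ r ∈ Finset.range K, z⁻¹ ^ r • f r) * G z := by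
    simpa using MatO.mul hF hG.matO
  have h2 : MatO D K fun z => ∑ r ∈ Finset.range K,
      z⁻¹ ^ r • (f r * (G z - ∑ s ∈ Finset.range (K - r), z⁻¹ ^ s • g s)) := by
    intro i j
    simp only [Matrix.sum_apply]
    refine IsBigO.fun_sum fun r hr => ?_
    have h3 := (MatO.mul (MatO.const (f r)) (hG.mono (Nat.sub_le K r))).smul r
    rw [zero_add, Nat.sub_add_cancel (Finset.mem_range.1 hr).le] at h3
    exact h3 i j
  refine (h1.add h2).congr' (Eventually.of_forall fun z => ?_)
  simp only
  have h3 : ∑ m ∈ Finset.range K, z⁻¹ ^ m • ∑ k ∈ Finset.range (m + 1), f k * g (m - k) =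
      ∑ r ∈ Finset.range K, ∑ s ∈ Finset.range (K - r), z⁻¹ ^ (r + s) • (f r * g s) := by
    rw [← Finset.sum_range_diag_flip K fun r s => z⁻¹ ^ (r + s) • (f r * g s)]
    refine Finset.sum_congr rfl fun m _ => ?_
    rw [Finset.smul_sum]
    refine Finset.sum_congr rfl fun k hk => ?_
    rw [Nat.add_sub_cancel' (Nat.lt_succ_iff.1 (Finset.mem_range.1 hk))]
  rw [h3]
  simp only [Matrix.sub_mul, Finset.sum_mul, Matrix.mul_sub, smul_sub, Finset.mul_sum,
    Finset.smul_sum, Finset.sum_sub_distrib, Matrix.smul_mul, Matrix.mul_smul, smul_smul, pow_add]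
  abel

lemma Expands.unique {D K : ℕ} (hD : 2 ≤ D) {F : ℂ → Mat D} {f g : ℕ → Mat D} (hF : Expands D K F f)
    (hG : Expands D K F g) {r : ℕ} (hr : r < K) : f r = g r := by
  have h := hF.sub hG
  simp only [sub_self] at h
  induction r using Nat.strong_induction_on with
  | _ r ih =>
    have h1 := h.mono (Nat.succ_le_of_lt hr)
    have h2 : MatO D (r + 1) fun z => z⁻¹ ^ r • (g r - f r) := by
      refine MatO.congr' h1 (Eventually.of_forall fun z => ?_)
      simp only [Nat.succ_eq_add_one, Finset.sum_range_succ]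
      rw [Finset.sum_eq_zero, zero_add, zero_sub, ← smul_neg, neg_sub]
      intro s hs
      have hs' := Finset.mem_range.1 hs
      rw [ih s hs' (hs'.trans hr), sub_self, smul_zero]
    exact (sub_eq_zero.1 (h2.eq_zero hD)).symm

lemma MatO.adjugate {D : ℕ} {F : ℂ → Mat D} (hF : MatO D 0 F) :
    MatO D 0 fun z => (F z).adjugate := fun i j => by
  simpa using isBigO_one_adjugate (M := F) (l := atInf D) (fun i j => by simpa using hF i j) i j

/-- The first coefficients of the expansion of the inverse. -/
def invCoeff {D : ℕ} (c : ℕ → Mat D) : ℕ → Mat D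
  | 0 => 1
  | 1 => -c 1
  | 2 => c 1 ^ 2 - c 2
  | _ => 0

/-- The truncated Neumann series multiplies `F` to `1 + O(z⁻³)`. Multiplying by the adjugate, which
is bounded and is the inverse because the determinant is `1`, transfers the error. -/
lemma Expands.adjugate {D : ℕ} {F : ℂ → Mat D} {c : ℕ → Mat D} (h : Expands D 4 F c)
    (h0 : c 0 = 1) (hdet : ∀ᶠ z in atInf D, (F z).det = 1) :
    Expands D 3 (fun z => (F z).adjugate) (invCoeff c) := by
  have h1 := ((h.mono (by norm_num : 3 ≤ 4)).mul (Expands.sum_pow (invCoeff c) 3)).sub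
    (Expands.const 1)
  have h2 : MatO D 3 fun z => F z * ∑ r ∈ Finset.range 3, z⁻¹ ^ r • invCoeff c r - 1 := by
    refine MatO.congr' h1 (Eventually.of_forall fun z => ?_)
    simp [Finset.sum_range_succ, invCoeff, h0, pow_two, smul_sub]
    abel
  have h3 := MatO.mul (MatO.sub (MatO.const 0) h.matO.adjugate) h2
  rw [zero_add] at h3
  refine h3.congr' ?_
  filter_upwards [hdet] with z hz
  have h4 := Matrix.adjugate_mul (F z)
  rw [hz, one_smul] at h4
  simp only [zero_sub, Matrix.neg_mul, Matrix.mul_sub, Matrix.mul_one, ← Matrix.mul_assoc, h4,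
    Matrix.one_mul]
  abel

/-! ### The normalisation at infinity -/

/-- `diag(z^{2n+D-1}, z^{-2n}, z^{-1}, …, z^{-1})`. -/
def normDiag (D n : ℕ) (z : ℂ) : Mat D := Matrix.diagonal fun k => z ^ expo D n k

/-- The inverse of `normDiag`. -/
def normDiagInv (D n : ℕ) (z : ℂ) : Mat D := Matrix.diagonal fun k => z ^ (-expo D n k)

lemma normDiag_mul_inv (D n : ℕ) {z : ℂ} (hz : z ≠ 0) :
    normDiag D n z * normDiagInv D n z = 1 := by
  rw [normDiag, normDiagInv, Matrix.diagonal_mul_diagonal, ← Matrix.diagonal_one]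
  congr 1
  funext k
  rw [← zpow_add₀ hz, add_neg_cancel, zpow_zero]

lemma normDiagInv_mul (D n : ℕ) {z : ℂ} (hz : z ≠ 0) :
    normDiagInv D n z * normDiag D n z = 1 :=
  mul_eq_one_comm.1 (normDiag_mul_inv D n hz)

/-- The exponents `2n + D - 1`, `-2n` and `D - 1` times `-1` add up to zero. Hence `det A` tends to
`1` at infinity. -/
lemma det_normDiagInv {D : ℕ} (hD : 2 ≤ D) (n : ℕ) {z : ℂ} (hz : z ≠ 0) :
    (normDiagInv D n z).det = 1 := by
  have h : ∀ s : Finset (Idx D), ∏ k ∈ s, z ^ (-expo D n k) = z ^ ∑ k ∈ s, -expo D n k := by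
    intro s
    induction s using Finset.induction_on with
    | empty => simp
    | insert a s ha ih => rw [Finset.prod_insert ha, Finset.sum_insert ha, ih, zpow_add₀ hz]
  rw [normDiagInv, Matrix.det_diagonal, h]
  have : ∑ k, -expo D n k = 0 := by
    simp only [Fintype.sum_sum_type, expo, Sum.elim_inl, Sum.elim_inr, Fin.sum_univ_two,
      Matrix.cons_val_zero, Matrix.cons_val_one, Matrix.cons_val_fin_one, neg_neg,
      Finset.sum_const, Finset.card_univ, Fintype.card_fin, nsmul_eq_mul, mul_one]
    push_cast [Nat.cast_sub (show 1 ≤ D by omega)]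
    ring
  rw [this, zpow_zero]

lemma adjugate_mul_normDiagInv {D : ℕ} (hD : 2 ≤ D) (n : ℕ) {z : ℂ} (hz : z ≠ 0) (M : Mat D) :
    (M * normDiagInv D n z).adjugate = normDiag D n z * M.adjugate := by
  rw [Matrix.adjugate_mul_distrib]
  congr 1
  calc (normDiagInv D n z).adjugate
      = (normDiagInv D n z).adjugate * (normDiagInv D n z * normDiag D n z) := by
        rw [normDiagInv_mul D n hz, Matrix.mul_one]
    _ = normDiag D n z := by
        rw [← Matrix.mul_assoc, Matrix.adjugate_mul, det_normDiagInv hD n hz, one_smul,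
          Matrix.one_mul]

lemma det_eq_one_of_matO {D : ℕ} (hD : 2 ≤ D) {V : ℝ[X]} {n : ℕ} {A : ℂ → Mat D}
    (hA : GoodMat D V A) (h : MatO D 1 fun z => A z * normDiagInv D n z - 1) :
    ∀ z ∈ (gamma D)ᶜ, (A z).det = 1 := by
  refine det_eq_one_of_tendsto hD hA ?_
  have h1 : Tendsto (fun z => A z * normDiagInv D n z) (atInf D) (𝓝 1) := by
    refine tendsto_pi_nhds.2 fun i => tendsto_pi_nhds.2 fun j => ?_
    simpa using (h.tendsto (k := 0) i j).add_const ((1 : Mat D) i j)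
  have hc : Continuous fun M : Mat D => M.det := continuous_id.matrix_det
  have h2 := (hc.tendsto 1).comp h1
  rw [Matrix.det_one] at h2
  refine h2.congr' ?_
  filter_upwards [eventually_ne_zero D] with z hz
  simp only [Function.comp_apply, Matrix.det_mul, det_normDiagInv hD n hz.1, mul_one]

lemma IsEvenSolution.matO {D : ℕ} {V : ℝ[X]} {n : ℕ} {A : ℂ → Mat D}
    (hA : IsEvenSolution D V n A) : MatO D 1 fun z => A z * normDiagInv D n z - 1 := fun i j => by
  simpa only [pow_one, normDiagInv] using hA.normalised i j

lemma isEvenSolution_iff {D : ℕ} (hD : 2 ≤ D) {V : ℝ[X]} {n : ℕ} {A : ℂ → Mat D} :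
    IsEvenSolution D V n A ↔
      GoodMat D V A ∧ MatO D 1 fun z => A z * normDiagInv D n z - 1 :=
  ⟨fun h => ⟨h.goodMat, h.matO⟩, fun h => isEvenSolution_of_goodMat hD h.1 fun i j => by
    simpa only [pow_one, normDiagInv] using h.2 i j⟩

lemma MatO.adjugate_normalised {D : ℕ} (hD : 2 ≤ D) {n : ℕ} {A : ℂ → Mat D}
    (h : MatO D 1 fun z => A z * normDiagInv D n z - 1) :
    MatO D 0 fun z => normDiag D n z * (A z).adjugate := by
  have h1 : MatO D 0 fun z => A z * normDiagInv D n z := by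
    refine ((h.mono zero_le_one).add (MatO.const 1)).congr' (Eventually.of_forall fun z => ?_)
    simp
  refine h1.adjugate.congr' ?_
  filter_upwards [eventually_ne_zero D] with z hz
  exact adjugate_mul_normDiagInv hD n hz.1 _

/-- Uniqueness of the solution. -/
theorem IsEvenSolution.eqOn {D : ℕ} (hD : 2 ≤ D) {V : ℝ[X]} {n : ℕ} {A B : ℂ → Mat D}
    (hA : IsEvenSolution D V n A) (hB : IsEvenSolution D V n B) : Set.EqOn B A (gamma D)ᶜ := by
  have hdA := det_eq_one_of_matO hD hA.goodMat hA.matO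
  have h1 : ∀ z ∈ (gamma D)ᶜ, B z * (A z).adjugate = 1 := by
    refine mul_adjugate_eq_of_tendsto hD hA.goodMat hB.goodMat (R := fun _ => 1)
      (fun i j => differentiable_const _) fun i j => ?_
    -- Inserting the normalising diagonal and its inverse, `(B - A) A⁻¹` is `O(z⁻¹)` times a bounded
    -- matrix.
    have h2 := (hB.matO.sub hA.matO).mul (MatO.adjugate_normalised hD hA.matO)
    refine (h2.tendsto (k := 0) i j).congr' ?_
    filter_upwards [eventually_ne_zero D] with z hz
    have h3 := Matrix.mul_adjugate (A z)
    rw [hdA z hz.2, one_smul] at h3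
    rw [sub_sub_sub_cancel_right, Matrix.sub_mul, Matrix.mul_assoc, Matrix.mul_assoc,
      ← Matrix.mul_assoc (normDiagInv D n z), normDiagInv_mul D n hz.1, Matrix.one_mul, h3]
  intro z hz
  have h3 := Matrix.adjugate_mul (A z)
  rw [hdA z hz, one_smul] at h3
  calc B z = B z * ((A z).adjugate * A z) := by rw [h3, Matrix.mul_one]
    _ = A z := by rw [← Matrix.mul_assoc, h1 z hz, Matrix.one_mul]

/-! ### The inverse transpose and its jump -/

lemma hat_eq_of_det {D : ℕ} {A : ℂ → Mat D} {z : ℂ} (h : (A z).det = 1) :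
    hat A z = (A z).adjugate.transpose := by
  rw [hat, Matrix.inv_def, h, Ring.inverse_one, one_smul]

/-- The jump matrix is unipotent: the perturbation squares to zero because the first entry of
`jumpRow` is `0`. -/
lemma adjugate_jumpMatrix (D : ℕ) (V : ℝ[X]) (x : ℂ) :
    (jumpMatrix D V x).adjugate =
      1 - Matrix.vecMulVec (Pi.single (Sum.inl 0) 1) (jumpRow D V x) := by
  have h0 : Matrix.vecMulVec (Pi.single (Sum.inl 0 : Idx D) 1) (jumpRow D V x) *
      Matrix.vecMulVec (Pi.single (Sum.inl 0 : Idx D) 1) (jumpRow D V x) = 0 := by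
    rw [Matrix.vecMulVec_mul_vecMulVec]
    simp [jumpRow]
  have h1 : jumpMatrix D V x *
      (1 - Matrix.vecMulVec (Pi.single (Sum.inl 0) 1) (jumpRow D V x)) = 1 := by
    rw [jumpMatrix, Matrix.add_mul, Matrix.mul_sub, Matrix.mul_sub, h0]
    simp
  calc (jumpMatrix D V x).adjugate
      = (jumpMatrix D V x).adjugate * (jumpMatrix D V x *
          (1 - Matrix.vecMulVec (Pi.single (Sum.inl 0) 1) (jumpRow D V x))) := by
        rw [h1, Matrix.mul_one]
    _ = _ := by rw [← Matrix.mul_assoc, Matrix.adjugate_mul, det_jumpMatrix, one_smul,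
          Matrix.one_mul]

/-- The matrix `e^{V σ}`. -/
def expDiag (D : ℕ) (V : ℝ[X]) (z : ℂ) : Mat D :=
  Matrix.diagonal (Sum.elim ![exp (aeval z V), exp (-aeval z V)] fun _ => 1)

/-- Conjugation by `e^{Vσ}` removes the potential from the jump, since `e^{-2V} e^V = e^{-V}` in the
second row and `e^{-V} e^V = 1` in the rows below. Thus the jump no longer depends on `n` or `t`. -/
lemma adjugate_jumpMatrix_mul_expDiag (D : ℕ) (V : ℝ[X]) (x : ℂ) :
    (jumpMatrix D V x).adjugate.transpose * expDiag D V x = expDiag D V x * constJump D x := by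
  rw [adjugate_jumpMatrix, constJump, expDiag, Matrix.transpose_sub, Matrix.transpose_one,
    Matrix.sub_mul, Matrix.mul_sub, Matrix.one_mul, Matrix.mul_one]
  congr 1
  ext i j
  rw [Matrix.mul_diagonal, Matrix.diagonal_mul, Matrix.transpose_apply, Matrix.vecMulVec_apply,
    Matrix.vecMulVec_apply]
  rcases j with j | j
  · fin_cases j
    · rcases i with i | i
      · fin_cases i
        · simp [jumpRow, constCol]
        · by_cases h : x ∈ realLine
          · simp [jumpRow, constCol, h, ← exp_add]; ring_nf
          · simp [jumpRow, constCol, h]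
      · by_cases h : x ∈ gammaK D (i + 1)
        · simp [jumpRow, constCol, h, ← exp_add]
        · simp [jumpRow, constCol, h]
    · simp
  · simp

theorem IsEvenSolution.hasJump_breve {D : ℕ} (hD : 2 ≤ D) {V : ℝ[X]} {n : ℕ} {A : ℂ → Mat D}
    (hA : IsEvenSolution D V n A) : HasJump D (breve V A) (constJump D) := by
  have hdA := det_eq_one_of_matO hD hA.goodMat hA.matO
  refine HasJump.of_limits hD fun x hx => ?_
  obtain ⟨fp, fm, h1, h2, h3⟩ := hA.goodMat.limits hx
  have hE : Continuous (expDiag D V) := by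
    refine Continuous.matrix_diagonal (continuous_pi ?_)
    have hV : Continuous fun z : ℂ => aeval z V := Polynomial.continuous_aeval V
    rintro (j | j)
    · fin_cases j
      · exact continuous_exp.comp hV
      · exact continuous_exp.comp hV.neg
    · exact continuous_const
  have hc : Continuous fun M : Mat D × Mat D => M.1.adjugate.transpose * M.2 :=
    (continuous_fst.matrix_adjugate.matrix_transpose).matrix_mul continuous_snd
  have hlim : ∀ {l : Filter ℂ} {M : Mat D}, l ≤ 𝓝 x → (∀ᶠ z in l, z ∈ (gamma D)ᶜ) →
      Tendsto A l (𝓝 M) → Tendsto (breve V A) l (𝓝 (M.adjugate.transpose * expDiag D V x)) := by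
    intro l M hl hg hM
    have e1 := (hc.tendsto (M, expDiag D V x)).comp
      (hM.prodMk_nhds ((hE.tendsto x).mono_left hl))
    refine e1.congr' (hg.mono fun z hz => ?_)
    simp only [Function.comp_apply]
    rw [breve, hat_eq_of_det (hdA z hz), expDiag]
  refine ⟨_, _, hlim nhdsWithin_le_nhds (eventually_not_mem_gamma_left hD hx) h1,
    hlim nhdsWithin_le_nhds (eventually_not_mem_gamma_right hD hx) h2, ?_⟩
  rw [h3, Matrix.adjugate_mul_distrib, Matrix.transpose_mul, Matrix.mul_assoc,
    adjugate_jumpMatrix_mul_expDiag, Matrix.mul_assoc]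

/-- The rows of `A^{-1}` other than the first have no jump. -/
lemma adjugate_row_eq_of_tendsto {D : ℕ} (hD : 2 ≤ D) {V : ℝ[X]} {A : ℂ → Mat D}
    (hA : GoodMat D V A) {i : Idx D} (hi : i ≠ .inl 0) {j : Idx D} {R : ℂ → ℂ}
    (hR : Differentiable ℂ R)
    (hinf : Tendsto (fun z => (A z).adjugate i j - R z) (atInf D) (𝓝 0)) :
    ∀ z ∈ (gamma D)ᶜ, (A z).adjugate i j = R z := by
  have h := eq_zero_of_no_jump hD (g := fun z => (A z).adjugate i j - R z) ?_ ?_ ?_ hinf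
  · exact fun z hz => sub_eq_zero.1 (h z hz)
  · exact fun z hz => (differentiableWithinAt_adjugate
      (fun i j => (hA i).analytic j z hz) i j).sub (hR z).differentiableWithinAt
  · intro x hx
    obtain ⟨fp, fm, h1, h2, h3⟩ := hA.limits hx
    have hc : Continuous fun M : Mat D => M.adjugate := continuous_id.matrix_adjugate
    have hlim : ∀ {l : Filter ℂ} {M : Mat D}, l ≤ 𝓝 x → Tendsto A l (𝓝 M) →
        Tendsto (fun z => (A z).adjugate i j - R z) l (𝓝 (M.adjugate i j - R x)) :=
      fun hl hM => (tendsto_pi_nhds.1 (tendsto_pi_nhds.1 ((hc.tendsto _).comp hM) i) j).sub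
        (hR.continuous.continuousAt.tendsto.mono_left hl)
    refine ⟨fm.adjugate i j - R x, ?_, hlim nhdsWithin_le_nhds h2⟩
    -- The inverse jump matrix differs from the identity only in its first row, so multiplying by it
    -- from the left leaves the other rows unchanged.
    have := hlim nhdsWithin_le_nhds h1
    rwa [h3, Matrix.adjugate_mul_distrib, adjugate_jumpMatrix, Matrix.sub_mul, Matrix.one_mul,
      Matrix.sub_apply, Matrix.vecMulVec_mul, Matrix.vecMulVec_apply, Pi.single_eq_of_ne hi,
      zero_mul, sub_zero] at this
  · refine bounded_of_isBigO_one (IsBigO.sub (isBigO_one_adjugate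
      (fun i j => isBigO_one_of_bounded ((hA i).bounded j)) i j) ?_)
    exact ((hR.continuous.tendsto 0).mono_left nhdsWithin_le_nhds).isBigO_one ℂ

lemma sigma_mul_diagonal {D : ℕ} (d : Idx D → ℂ) :
    sigma D * Matrix.diagonal d = Matrix.diagonal d * sigma D := by
  rw [sigma, E1, E2, Matrix.sub_mul, Matrix.mul_sub]
  simp only [Matrix.diagonal_mul_diagonal, mul_comm]

lemma transpose_sigma (D : ℕ) : (sigma D).transpose = sigma D := by
  simp [sigma, E1, E2, Matrix.diagonal_transpose]

/-! ### Consequences of the expansion of the solution -/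

namespace SolFamily

variable {D : ℕ} {V₀ : ℝ[X]} {n : ℕ} (S : SolFamily D V₀ n)

lemma expands (t : ℝ) :
    Expands D 4 (fun z => S.A t z * normDiagInv D n z) fun r => S.c r t := fun i j => by
  refine (S.expand t i j).congr (fun z => ?_) fun z => rfl
  simp [normDiagInv, Matrix.sum_apply]

lemma expands_deriv (t : ℝ) :
    Expands D 4 (fun z => S.A' t z * normDiagInv D n z) fun r => S.c' r t := fun i j => by
  refine (S.expand' t i j).congr (fun z => ?_) fun z => rfl
  simp [normDiagInv, Matrix.sum_apply]

lemma isEvenSolution (hD : 2 ≤ D) (t : ℝ) : IsEvenSolution D (deform V₀ t) n (S.A t) := by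
  refine (isEvenSolution_iff hD).2 ⟨S.good t, ?_⟩
  refine MatO.congr' ((S.expands t).mono (by norm_num : 1 ≤ 4)) (Eventually.of_forall fun z => ?_)
  simp [S.c_zero]

lemma det_eq_one (hD : 2 ≤ D) (t : ℝ) {z : ℂ} (hz : z ∈ (gamma D)ᶜ) : (S.A t z).det = 1 :=
  det_eq_one_of_matO hD (S.good t) (S.isEvenSolution hD t).matO z hz

lemma mul_adjugate (hD : 2 ≤ D) (t : ℝ) {z : ℂ} (hz : z ∈ (gamma D)ᶜ) :
    S.A t z * (S.A t z).adjugate = 1 := by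
  rw [Matrix.mul_adjugate, S.det_eq_one hD t hz, one_smul]

lemma adjugate_mul (hD : 2 ≤ D) (t : ℝ) {z : ℂ} (hz : z ∈ (gamma D)ᶜ) :
    (S.A t z).adjugate * S.A t z = 1 := by
  rw [Matrix.adjugate_mul, S.det_eq_one hD t hz, one_smul]

/-- The coefficients of the expansion of the inverse matrix. -/
def inv (r : ℕ) (t : ℝ) : Mat D := invCoeff (fun r => S.c r t) r

lemma inv_zero (t : ℝ) : S.inv 0 t = 1 := rfl

lemma inv_one (t : ℝ) : S.inv 1 t = -S.c 1 t := rfl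

lemma inv_two (t : ℝ) : S.inv 2 t = S.c 1 t ^ 2 - S.c 2 t := rfl

lemma expands_inv (hD : 2 ≤ D) (t : ℝ) :
    Expands D 3 (fun z => normDiag D n z * (S.A t z).adjugate) fun r => S.inv r t := by
  refine Expands.congr' (Expands.adjugate (S.expands t) (S.c_zero t) ?_) ?_
  · filter_upwards [eventually_ne_zero D] with z hz
    rw [Matrix.det_mul, S.det_eq_one hD t hz.2, det_normDiagInv hD n hz.1, mul_one]
  · filter_upwards [eventually_ne_zero D] with z hz
    exact adjugate_mul_normDiagInv hD n hz.1 _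

lemma c'_zero (t : ℝ) : S.c' 0 t = 0 := by
  ext i j
  have h := S.hasDerivAt_c 0 t i j
  simp only [S.c_zero] at h
  exact h.unique (hasDerivAt_const _ _)

/-- The logarithmic derivative in `t`, conjugated by the exponential, is a polynomial. -/
lemma mul_adjugate_eq (hD : 2 ≤ D) (t : ℝ) : ∀ z ∈ (gamma D)ᶜ,
    S.B t z * (S.A t z).adjugate =
      -(z • sigma D) - (S.c 1 t * sigma D - sigma D * S.c 1 t) := by
  refine mul_adjugate_eq_of_tendsto hD (S.good t) (S.goodB t) (fun i j => ?_) fun i j => ?_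
  · simp only [Matrix.sub_apply, Matrix.neg_apply, Matrix.smul_apply, smul_eq_mul]
    fun_prop
  -- The identity is divided by `z`, so that only nonpositive powers occur, and the expansions are
  -- multiplied. Error `O(z⁻²)` there means error `O(z⁻¹)` for the original, as Liouville requires.
  · have h1 : Expands D 2 (fun z => z⁻¹ • (S.A' t z * normDiagInv D n z)) _ :=
      ((S.expands_deriv t).mono (by norm_num : 1 ≤ 4)).smul
    have h2 := ((S.expands t).mono (by norm_num : 2 ≤ 4)).mul (Expands.const (sigma D))
    have h3 := (h1.sub h2).mul ((S.expands_inv hD t).mono (by norm_num : 2 ≤ 3))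
    have h4 : MatO D (1 + 1) fun z => z⁻¹ ^ 1 • (S.B t z * (S.A t z).adjugate -
        (-(z • sigma D) - (S.c 1 t * sigma D - sigma D * S.c 1 t))) := by
      refine MatO.congr' h3 ?_
      filter_upwards [eventually_ne_zero D] with z hz
      have e1 : (z⁻¹ • (S.A' t z * normDiagInv D n z) -
          S.A t z * normDiagInv D n z * sigma D) * (normDiag D n z * (S.A t z).adjugate) =
          z⁻¹ • (S.B t z * (S.A t z).adjugate) := by
        have e2 : S.A t z * normDiagInv D n z * sigma D = S.A t z * sigma D * normDiagInv D n z := by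
          rw [Matrix.mul_assoc, Matrix.mul_assoc, normDiagInv, sigma_mul_diagonal]
        rw [e2, ← Matrix.smul_mul, ← Matrix.sub_mul, Matrix.mul_assoc,
          ← Matrix.mul_assoc (normDiagInv D n z), normDiagInv_mul D n hz.1, Matrix.one_mul,
          S.B_eq t z hz.2, ← Matrix.smul_mul, smul_sub, smul_smul, inv_mul_cancel₀ hz.1, one_smul]
      simp only [e1, pow_one, smul_sub, smul_neg, smul_smul, inv_mul_cancel₀ hz.1, one_smul]
      simp [Finset.sum_range_succ, S.c_zero, S.c'_zero, S.inv_zero, S.inv_one]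
      abel
    exact (MatO.of_smul h4).tendsto (k := 0) i j

lemma deriv_eq (hD : 2 ≤ D) (t : ℝ) {z : ℂ} (hz : z ∈ (gamma D)ᶜ) :
    S.A' t z = z • (S.A t z * sigma D) - z • (sigma D * S.A t z) -
      (S.c 1 t * sigma D - sigma D * S.c 1 t) * S.A t z := by
  have h1 := congrArg (· * S.A t z) (S.mul_adjugate_eq hD t z hz)
  simp only [Matrix.mul_assoc, S.adjugate_mul hD t hz, Matrix.mul_one] at h1
  rw [S.B_eq t z hz, sub_eq_iff_eq_add] at h1
  rw [h1, Matrix.sub_mul, Matrix.neg_mul, Matrix.smul_mul]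
  abel

/-- Coefficients of `z⁻ʳ` in the flow equation divided by `z`, compared by uniqueness of expansions.
The orders `0` and `1` are empty; `2` and `3` give the derivatives of `c 1` and `c 2`. -/
lemma expands_flow (hD : 2 ≤ D) (t : ℝ) : ∀ r < 4,
    (if r = 0 then 0 else S.c' (r - 1) t) = S.c r t * sigma D - sigma D * S.c r t -
      if r = 0 then 0 else (S.c 1 t * sigma D - sigma D * S.c 1 t) * S.c (r - 1) t := by
  intro r hr
  have h1 : Expands D 4 (fun z => z⁻¹ • (S.A' t z * normDiagInv D n z)) _ :=
    ((S.expands_deriv t).mono (by norm_num : 3 ≤ 4)).smul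
  set F := S.c 1 t * sigma D - sigma D * S.c 1 t with hF
  have h2 : Expands D 4 (fun z => z⁻¹ • (F * (S.A t z * normDiagInv D n z))) _ :=
    ((Expands.const F).mul ((S.expands t).mono (by norm_num : 3 ≤ 4))).smul
  have h3 := (((S.expands t).mul (Expands.const (sigma D))).sub
    ((Expands.const (sigma D)).mul (S.expands t))).sub h2
  have h4 := h3.congr' (G := fun z => z⁻¹ • (S.A' t z * normDiagInv D n z)) (by
    filter_upwards [eventually_ne_zero D] with z hz
    rw [S.deriv_eq hD t hz.2, ← hF]
    simp only [Matrix.sub_mul, smul_sub, Matrix.smul_mul, smul_smul, inv_mul_cancel₀ hz.1, one_smul,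
      Matrix.mul_assoc]
    rw [normDiagInv, sigma_mul_diagonal])
  have h5 := h1.unique hD h4 hr
  rw [h5]
  interval_cases r <;> simp [Finset.sum_range_succ]

lemma c'_one (hD : 2 ≤ D) (t : ℝ) : S.c' 1 t = S.c 2 t * sigma D - sigma D * S.c 2 t -
    (S.c 1 t * sigma D - sigma D * S.c 1 t) * S.c 1 t := by
  simpa using S.expands_flow hD t 2 (by norm_num)

lemma c'_two (hD : 2 ≤ D) (t : ℝ) : S.c' 2 t = S.c 3 t * sigma D - sigma D * S.c 3 t -
    (S.c 1 t * sigma D - sigma D * S.c 1 t) * S.c 2 t := by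
  simpa using S.expands_flow hD t 3 (by norm_num)

/-- The rows of the inverse with index at least `3` are linear in `z`. -/
lemma inv_two_inr (hD : 2 ≤ D) (t : ℝ) (i : Fin (D - 1)) (j : Idx D) :
    S.inv 2 t (.inr i) j = 0 := by
  have h := S.expands_inv hD t
  have hrow : ∀ z : ℂ, z ≠ 0 → (normDiag D n z * (S.A t z).adjugate) (.inr i) j =
      z⁻¹ * (S.A t z).adjugate (.inr i) j := by
    intro z hz
    rw [normDiag, Matrix.diagonal_mul]
    simp [expo]
  set δ : ℂ := (1 : Mat D) (.inr i) j with hδ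
  -- The candidate for the whole entry: the row has no jump and grows at most linearly, so by
  -- Liouville it equals its polynomial part, and nothing is left at order `z⁻²` after
  -- normalisation.
  set R : ℂ → ℂ := fun z => z * δ + S.inv 1 t (.inr i) j with hR
  have h1 : (fun z => z⁻¹ * ((S.A t z).adjugate (.inr i) j - R z)) =O[atInf D]
      fun z => z⁻¹ ^ 2 := by
    refine ((h.mono (by norm_num : 2 ≤ 3)) (.inr i) j).congr' ?_ EventuallyEq.rfl
    filter_upwards [eventually_ne_zero D] with z hz
    rw [Matrix.sub_apply, hrow z hz.1]
    have := inv_mul_cancel₀ hz.1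
    simp only [Finset.sum_range_succ, Finset.sum_range_zero, zero_add, pow_zero, one_smul, pow_one,
      Matrix.add_apply, Matrix.smul_apply, smul_eq_mul, S.inv_zero, hR, ← hδ]
    linear_combination δ * this
  have h2 : Tendsto (fun z => (S.A t z).adjugate (.inr i) j - R z) (atInf D) (𝓝 0) := by
    have h3 := (isBigO_refl (fun z : ℂ => z) (atInf D)).mul h1
    have h4 : Tendsto (fun z : ℂ => z * z⁻¹ ^ 2) (atInf D) (𝓝 0) := by
      refine (tendsto_inv_atInf D).congr' ?_
      filter_upwards [eventually_ne_zero D] with z hz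
      have := hz.1
      field_simp
    refine (h3.trans_tendsto h4).congr' ?_
    filter_upwards [eventually_ne_zero D] with z hz
    rw [← mul_assoc, mul_inv_cancel₀ hz.1, one_mul]
  have h3 := adjugate_row_eq_of_tendsto hD (S.good t) (by simp) (R := R)
    ((differentiable_id.mul_const _).add_const _) h2
  have h4 : (fun z : ℂ => z⁻¹ ^ 2 * S.inv 2 t (.inr i) j) =O[atInf D] fun z => z⁻¹ ^ 3 := by
    refine (h (.inr i) j).neg_left.congr' ?_ EventuallyEq.rfl
    filter_upwards [eventually_ne_zero D] with z hz
    rw [Matrix.sub_apply, hrow z hz.1, h3 z hz.2]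
    have := inv_mul_cancel₀ hz.1
    simp only [Finset.sum_range_succ, Finset.sum_range_zero, zero_add, pow_zero, one_smul, pow_one,
      Matrix.add_apply, Matrix.smul_apply, smul_eq_mul, S.inv_zero, hR, ← hδ]
    linear_combination -δ * this
  -- The scalar is spread over a constant matrix so that the matrix version of uniqueness applies.
  have h5 : MatO D (2 + 1) fun z => z⁻¹ ^ 2 • (Matrix.of fun _ _ => S.inv 2 t (.inr i) j : Mat D) :=
    fun k l => h4
  have h6 := congrFun (congrFun (h5.eq_zero hD) (.inl 0)) (.inl 0)
  exact h6

end SolFamily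

/-! ### Entrywise derivatives of matrices -/

/-- `F` is entrywise differentiable at `t` with derivative `F'`. -/
def MatDeriv {D : ℕ} (F : ℝ → Mat D) (F' : Mat D) (t : ℝ) : Prop :=
  ∀ i j, HasDerivAt (fun s => F s i j) (F' i j) t

namespace MatDeriv

variable {D : ℕ} {F G : ℝ → Mat D} {F' G' : Mat D} {t : ℝ}

lemma unique (hF : MatDeriv F F' t) (hG : MatDeriv F G' t) : F' = G' :=
  Matrix.ext fun i j => (hF i j).unique (hG i j)

lemma const (M : Mat D) (t : ℝ) : MatDeriv (fun _ => M) 0 t := fun i j =>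
  hasDerivAt_const t (M i j)

lemma add (hF : MatDeriv F F' t) (hG : MatDeriv G G' t) :
    MatDeriv (fun s => F s + G s) (F' + G') t := fun i j => (hF i j).add (hG i j)

lemma sub (hF : MatDeriv F F' t) (hG : MatDeriv G G' t) :
    MatDeriv (fun s => F s - G s) (F' - G') t := fun i j => (hF i j).sub (hG i j)

lemma neg (hF : MatDeriv F F' t) : MatDeriv (fun s => -F s) (-F') t := fun i j => (hF i j).neg

lemma smul (hF : MatDeriv F F' t) (z : ℂ) : MatDeriv (fun s => z • F s) (z • F') t :=
  fun i j => (hF i j).const_mul z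

lemma transpose (hF : MatDeriv F F' t) :
    MatDeriv (fun s => (F s).transpose) F'.transpose t := fun i j => hF j i

lemma mul (hF : MatDeriv F F' t) (hG : MatDeriv G G' t) :
    MatDeriv (fun s => F s * G s) (F' * G t + F t * G') t := fun i j => by
  simp only [Matrix.mul_apply, Matrix.add_apply, ← Finset.sum_add_distrib]
  exact HasDerivAt.fun_sum fun k _ => (hF i k).mul (hG k j)

lemma const_mul (hG : MatDeriv G G' t) (M : Mat D) : MatDeriv (fun s => M * G s) (M * G') t := by
  simpa using (MatDeriv.const M t).mul hG

lemma mul_const (hF : MatDeriv F F' t) (M : Mat D) : MatDeriv (fun s => F s * M) (F' * M) t := by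
  simpa using hF.mul (MatDeriv.const M t)

end MatDeriv

/-! ### The Lax pair -/

section Lax

variable {D : ℕ} {V₀ : ℝ[X]} (S : ∀ n, SolFamily D V₀ n)

/-- The coefficients `A_n^{(r)}` of the expansion of the inverse transpose. -/
def coeffA (r n : ℕ) (t : ℝ) : Mat D := ((S n).inv r t).transpose

lemma transpose_E1 (D : ℕ) : (E1 D).transpose = E1 D := by simp [E1]

lemma transpose_E2 (D : ℕ) : (E2 D).transpose = E2 D := by simp [E2]

/-- This form displays `ρᵀ` as the polynomial part of `A_n A_{n+1}⁻¹`. The combination `a₁² - a₂` in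
`rho2` is the transpose of the second coefficient `c 2` of `A_n`. -/
lemma transpose_rho (z : ℂ) (t : ℝ) (n : ℕ) :
    (rho (coeffA S 1) (coeffA S 2) z t n).transpose =
      z ^ 2 • E2 D + z • ((S n).c 1 t * E2 D + E2 D * (S (n + 1)).inv 1 t) +
        ((S n).c 2 t * E2 D + (S n).c 1 t * E2 D * (S (n + 1)).inv 1 t +
          E2 D * (S (n + 1)).inv 2 t + (1 - E1 D - E2 D)) := by
  simp only [rho, rho1, rho2, coeffA, Matrix.transpose_add, Matrix.transpose_sub,
    Matrix.transpose_smul, Matrix.transpose_mul, Matrix.transpose_transpose, transpose_E1,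
    transpose_E2, Matrix.transpose_one, Matrix.transpose_pow, (S n).inv_one, (S n).inv_two]
  noncomm_ring

/-- The quotient of consecutive normalisations is `diag(z⁻², z², 1, …, 1)`. Its only growing entry
explains the degree `2` and the leading coefficient `E_2` of `ρ`. -/
lemma normDiag_mul_normDiagInv_succ (D n : ℕ) {z : ℂ} (hz : z ≠ 0) :
    z⁻¹ ^ 2 • (normDiag D n z * normDiagInv D (n + 1) z) =
      E2 D + z⁻¹ ^ 2 • (1 - E1 D - E2 D) + z⁻¹ ^ 4 • E1 D := by
  rw [normDiag, normDiagInv, Matrix.diagonal_mul_diagonal, E1, E2, ← Matrix.diagonal_one]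
  simp only [← Matrix.diagonal_smul, Matrix.diagonal_add, Matrix.diagonal_sub]
  congr 1
  funext k
  simp only [Pi.smul_apply, smul_eq_mul]
  rw [← zpow_add₀ hz]
  rcases k with k | k
  · fin_cases k
    · have : expo D n (.inl 0) + -expo D (n + 1) (.inl 0) = -((2 : ℕ) : ℤ) := by
        simp [expo]; ring
      simp only [Fin.zero_eta, this, zpow_neg, zpow_natCast]
      simp
      ring
    · have : expo D n (.inl 1) + -expo D (n + 1) (.inl 1) = ((2 : ℕ) : ℤ) := by
        simp [expo]; ring
      simp only [Fin.mk_one, this, zpow_natCast]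
      simp [hz]
  · simp [expo]

/-- The shift in `n` for the solution. -/
lemma mul_adjugate_succ (hD : 2 ≤ D) (n : ℕ) (t : ℝ) : ∀ z ∈ (gamma D)ᶜ,
    (S n).A t z * ((S (n + 1)).A t z).adjugate =
      (rho (coeffA S 1) (coeffA S 2) z t n).transpose := by
  refine mul_adjugate_eq_of_tendsto hD ((S (n + 1)).good t) ((S n).good t) (fun i j => ?_)
    fun i j => ?_
  · simp only [transpose_rho, Matrix.add_apply, Matrix.smul_apply, smul_eq_mul]
    fun_prop
  -- Coefficients of `z⁻²` times the quotient of normalisations. The term `E1` has order `4`, beyond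
  -- the truncation at `3`, so it does not enter `ρ`.
  · set g : ℕ → Mat D := fun r =>
      if r = 0 then E2 D else if r = 2 then 1 - E1 D - E2 D else if r = 4 then E1 D else 0 with hg
    have h1 : Expands D 3 _ g := (Expands.sum_pow g 5).mono (by norm_num : 3 ≤ 5)
    have h2 := (((S n).expands t).mono (by norm_num : 3 ≤ 4)).mul
      (h1.mul ((S (n + 1)).expands_inv hD t))
    have h3 : MatO D (1 + 2) fun z => z⁻¹ ^ 2 • ((S n).A t z * ((S (n + 1)).A t z).adjugate -
        (rho (coeffA S 1) (coeffA S 2) z t n).transpose) := by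
      refine MatO.congr' h2 ?_
      filter_upwards [eventually_ne_zero D] with z hz
      have e0 : ∑ r ∈ Finset.range 5, z⁻¹ ^ r • g r =
          z⁻¹ ^ 2 • (normDiag D n z * normDiagInv D (n + 1) z) := by
        rw [normDiag_mul_normDiagInv_succ D n hz.1]
        simp [Finset.sum_range_succ, hg]
      have e1 : (S n).A t z * normDiagInv D n z * ((∑ r ∈ Finset.range 5, z⁻¹ ^ r • g r) *
          (normDiag D (n + 1) z * ((S (n + 1)).A t z).adjugate)) =
          z⁻¹ ^ 2 • ((S n).A t z * ((S (n + 1)).A t z).adjugate) := by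
        rw [e0, Matrix.smul_mul, Matrix.mul_smul]
        congr 1
        calc _ = (S n).A t z * ((normDiagInv D n z * normDiag D n z) *
              (normDiagInv D (n + 1) z * normDiag D (n + 1) z)) *
                ((S (n + 1)).A t z).adjugate := by simp only [Matrix.mul_assoc]
          _ = _ := by
            rw [normDiagInv_mul D n hz.1, normDiagInv_mul D (n + 1) hz.1, Matrix.mul_one,
              Matrix.mul_one]
      have e2 : z⁻¹ ^ 2 * z ^ 2 = 1 := by rw [← mul_pow, inv_mul_cancel₀ hz.1, one_pow]
      have e3 : z⁻¹ ^ 2 * z = z⁻¹ := by rw [pow_two, mul_assoc, inv_mul_cancel₀ hz.1, mul_one]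
      have e4 : ∀ X Y Z : Mat D, z⁻¹ ^ 2 • (z ^ 2 • X + z • Y + Z) =
          X + z⁻¹ • Y + z⁻¹ ^ 2 • Z := fun X Y Z => by
        rw [smul_add, smul_add, smul_smul, smul_smul, e2, e3, one_smul]
      rw [e1, transpose_rho, smul_sub, e4]
      congr 1
      simp [Finset.sum_range_succ, hg, (S n).c_zero, (S (n + 1)).inv_zero, Matrix.mul_assoc]
      abel
    exact (MatO.of_smul h3).tendsto (k := 0) i j

lemma hat_eq (hD : 2 ≤ D) (n : ℕ) (t : ℝ) {z : ℂ} (hz : z ∈ (gamma D)ᶜ) :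
    hat ((S n).A t) z = ((S n).A t z).adjugate.transpose :=
  hat_eq_of_det ((S n).det_eq_one hD t hz)

lemma hat_succ (hD : 2 ≤ D) (n : ℕ) (t : ℝ) {z : ℂ} (hz : z ∈ (gamma D)ᶜ) :
    hat ((S (n + 1)).A t) z = rho (coeffA S 1) (coeffA S 2) z t n * hat ((S n).A t) z := by
  rw [hat_eq S hD _ t hz, hat_eq S hD _ t hz, ← Matrix.transpose_transpose (rho _ _ _ _ _),
    ← Matrix.transpose_mul, ← mul_adjugate_succ S hD n t z hz, ← Matrix.mul_assoc,
    (S n).adjugate_mul hD t hz, Matrix.one_mul]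

lemma hasExpansion_hat (hD : 2 ≤ D) (n : ℕ) (t : ℝ) :
    HasExpansion D n (hat ((S n).A t)) (coeffA S 1 n t) (coeffA S 2 n t) := by
  intro i j
  refine ((S n).expands_inv hD t j i).congr' ?_ (Eventually.of_forall fun z => inv_pow z 3)
  filter_upwards [eventually_ne_zero D] with z hz
  have h : hat ((S n).A t) z * Matrix.diagonal (fun k => z ^ expo D n k) -
      (1 + z⁻¹ • coeffA S 1 n t + (z ^ 2)⁻¹ • coeffA S 2 n t) =
      (normDiag D n z * ((S n).A t z).adjugate -
        ∑ r ∈ Finset.range 3, z⁻¹ ^ r • (S n).inv r t).transpose := by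
    rw [hat_eq S hD n t hz.2, Matrix.transpose_sub, Matrix.transpose_mul, normDiag,
      Matrix.diagonal_transpose]
    simp [Finset.sum_range_succ, coeffA, (S n).inv_zero]
  rw [h, Matrix.transpose_apply]

lemma lam_eq (z : ℂ) (t : ℝ) (n : ℕ) : lam (coeffA S 1) z t n =
    z • sigma D + ((S n).c 1 t * sigma D - sigma D * (S n).c 1 t).transpose := by
  simp only [lam, coeffA, (S n).inv_one, Matrix.transpose_sub, Matrix.transpose_mul,
    transpose_sigma, Matrix.transpose_neg]
  noncomm_ring

/-- From `(A⁻¹)' = -A⁻¹ A' A⁻¹` and the flow of `A`. The unwanted term with `σ` on the right is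
cancelled by the derivative of `e^{Vσ}` in `matDeriv_breve`. -/
lemma matDeriv_hat (hD : 2 ≤ D) (n : ℕ) (t : ℝ) {z : ℂ} (hz : z ∈ (gamma D)ᶜ) :
    MatDeriv (fun s => hat ((S n).A s) z) (lam (coeffA S 1) z t n * hat ((S n).A t) z -
      z • (hat ((S n).A t) z * sigma D)) t := by
  set Y : ℝ → Mat D := fun s => ((S n).A s z).adjugate with hY
  have hA : MatDeriv (fun s => (S n).A s z) ((S n).A' t z) t := (S n).hasDerivAt t z hz
  have hYd : MatDeriv Y (Matrix.of fun i j => deriv (fun s => Y s i j) t) t := by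
    intro i j
    refine DifferentiableAt.hasDerivAt ?_
    rw [← differentiableWithinAt_univ]
    exact differentiableWithinAt_adjugate
      (fun i j => (hA i j).differentiableAt.differentiableWithinAt) i j
  set Y' : Mat D := Matrix.of fun i j => deriv (fun s => Y s i j) t
  have h1 : (S n).A' t z * Y t + (S n).A t z * Y' = 0 := by
    refine (hA.mul hYd).unique ?_
    have : (fun s => (S n).A s z * Y s) = fun _ => 1 := funext fun s => (S n).mul_adjugate hD s hz
    rw [this]
    exact MatDeriv.const 1 t
  have hYA : Y t * (S n).A t z = 1 := (S n).adjugate_mul hD t hz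
  have hAY : (S n).A t z * Y t = 1 := (S n).mul_adjugate hD t hz
  have h2 : Y' = -(Y t * ((S n).A' t z * Y t)) := by
    have := congrArg (Y t * ·) h1
    simp only [Matrix.mul_add, ← Matrix.mul_assoc, hYA, Matrix.one_mul, Matrix.mul_zero] at this
    rw [eq_neg_iff_add_eq_zero, add_comm, ← Matrix.mul_assoc]
    exact this
  have h3 : (S n).A' t z * Y t = z • ((S n).A t z * sigma D * Y t) - z • sigma D -
      ((S n).c 1 t * sigma D - sigma D * (S n).c 1 t) := by
    rw [(S n).deriv_eq hD t hz, Matrix.sub_mul, Matrix.sub_mul, Matrix.smul_mul, Matrix.smul_mul]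
    simp only [Matrix.mul_assoc, hAY, Matrix.mul_one]
  have h4 : Y' = z • (Y t * sigma D) - z • (sigma D * Y t) +
      Y t * ((S n).c 1 t * sigma D - sigma D * (S n).c 1 t) := by
    rw [h2, h3, Matrix.mul_sub, Matrix.mul_sub, Matrix.mul_smul, Matrix.mul_smul,
      Matrix.mul_assoc (_ : Mat D) (sigma D), ← Matrix.mul_assoc (Y t) ((S n).A t z), hYA,
      Matrix.one_mul]
    abel
  have h5 := hYd.transpose
  have h6 : (fun s => (Y s).transpose) = fun s => hat ((S n).A s) z :=
    funext fun s => (hat_eq S hD n s hz).symm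
  rw [h6] at h5
  convert h5 using 1
  rw [h4, hat_eq S hD n t hz, lam_eq]
  simp only [Matrix.transpose_add, Matrix.transpose_sub, Matrix.transpose_smul,
    Matrix.transpose_mul, transpose_sigma, Matrix.add_mul, Matrix.smul_mul, hY]
  abel

lemma matDeriv_expDiag (D : ℕ) (V₀ : ℝ[X]) (z : ℂ) (t : ℝ) :
    MatDeriv (fun s => expDiag D (deform V₀ s) z) (z • (sigma D * expDiag D (deform V₀ t) z)) t := by
  have hv : HasDerivAt (fun s : ℝ => aeval z (deform V₀ s)) z t := by
    have : (fun s : ℝ => aeval z (deform V₀ s)) = fun s : ℝ => aeval z V₀ + (s : ℂ) * z := by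
      funext s; simp [deform]
    rw [this]
    simpa using ((ofRealCLM.hasDerivAt (x := t)).mul_const z).const_add (aeval z V₀)
  intro i j
  rw [expDiag, sigma_mul_diagonal, Matrix.smul_apply, mul_sigma_apply]
  simp only [expDiag, Matrix.diagonal_apply]
  by_cases hij : i = j
  · subst hij
    simp only [if_true]
    rcases i with i | i
    · fin_cases i
      · exact hv.cexp.congr_deriv (by simp; ring)
      · exact hv.neg.cexp.congr_deriv (by simp; ring)
    · exact (hasDerivAt_const t _).congr_deriv (by simp)
  · simp only [hij, if_false]
    exact (hasDerivAt_const t _).congr_deriv (by simp)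

lemma matDeriv_breve (hD : 2 ≤ D) (n : ℕ) (t : ℝ) {z : ℂ} (hz : z ∈ (gamma D)ᶜ) :
    MatDeriv (fun s => breve (deform V₀ s) ((S n).A s) z)
      (lam (coeffA S 1) z t n * breve (deform V₀ t) ((S n).A t) z) t := by
  have h := (matDeriv_hat S hD n t hz).mul (matDeriv_expDiag D V₀ z t)
  rw [Matrix.sub_mul, Matrix.smul_mul, Matrix.mul_smul, Matrix.mul_assoc, Matrix.mul_assoc,
    sub_add_cancel] at h
  exact h

end Lax

/-! ### Flow of the coefficients, compatibility, and relations between entries -/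

section Lax

variable {D : ℕ} {V₀ : ℝ[X]} (S : ∀ n, SolFamily D V₀ n)

lemma matDeriv_coeffA_one (hD : 2 ≤ D) (n : ℕ) (t : ℝ) :
    MatDeriv (coeffA S 1 n) (sigma D * coeffA S 2 n t - coeffA S 2 n t * sigma D +
      (coeffA S 1 n t * sigma D - sigma D * coeffA S 1 n t) * coeffA S 1 n t) t := by
  have h : MatDeriv ((S n).c 1) ((S n).c' 1 t) t := (S n).hasDerivAt_c 1 t
  have e : sigma D * coeffA S 2 n t - coeffA S 2 n t * sigma D +
      (coeffA S 1 n t * sigma D - sigma D * coeffA S 1 n t) * coeffA S 1 n t =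
      (-(S n).c' 1 t).transpose := by
    apply Matrix.transpose_injective
    simp only [coeffA, Matrix.transpose_add, Matrix.transpose_sub, Matrix.transpose_mul,
      Matrix.transpose_transpose, transpose_sigma, (S n).c'_one hD, (S n).inv_one, (S n).inv_two]
    noncomm_ring
  rw [e]
  exact h.neg.transpose

/-- The witness is the formal third coefficient of the inverse transpose. Its value is never needed:
the diagonal entries of a commutator with `σ` vanish, and elsewhere only differentiability is used.
-/
lemma matDeriv_coeffA_two (hD : 2 ≤ D) (n : ℕ) (t : ℝ) : ∃ a₃ : Mat D,
    MatDeriv (coeffA S 2 n) (sigma D * a₃ - a₃ * sigma D +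
      (coeffA S 1 n t * sigma D - sigma D * coeffA S 1 n t) * coeffA S 2 n t) t := by
  have h1 : MatDeriv ((S n).c 1) ((S n).c' 1 t) t := (S n).hasDerivAt_c 1 t
  have h2 : MatDeriv ((S n).c 2) ((S n).c' 2 t) t := (S n).hasDerivAt_c 2 t
  refine ⟨(-(S n).c 3 t + (S n).c 1 t * (S n).c 2 t + (S n).c 2 t * (S n).c 1 t -
    (S n).c 1 t ^ 3).transpose, ?_⟩
  have e : sigma D * (-(S n).c 3 t + (S n).c 1 t * (S n).c 2 t + (S n).c 2 t * (S n).c 1 t -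
      (S n).c 1 t ^ 3).transpose - (-(S n).c 3 t + (S n).c 1 t * (S n).c 2 t +
      (S n).c 2 t * (S n).c 1 t - (S n).c 1 t ^ 3).transpose * sigma D +
      (coeffA S 1 n t * sigma D - sigma D * coeffA S 1 n t) * coeffA S 2 n t =
      ((S n).c' 1 t * (S n).c 1 t + (S n).c 1 t * (S n).c' 1 t - (S n).c' 2 t).transpose := by
    apply Matrix.transpose_injective
    simp only [coeffA, Matrix.transpose_add, Matrix.transpose_sub, Matrix.transpose_mul,
      Matrix.transpose_transpose, transpose_sigma, (S n).c'_one hD, (S n).c'_two hD,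
      (S n).inv_one, (S n).inv_two]
    noncomm_ring
  rw [e]
  have h3 := ((h1.mul h1).sub h2).transpose
  have e2 : coeffA S 2 n = fun s => ((S n).c 1 s * (S n).c 1 s - (S n).c 2 s).transpose := by
    funext s; rw [coeffA, (S n).inv_two, pow_two]
  rw [e2]
  exact h3

lemma det_breve (hD : 2 ≤ D) (n : ℕ) (t : ℝ) {z : ℂ} (hz : z ∈ (gamma D)ᶜ) :
    (breve (deform V₀ t) ((S n).A t) z).det = 1 := by
  rw [breve, Matrix.det_mul, hat, Matrix.det_transpose, Matrix.det_nonsing_inv,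
    (S n).det_eq_one hD t hz, Ring.inverse_one, one_mul, Matrix.det_diagonal]
  simp [Fintype.prod_sum_type, ← exp_add]

lemma breve_succ (hD : 2 ≤ D) (n : ℕ) (t : ℝ) {z : ℂ} (hz : z ∈ (gamma D)ᶜ) :
    breve (deform V₀ t) ((S (n + 1)).A t) z =
      rho (coeffA S 1) (coeffA S 2) z t n * breve (deform V₀ t) ((S n).A t) z := by
  rw [breve, hat_succ S hD n t hz, Matrix.mul_assoc, breve]

lemma continuous_rho_apply (a₁ a₂ : ℕ → ℝ → Mat D) (t : ℝ) (n : ℕ) (i j : Idx D) :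
    Continuous fun z => rho a₁ a₂ z t n i j := by
  simp only [rho, Matrix.add_apply, Matrix.smul_apply, smul_eq_mul]
  fun_prop

lemma continuous_lam_apply (a₁ : ℕ → ℝ → Mat D) (t : ℝ) (n : ℕ) (i j : Idx D) :
    Continuous fun z => lam a₁ z t n i j := by
  simp only [lam, Matrix.add_apply, Matrix.smul_apply, smul_eq_mul]
  fun_prop

/-- The compatibility condition of the Lax pair. -/
lemma matDeriv_rho (hD : 2 ≤ D) (n : ℕ) (t : ℝ) (z : ℂ) :
    MatDeriv (fun s => rho (coeffA S 1) (coeffA S 2) z s n)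
      (lam (coeffA S 1) z t (n + 1) * rho (coeffA S 1) (coeffA S 2) z t n -
        rho (coeffA S 1) (coeffA S 2) z t n * lam (coeffA S 1) z t n) t := by
  -- First only the existence of a derivative that is affine in `z`; the leading coefficient `E_2`
  -- is constant in `t`.
  obtain ⟨r1, r2, hr⟩ : ∃ r1 r2 : Mat D, ∀ z : ℂ,
      MatDeriv (fun s => rho (coeffA S 1) (coeffA S 2) z s n) (z • r1 + r2) t := by
    have d1 := matDeriv_coeffA_one S hD n t
    have d1' := matDeriv_coeffA_one S hD (n + 1) t
    obtain ⟨_, d2⟩ := matDeriv_coeffA_two S hD n t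
    obtain ⟨_, d2'⟩ := matDeriv_coeffA_two S hD (n + 1) t
    obtain ⟨r1, h1⟩ : ∃ r1, MatDeriv (rho1 (coeffA S 1) n) r1 t :=
      ⟨_, (d1'.mul_const (E2 D)).sub (d1.const_mul (E2 D))⟩
    obtain ⟨r2, h2⟩ : ∃ r2, MatDeriv (rho2 (coeffA S 1) (coeffA S 2) n) r2 t := by
      have h2 := (((MatDeriv.const (1 - E1 D - E2 D) t).add (d2'.mul_const (E2 D))).add
        (((d1.mul d1).sub d2).const_mul (E2 D))).sub ((d1'.mul_const (E2 D)).mul d1)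
      simp only [← pow_two] at h2
      exact ⟨_, h2⟩
    refine ⟨r1, r2, fun z => ?_⟩
    have h3 := ((MatDeriv.const (z ^ 2 • E2 D) t).add (h1.smul z)).add h2
    rw [zero_add] at h3
    exact h3
  -- Cross-differentiation: the shift equation is differentiated in `t` in two ways, and the common
  -- factor, of determinant `1`, is cancelled.
  have hoff : ∀ z ∈ (gamma D)ᶜ, z • r1 + r2 =
      lam (coeffA S 1) z t (n + 1) * rho (coeffA S 1) (coeffA S 2) z t n -
        rho (coeffA S 1) (coeffA S 2) z t n * lam (coeffA S 1) z t n := by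
    intro z hz
    have h1 := matDeriv_breve S hD (n + 1) t hz
    have h2 := (hr z).mul (matDeriv_breve S hD n t hz)
    have h3 : (fun s => breve (deform V₀ s) ((S (n + 1)).A s) z) = fun s =>
        rho (coeffA S 1) (coeffA S 2) z s n * breve (deform V₀ s) ((S n).A s) z :=
      funext fun s => breve_succ S hD n s hz
    rw [h3] at h1
    have h4 := h2.unique h1
    rw [breve_succ S hD n t hz, ← Matrix.mul_assoc, ← Matrix.mul_assoc, ← Matrix.add_mul] at h4
    have hu : IsUnit (breve (deform V₀ t) ((S n).A t) z) := by
      rw [Matrix.isUnit_iff_isUnit_det, det_breve S hD n t hz]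
      exact isUnit_one
    rw [← hu.mul_left_injective h4]
    abel
  -- Both sides are continuous in `z` and the complement of `Γ` is dense.
  have hall : z • r1 + r2 =
      lam (coeffA S 1) z t (n + 1) * rho (coeffA S 1) (coeffA S 2) z t n -
        rho (coeffA S 1) (coeffA S 2) z t n * lam (coeffA S 1) z t n := by
    ext i j
    refine congrFun (Continuous.ext_on (dense_compl_gamma hD)
      (f := fun z => (z • r1 + r2) i j)
      (g := fun z => (lam (coeffA S 1) z t (n + 1) * rho (coeffA S 1) (coeffA S 2) z t n -
        rho (coeffA S 1) (coeffA S 2) z t n * lam (coeffA S 1) z t n) i j) ?_ ?_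
      fun z hz => congrFun (congrFun (hoff z hz) i) j) z
    · simp only [Matrix.add_apply, Matrix.smul_apply, smul_eq_mul]
      fun_prop
    · simp only [Matrix.sub_apply, Matrix.mul_apply]
      exact (continuous_finsetSum _ fun k _ => (continuous_lam_apply _ _ _ _ _).mul
        (continuous_rho_apply _ _ _ _ _ _)).sub (continuous_finsetSum _ fun k _ =>
          (continuous_rho_apply _ _ _ _ _ _).mul (continuous_lam_apply _ _ _ _ _))
  rw [← hall]
  exact hr z

theorem isLaxPair_coeffA (hD : 2 ≤ D) : IsLaxPair (coeffA S 1) (coeffA S 2)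
    fun n t z => breve (deform V₀ t) ((S n).A t) z :=
  ⟨fun n t _ hz => breve_succ S hD n t hz, fun n t _ hz => matDeriv_breve S hD n t hz,
    fun n t z => matDeriv_rho S hD n t z⟩

lemma coeffA_one_12 (n : ℕ) (t : ℝ) : coeffA S 1 n t (.inl 0) (.inl 1) = 0 := by
  rw [coeffA, Matrix.transpose_apply, (S n).inv_one, Matrix.neg_apply, (S n).c_one_21, neg_zero]

lemma coeffA_one_21 (n : ℕ) (t : ℝ) : coeffA S 1 n t (.inl 1) (.inl 0) = 0 := by
  rw [coeffA, Matrix.transpose_apply, (S n).inv_one, Matrix.neg_apply, (S n).c_one_12, neg_zero]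

lemma coeffA_two_inr (hD : 2 ≤ D) (n : ℕ) (t : ℝ) (k : Idx D) (i : Fin (D - 1)) :
    coeffA S 2 n t k (.inr i) = 0 := (S n).inv_two_inr hD t i k

lemma coeffA_one_zero (t : ℝ) (k : Idx D) : coeffA S 1 0 t k (.inl 1) = 0 := by
  rw [coeffA, Matrix.transpose_apply, (S 0).inv_one, Matrix.neg_apply,
    (S 0).c_of_zero rfl 1 t k one_pos, neg_zero]

lemma coeffA_two_zero (t : ℝ) (k : Idx D) : coeffA S 2 0 t k (.inl 1) = 0 := by
  rw [coeffA, Matrix.transpose_apply, (S 0).inv_two, Matrix.sub_apply,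
    (S 0).c_of_zero rfl 2 t k two_pos, sub_zero, pow_two, Matrix.mul_apply]
  exact Finset.sum_eq_zero fun l _ => by rw [(S 0).c_of_zero rfl 1 t l one_pos, zero_mul]

/-- Thus the first row of the dual solution at `n + 1` is a scalar multiple of the second row at
`n`. -/
lemma rho_one_apply {a₁ a₂ : ℕ → ℝ → Mat D} {n : ℕ} {t : ℝ}
    (h : a₁ (n + 1) t (.inl 0) (.inl 1) = 0) (z : ℂ) (k : Idx D) :
    rho a₁ a₂ z t n (.inl 0) k =
      if k = .inl 1 then a₂ (n + 1) t (.inl 0) (.inl 1) else 0 := by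
  have h1 : (a₁ (n + 1) t * E2 D * a₁ n t) (.inl 0) k = 0 := by
    rw [Matrix.mul_apply]
    refine Finset.sum_eq_zero fun l _ => ?_
    rw [E2, Matrix.mul_diagonal]
    by_cases hl : l = .inl 1
    · rw [hl, h, zero_mul, zero_mul]
    · rw [Pi.single_eq_of_ne hl, mul_zero, zero_mul]
  rw [rho, rho1, rho2, Matrix.add_apply, Matrix.add_apply, Matrix.sub_apply (_ + _), h1]
  simp only [Matrix.add_apply, Matrix.sub_apply, Matrix.smul_apply, E1, E2, Matrix.mul_diagonal,
    Matrix.diagonal_mul]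
  rcases k with k | k
  · fin_cases k
    · simp [Matrix.one_apply]
    · simp [h]
  · simp

/-- The relation between consecutive normalisation constants. -/
lemma coeffA_two_mul (hD : 2 ≤ D) (n : ℕ) (t : ℝ) :
    coeffA S 2 (n + 1) t (.inl 0) (.inl 1) * coeffA S 2 n t (.inl 1) (.inl 0) = 1 := by
  have hne := neBot_atInf hD
  set h := coeffA S 2 (n + 1) t (.inl 0) (.inl 1) with hh
  set e : ℕ → ℂ → ℂ := fun m z => z ^ expo D m (.inl 0) with he
  -- The shift equation in the entry `(1,1)`. Multiplied by `z` to the power `2(n+1) + D - 1`, the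
  -- left side tends to `1` and the right side to the product in question.
  have h1 : ∀ z ∈ (gamma D)ᶜ, ((S (n + 1)).A t z).adjugate (.inl 0) (.inl 0) =
      h * ((S n).A t z).adjugate (.inl 0) (.inl 1) := by
    intro z hz
    have h2 := congrFun (congrFun (hat_succ S hD n t hz) (.inl 0)) (.inl 0)
    rw [hat_eq S hD _ t hz, hat_eq S hD _ t hz, Matrix.transpose_apply, Matrix.mul_apply,
      Finset.sum_eq_single (.inl 1)] at h2
    · rw [h2, rho_one_apply (coeffA_one_12 S (n + 1) t), if_pos rfl, Matrix.transpose_apply]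
    · intro k _ hk
      rw [rho_one_apply (coeffA_one_12 S (n + 1) t), if_neg hk, zero_mul]
    · simp
  have t1 : Tendsto (fun z => e (n + 1) z * ((S (n + 1)).A t z).adjugate (.inl 0) (.inl 0))
      (atInf D) (𝓝 1) := by
    have h2 := (((S (n + 1)).expands_inv hD t).mono (by norm_num : 0 + 1 ≤ 3))
    have h3 := (MatO.tendsto h2 (.inl 0) (.inl 0)).add_const 1
    simpa [Finset.sum_range_succ, (S (n + 1)).inv_zero, normDiag, Matrix.diagonal_mul] using h3
  -- The normalised entry is off-diagonal and its coefficient of order `1` is zero by skew-symmetry,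
  -- so its leading term has order `z⁻²`.
  have t2 : Tendsto (fun z => z ^ 2 * (e n z * ((S n).A t z).adjugate (.inl 0) (.inl 1)))
      (atInf D) (𝓝 (coeffA S 2 n t (.inl 1) (.inl 0))) := by
    have h2 := (S n).expands_inv hD t (.inl 0) (.inl 1)
    have h3 := (isBigO_refl (fun z : ℂ => z ^ 2) (atInf D)).mul h2
    have h4 : Tendsto (fun z : ℂ => z ^ 2 * z⁻¹ ^ 3) (atInf D) (𝓝 0) := by
      refine (tendsto_inv_atInf D).congr' ?_
      filter_upwards [eventually_ne_zero D] with z hz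
      have := hz.1
      field_simp
    have h5 := (h3.trans_tendsto h4).add_const (coeffA S 2 n t (.inl 1) (.inl 0))
    rw [zero_add] at h5
    refine h5.congr' ?_
    filter_upwards [eventually_ne_zero D] with z hz
    have h6 : (S n).inv 1 t (.inl 0) (.inl 1) = 0 := by
      rw [(S n).inv_one, Matrix.neg_apply, (S n).c_one_12, neg_zero]
    have h7 : z ^ 2 * z⁻¹ ^ 2 = 1 := by rw [← mul_pow, mul_inv_cancel₀ hz.1, one_pow]
    simp only [Matrix.sub_apply, normDiag, Matrix.diagonal_mul, Finset.sum_range_succ,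
      Finset.sum_range_zero, zero_add, Matrix.add_apply, Matrix.smul_apply, (S n).inv_zero, h6,
      smul_eq_mul, mul_zero, add_zero, coeffA, Matrix.transpose_apply, he]
    rw [Matrix.one_apply_ne (by simp)]
    linear_combination (-(S n).inv 2 t (.inl 0) (.inl 1)) * h7
  refine tendsto_nhds_unique ((t2.const_mul h).congr' ?_) t1
  filter_upwards [eventually_ne_zero D] with z hz
  have h2 : e (n + 1) z = z ^ 2 * e n z := by
    simp only [he]
    rw [← zpow_natCast, ← zpow_add₀ hz.1]
    congr 1
    simp [expo]
    ring
  rw [h1 z hz.2, h2]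
  ring

end Lax

/-! ### The dynamical system -/

/-- The properties of the expansion coefficients from which the dynamical system follows. -/
structure TodaData {D : ℕ} (a₁ a₂ : ℕ → ℝ → Mat D) : Prop where
  deriv_one : ∀ n t, MatDeriv (a₁ n) (sigma D * a₂ n t - a₂ n t * sigma D +
    (a₁ n t * sigma D - sigma D * a₁ n t) * a₁ n t) t
  deriv_two : ∀ n t, ∃ a₃ : Mat D, MatDeriv (a₂ n) (sigma D * a₃ - a₃ * sigma D +
    (a₁ n t * sigma D - sigma D * a₁ n t) * a₂ n t) t
  compat : ∀ n t z, MatDeriv (fun s => rho a₁ a₂ z s n)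
    (lam a₁ z t (n + 1) * rho a₁ a₂ z t n - rho a₁ a₂ z t n * lam a₁ z t n) t
  one_12 : ∀ n t, a₁ n t (.inl 0) (.inl 1) = 0
  one_21 : ∀ n t, a₁ n t (.inl 1) (.inl 0) = 0
  two_inr : ∀ n t k i, a₂ n t k (.inr i) = 0
  two_mul : ∀ n t, a₂ (n + 1) t (.inl 0) (.inl 1) * a₂ n t (.inl 1) (.inl 0) = 1
  one_zero : ∀ t k, a₁ 0 t k (.inl 1) = 0
  two_zero : ∀ t k, a₂ 0 t k (.inl 1) = 0

lemma sigma_mul_apply {D : ℕ} (M : Mat D) (i j : Idx D) :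
    (sigma D * M) i j = Sum.elim ![1, -1] (fun _ => 0) i * M i j := by
  have h := mul_sigma_apply M.transpose j i
  have e : M.transpose * sigma D = (sigma D * M).transpose := by
    rw [Matrix.transpose_mul, transpose_sigma]
  rw [e, Matrix.transpose_apply, Matrix.transpose_apply] at h
  rw [h, mul_comm]

lemma commutator_sigma_apply {D : ℕ} (M : Mat D) (i j : Idx D) :
    (M * sigma D - sigma D * M) i j =
      M i j * (Sum.elim ![1, -1] (fun _ => 0) j - Sum.elim ![1, -1] (fun _ => 0) i) := by
  rw [Matrix.sub_apply, mul_sigma_apply, sigma_mul_apply]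
  ring

lemma mul_E2_mul_apply {D : ℕ} (M N : Mat D) (i j : Idx D) :
    (M * E2 D * N) i j = M i (.inl 1) * N (.inl 1) j := by
  rw [Matrix.mul_apply, Finset.sum_eq_single (.inl 1)]
  · simp [E2]
  · intro k _ hk
    rw [E2, Matrix.mul_diagonal, Pi.single_eq_of_ne hk, mul_zero, zero_mul]
  · simp

lemma rho1_apply {D : ℕ} (a₁ : ℕ → ℝ → Mat D) (n : ℕ) (t : ℝ) (i j : Idx D) :
    rho1 a₁ n t i j = a₁ (n + 1) t i j * (if j = .inl 1 then 1 else 0) -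
      (if i = .inl 1 then 1 else 0) * a₁ n t i j := by
  simp [rho1, E2, Pi.single_apply]

lemma rho2_apply {D : ℕ} (a₁ a₂ : ℕ → ℝ → Mat D) (n : ℕ) (t : ℝ) (i j : Idx D) :
    rho2 a₁ a₂ n t i j =
      (if i = j then 1 - (if i = .inl 0 then 1 else 0) - (if i = .inl 1 then 1 else 0) else 0) +
        a₂ (n + 1) t i j * (if j = .inl 1 then 1 else 0) +
        (if i = .inl 1 then 1 else 0) * ((a₁ n t * a₁ n t) i j - a₂ n t i j) -
        a₁ (n + 1) t i (.inl 1) * a₁ n t (.inl 1) j := by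
  rw [rho2, Matrix.sub_apply, mul_E2_mul_apply, pow_two]
  simp only [E1, E2, Matrix.add_apply, Matrix.sub_apply, Matrix.mul_diagonal, Matrix.diagonal_mul,
    Matrix.diagonal_apply, Matrix.one_apply, Pi.single_apply]
  split_ifs <;> simp

/-! ### Entries of the compatibility condition and of the flow -/

namespace TodaData

variable {D : ℕ} {a₁ a₂ : ℕ → ℝ → Mat D}

lemma compat_zero (h : TodaData a₁ a₂) (n : ℕ) (t : ℝ) : MatDeriv (rho2 a₁ a₂ n)
    ((a₁ (n + 1) t * sigma D - sigma D * a₁ (n + 1) t) * rho2 a₁ a₂ n t -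
      rho2 a₁ a₂ n t * (a₁ n t * sigma D - sigma D * a₁ n t)) t := by
  have h0 := h.compat n t 0
  simpa [rho, lam] using h0

/-- Half the difference of the compatibility condition at `z = 1` and `z = -1` is its odd part. The
cubic term is absent because `σ` and `E_2` commute, so the coefficient of `z` remains. -/
lemma compat_one (h : TodaData a₁ a₂) (n : ℕ) (t : ℝ) : MatDeriv (rho1 a₁ n)
    (sigma D * rho2 a₁ a₂ n t - rho2 a₁ a₂ n t * sigma D +
      (a₁ (n + 1) t * sigma D - sigma D * a₁ (n + 1) t) * rho1 a₁ n t -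
      rho1 a₁ n t * (a₁ n t * sigma D - sigma D * a₁ n t)) t := by
  have h0 := ((h.compat n t 1).sub (h.compat n t (-1))).smul (1 / 2)
  have e1 : (fun s => (1 / 2 : ℂ) • (rho a₁ a₂ 1 s n - rho a₁ a₂ (-1) s n)) = rho1 a₁ n := by
    funext s
    ext i j
    simp [rho]
    ring
  have e2 : sigma D * E2 D = E2 D * sigma D := by rw [E2, sigma_mul_diagonal]
  rw [e1] at h0
  convert h0 using 1
  ext i j
  simp only [lam, rho, one_smul, neg_smul, one_pow, neg_one_sq, Matrix.add_mul, Matrix.mul_add,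
    Matrix.neg_mul, Matrix.mul_neg, e2, Matrix.add_apply, Matrix.sub_apply, Matrix.neg_apply,
    Matrix.smul_apply, smul_eq_mul]
  ring

lemma rho2_11 (h : TodaData a₁ a₂) (n : ℕ) (t : ℝ) : rho2 a₁ a₂ n t (.inl 0) (.inl 0) = 0 := by
  simp [rho2_apply, h.one_12]

lemma rho2_12 (h : TodaData a₁ a₂) (n : ℕ) (t : ℝ) :
    rho2 a₁ a₂ n t (.inl 0) (.inl 1) = a₂ (n + 1) t (.inl 0) (.inl 1) := by
  simp [rho2_apply, h.one_12]

lemma rho2_1i (h : TodaData a₁ a₂) (n : ℕ) (t : ℝ) (i : Fin (D - 1)) : rho2 a₁ a₂ n t (.inl 0) (.inr i) = 0 := by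
  simp [rho2_apply, h.one_12]

lemma rho2_21 (h : TodaData a₁ a₂) (n : ℕ) (t : ℝ) : rho2 a₁ a₂ n t (.inl 1) (.inl 0) =
    ∑ k, a₁ n t (.inl 1) (.inr k) * a₁ n t (.inr k) (.inl 0) - a₂ n t (.inl 1) (.inl 0) := by
  simp [rho2_apply, h.one_21, Matrix.mul_apply]

lemma rho2_22 (h : TodaData a₁ a₂) (n : ℕ) (t : ℝ) : rho2 a₁ a₂ n t (.inl 1) (.inl 1) =
    a₂ (n + 1) t (.inl 1) (.inl 1) + a₁ n t (.inl 1) (.inl 1) ^ 2 +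
      ∑ k, a₁ n t (.inl 1) (.inr k) * a₁ n t (.inr k) (.inl 1) - a₂ n t (.inl 1) (.inl 1) -
      a₁ (n + 1) t (.inl 1) (.inl 1) * a₁ n t (.inl 1) (.inl 1) := by
  simp [rho2_apply, h.one_21, Matrix.mul_apply]
  ring

lemma rho2_2i (h : TodaData a₁ a₂) (n : ℕ) (t : ℝ) (i : Fin (D - 1)) : rho2 a₁ a₂ n t (.inl 1) (.inr i) =
    a₁ n t (.inl 1) (.inl 1) * a₁ n t (.inl 1) (.inr i) + bvar a₁ n t i -
      a₁ (n + 1) t (.inl 1) (.inl 1) * a₁ n t (.inl 1) (.inr i) := by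
  simp [rho2_apply, h.one_21, h.two_inr, Matrix.mul_apply, bvar]

lemma rho2_i1 (h : TodaData a₁ a₂) (n : ℕ) (t : ℝ) (i : Fin (D - 1)) : rho2 a₁ a₂ n t (.inr i) (.inl 0) = 0 := by
  simp [rho2_apply, h.one_21]

lemma rho2_i2 (a₁ a₂ : ℕ → ℝ → Mat D) (n : ℕ) (t : ℝ) (i : Fin (D - 1)) :
    rho2 a₁ a₂ n t (.inr i) (.inl 1) = a₂ (n + 1) t (.inr i) (.inl 1) -
      a₁ (n + 1) t (.inr i) (.inl 1) * a₁ n t (.inl 1) (.inl 1) := by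
  simp [rho2_apply]

lemma rho2_ij (a₁ a₂ : ℕ → ℝ → Mat D) (n : ℕ) (t : ℝ) (i j : Fin (D - 1)) :
    rho2 a₁ a₂ n t (.inr i) (.inr j) = (if i = j then 1 else 0) -
      a₁ (n + 1) t (.inr i) (.inl 1) * a₁ n t (.inl 1) (.inr j) := by
  simp [rho2_apply]

/-- The entry `(1,2)` of `rho1` is identically zero, so its compatibility equation is algebraic. -/
lemma two_mul_h (h : TodaData a₁ a₂) (n : ℕ) (t : ℝ) : ∑ k, a₁ (n + 1) t (.inl 0) (.inr k) *
    a₁ (n + 1) t (.inr k) (.inl 1) = 2 * a₂ (n + 1) t (.inl 0) (.inl 1) := by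
  have h1 := h.compat_one n t (.inl 0) (.inl 1)
  have e : (fun s => rho1 a₁ n s (.inl 0) (.inl 1)) = fun _ => 0 := by
    funext s; simp [rho1_apply, h.one_12]
  rw [e] at h1
  have h2 := h1.unique (hasDerivAt_const t 0)
  rw [Matrix.sub_apply, Matrix.add_apply, Matrix.sub_apply, sigma_mul_apply, mul_sigma_apply,
    Matrix.mul_apply, Matrix.mul_apply] at h2
  simp only [commutator_sigma_apply] at h2
  simp [rho1_apply, h.one_12, h.rho2_12] at h2
  linear_combination -h2

/-- The entry `(1,i)` of `rho2` is identically zero. Its equation eliminates the first row of `a₁`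
in favour of the second row at the previous `n`. -/
lemma one_1i (h : TodaData a₁ a₂) (n : ℕ) (t : ℝ) (i : Fin (D - 1)) : a₁ (n + 1) t (.inl 0) (.inr i) =
    a₂ (n + 1) t (.inl 0) (.inl 1) * a₁ n t (.inl 1) (.inr i) := by
  have h1 := h.compat_zero n t (.inl 0) (.inr i)
  have e : (fun s => rho2 a₁ a₂ n s (.inl 0) (.inr i)) = fun _ => 0 :=
    funext fun s => h.rho2_1i n s i
  rw [e] at h1
  have h2 := h1.unique (hasDerivAt_const t 0)
  rw [Matrix.sub_apply, Matrix.mul_apply, Matrix.mul_apply] at h2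
  simp only [commutator_sigma_apply] at h2
  simp [h.one_12, h.rho2_11, h.rho2_12, h.rho2_1i, rho2_ij, mul_sub,
    Finset.sum_add_distrib, ← mul_assoc, ← Finset.sum_mul, h.two_mul_h] at h2
  linear_combination -h2

lemma h_ne_zero (h : TodaData a₁ a₂) (n : ℕ) (t : ℝ) : a₂ (n + 1) t (.inl 0) (.inl 1) ≠ 0 :=
  left_ne_zero_of_mul (h.two_mul n t ▸ one_ne_zero)

/-- Insert `one_1i` into `two_mul_h` and cancel the nonzero factor. -/
lemma constraint (h : TodaData a₁ a₂) (n : ℕ) (t : ℝ) :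
    ∑ j, a₁ n t (.inl 1) (.inr j) * a₁ (n + 1) t (.inr j) (.inl 1) = 2 := by
  have h1 := h.two_mul_h n t
  simp only [h.one_1i n t, mul_assoc, ← Finset.mul_sum] at h1
  rw [mul_comm 2] at h1
  exact mul_left_cancel₀ (h.h_ne_zero n t) h1

/-- Counterpart of `two_mul_h` for the entry `(2,1)` of `rho1`, which also vanishes identically. -/
lemma sum_mul_i1 (h : TodaData a₁ a₂) (n : ℕ) (t : ℝ) : ∑ k, a₁ n t (.inl 1) (.inr k) * a₁ n t (.inr k) (.inl 0) =
    2 * rho2 a₁ a₂ n t (.inl 1) (.inl 0) := by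
  have h1 := h.compat_one n t (.inl 1) (.inl 0)
  have e : (fun s => rho1 a₁ n s (.inl 1) (.inl 0)) = fun _ => 0 := by
    funext s; simp [rho1_apply, h.one_21]
  rw [e] at h1
  have h2 := h1.unique (hasDerivAt_const t 0)
  rw [Matrix.sub_apply, Matrix.add_apply, Matrix.sub_apply, sigma_mul_apply, mul_sigma_apply,
    Matrix.mul_apply, Matrix.mul_apply] at h2
  simp only [commutator_sigma_apply] at h2
  simp [rho1_apply, h.one_21] at h2
  linear_combination h2

/-- By `rho2_21` and `sum_mul_i1` the entry equals `a₂ n` at `(2,1)`, so this is `two_mul`. -/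
lemma h_mul_rho2_21 (h : TodaData a₁ a₂) (n : ℕ) (t : ℝ) :
    a₂ (n + 1) t (.inl 0) (.inl 1) * rho2 a₁ a₂ n t (.inl 1) (.inl 0) = 1 := by
  have h1 := h.sum_mul_i1 n t
  have h2 := h.rho2_21 n t
  have h3 := h.two_mul n t
  linear_combination h3 + a₂ (n + 1) t (.inl 0) (.inl 1) * (-h2 - h1)

lemma rho2_21_eq (h : TodaData a₁ a₂) (n : ℕ) (t : ℝ) :
    rho2 a₁ a₂ n t (.inl 1) (.inl 0) = (a₂ (n + 1) t (.inl 0) (.inl 1))⁻¹ :=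
  eq_inv_of_mul_eq_one_right (h.h_mul_rho2_21 n t)

/-- The vanishing entry `(i,1)` of `rho2` eliminates the first column of `a₁` in favour of the
second column at the next `n`. -/
lemma one_i1 (h : TodaData a₁ a₂) (n : ℕ) (t : ℝ) (i : Fin (D - 1)) : a₁ n t (.inr i) (.inl 0) =
    rho2 a₁ a₂ n t (.inl 1) (.inl 0) * a₁ (n + 1) t (.inr i) (.inl 1) := by
  have h1 := h.compat_zero n t (.inr i) (.inl 0)
  have e : (fun s => rho2 a₁ a₂ n s (.inr i) (.inl 0)) = fun _ => 0 :=
    funext fun s => h.rho2_i1 n s i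
  rw [e] at h1
  have h2 := h1.unique (hasDerivAt_const t 0)
  rw [Matrix.sub_apply, Matrix.mul_apply, Matrix.mul_apply] at h2
  simp only [commutator_sigma_apply] at h2
  simp [h.one_21, h.rho2_11, h.rho2_i1, rho2_ij, sub_mul,
    Finset.sum_sub_distrib, mul_assoc, ← Finset.mul_sum, h.sum_mul_i1] at h2
  linear_combination -h2

lemma hasDerivAt_one_22 (h : TodaData a₁ a₂) (n : ℕ) (t : ℝ) : HasDerivAt (fun s => a₁ n s (.inl 1) (.inl 1))
    (∑ k : Fin (D - 1), a₁ n t (.inl 1) (.inr k) * a₁ n t (.inr k) (.inl 1)) t := by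
  refine (h.deriv_one n t (.inl 1) (.inl 1)).congr_deriv ?_
  rw [Matrix.add_apply, Matrix.sub_apply, sigma_mul_apply, mul_sigma_apply, Matrix.mul_apply]
  simp only [commutator_sigma_apply]
  simp [h.one_21]

lemma hasDerivAt_one_2i (h : TodaData a₁ a₂) (n : ℕ) (t : ℝ) (i : Fin (D - 1)) :
    HasDerivAt (fun s => a₁ n s (.inl 1) (.inr i)) (bvar a₁ n t i) t := by
  refine (h.deriv_one n t (.inl 1) (.inr i)).congr_deriv ?_
  rw [Matrix.add_apply, Matrix.sub_apply, sigma_mul_apply, mul_sigma_apply, Matrix.mul_apply]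
  simp only [commutator_sigma_apply]
  simp [h.one_21, h.two_inr, bvar]

lemma hasDerivAt_one_i2 (h : TodaData a₁ a₂) (n : ℕ) (t : ℝ) (i : Fin (D - 1)) :
    HasDerivAt (fun s => a₁ n s (.inr i) (.inl 1))
      (a₂ n t (.inr i) (.inl 1) - a₁ n t (.inr i) (.inl 1) * a₁ n t (.inl 1) (.inl 1)) t := by
  refine (h.deriv_one n t (.inr i) (.inl 1)).congr_deriv ?_
  rw [Matrix.add_apply, Matrix.sub_apply, sigma_mul_apply, mul_sigma_apply, Matrix.mul_apply]
  simp only [commutator_sigma_apply]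
  simp [h.one_12]
  ring

/-- The unknown `a₃` enters through a commutator with the diagonal matrix `σ`, which has zero
diagonal. -/
lemma hasDerivAt_two_22 (h : TodaData a₁ a₂) (n : ℕ) (t : ℝ) : HasDerivAt (fun s => a₂ n s (.inl 1) (.inl 1))
    (∑ k : Fin (D - 1), a₁ n t (.inl 1) (.inr k) * a₂ n t (.inr k) (.inl 1)) t := by
  obtain ⟨a₃, h3⟩ := h.deriv_two n t
  refine (h3 (.inl 1) (.inl 1)).congr_deriv ?_
  rw [Matrix.add_apply, Matrix.sub_apply, sigma_mul_apply, mul_sigma_apply, Matrix.mul_apply]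
  simp only [commutator_sigma_apply]
  simp [h.one_21]

lemma hasDerivAt_two_12 (h : TodaData a₁ a₂) (n : ℕ) (t : ℝ) :
    HasDerivAt (fun s => a₂ (n + 1) s (.inl 0) (.inl 1))
      (a₂ (n + 1) t (.inl 0) (.inl 1) * (2 * a₁ n t (.inl 1) (.inl 1) -
        ∑ j : Fin (D - 1), a₁ n t (.inl 1) (.inr j) * a₂ (n + 1) t (.inr j) (.inl 1))) t := by
  have h1 := h.compat_zero n t (.inl 0) (.inl 1)
  have e : (fun s => rho2 a₁ a₂ n s (.inl 0) (.inl 1)) =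
      fun s => a₂ (n + 1) s (.inl 0) (.inl 1) := funext fun s => h.rho2_12 n s
  rw [e] at h1
  refine h1.congr_deriv ?_
  rw [Matrix.sub_apply, Matrix.mul_apply, Matrix.mul_apply]
  simp only [commutator_sigma_apply]
  simp [h.one_12, h.rho2_1i, rho2_i2, mul_sub,
    Finset.sum_add_distrib, ← mul_assoc, ← Finset.sum_mul, h.two_mul_h]
  simp only [h.one_1i n t, mul_assoc, ← Finset.mul_sum]
  ring

/-- The entry `(i,2)` of `rho2` is this coefficient minus a product with known derivative, which is
added back. The quotient with index `n + 2` comes from eliminating the first column by `one_i1`. -/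
lemma hasDerivAt_two_i2 (h : TodaData a₁ a₂) (n : ℕ) (t : ℝ) (i : Fin (D - 1)) :
    HasDerivAt (fun s => a₂ (n + 1) s (.inr i) (.inl 1))
      (a₂ (n + 1) t (.inr i) (.inl 1) * a₁ n t (.inl 1) (.inl 1)
        + a₁ (n + 1) t (.inr i) (.inl 1) * a₂ n t (.inl 1) (.inl 1)
        + a₁ n t (.inr i) (.inl 1)
        - a₁ (n + 1) t (.inr i) (.inl 1) * a₂ (n + 1) t (.inl 1) (.inl 1)
        + a₁ (n + 2) t (.inr i) (.inl 1)
          * (a₂ (n + 1) t (.inl 0) (.inl 1) / a₂ (n + 2) t (.inl 0) (.inl 1))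
        - a₁ (n + 1) t (.inr i) (.inl 1) * a₁ n t (.inl 1) (.inl 1) ^ 2
        - a₁ (n + 1) t (.inr i) (.inl 1)
          * ∑ k : Fin (D - 1), a₁ n t (.inl 1) (.inr k) * a₁ n t (.inr k) (.inl 1)) t := by
  have h1 := (h.compat_zero n t (.inr i) (.inl 1)).add
    ((h.hasDerivAt_one_i2 (n + 1) t i).mul (h.hasDerivAt_one_22 n t))
  have e : (fun s => rho2 a₁ a₂ n s (.inr i) (.inl 1)) + (fun s => a₁ (n + 1) s (.inr i) (.inl 1)) *
      (fun s => a₁ n s (.inl 1) (.inl 1)) = fun s => a₂ (n + 1) s (.inr i) (.inl 1) := by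
    funext s
    simp only [Pi.add_apply, Pi.mul_apply, rho2_i2]
    ring
  rw [e] at h1
  refine h1.congr_deriv ?_
  rw [Matrix.sub_apply, Matrix.mul_apply, Matrix.mul_apply]
  simp only [commutator_sigma_apply]
  simp [h.one_12, h.rho2_12, h.rho2_22, rho2_ij, sub_mul,
    Finset.sum_sub_distrib, mul_assoc, ← Finset.mul_sum, h.one_i1 (n + 1), h.rho2_21_eq (n + 1)]
  ring

/-- The entry `(2,i)` of `rho2` is `bvar` up to products with known derivatives. The index is `n +
1` because `one_1i` expresses the first row there by data at `n`; this is why the equation starts at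
`n = 1`. -/
lemma hasDerivAt_bvar (h : TodaData a₁ a₂) (n : ℕ) (t : ℝ) (i : Fin (D - 1)) :
    HasDerivAt (fun s => bvar a₁ (n + 1) s i)
      (a₂ (n + 1) t (.inl 0) (.inl 1) / a₂ (n + 2) t (.inl 0) (.inl 1)
          * a₁ n t (.inl 1) (.inr i)
        + a₁ (n + 2) t (.inl 1) (.inl 1) * a₁ (n + 1) t (.inl 1) (.inl 1)
          * a₁ (n + 1) t (.inl 1) (.inr i)
        + a₁ (n + 2) t (.inl 1) (.inr i)
        - a₂ (n + 2) t (.inl 1) (.inl 1) * a₁ (n + 1) t (.inl 1) (.inr i)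
        + a₂ (n + 1) t (.inl 1) (.inl 1) * a₁ (n + 1) t (.inl 1) (.inr i)
        - a₁ (n + 1) t (.inl 1) (.inr i) * a₁ (n + 1) t (.inl 1) (.inl 1) ^ 2
        - a₁ (n + 1) t (.inl 1) (.inl 1) * bvar a₁ (n + 1) t i
        - 2 * a₁ (n + 1) t (.inl 1) (.inr i)
          * ∑ k : Fin (D - 1), a₁ (n + 1) t (.inl 1) (.inr k) * a₁ (n + 1) t (.inr k) (.inl 1)
        + a₁ (n + 2) t (.inl 1) (.inl 1) * bvar a₁ (n + 1) t i) t := by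
  have h1 := ((h.compat_zero (n + 1) t (.inl 1) (.inr i)).sub
    ((h.hasDerivAt_one_22 (n + 1) t).mul (h.hasDerivAt_one_2i (n + 1) t i))).add
    ((h.hasDerivAt_one_22 (n + 2) t).mul (h.hasDerivAt_one_2i (n + 1) t i))
  have e : ((fun s => rho2 a₁ a₂ (n + 1) s (.inl 1) (.inr i)) -
      (fun s => a₁ (n + 1) s (.inl 1) (.inl 1)) * fun s => a₁ (n + 1) s (.inl 1) (.inr i)) +
      (fun s => a₁ (n + 2) s (.inl 1) (.inl 1)) * (fun s => a₁ (n + 1) s (.inl 1) (.inr i)) =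
      fun s => bvar a₁ (n + 1) s i := by
    funext s
    simp only [Pi.add_apply, Pi.mul_apply, Pi.sub_apply, h.rho2_2i]
    ring
  rw [e] at h1
  refine h1.congr_deriv ?_
  rw [Matrix.sub_apply, Matrix.mul_apply, Matrix.mul_apply]
  simp only [commutator_sigma_apply]
  simp [h.one_21, h.rho2_22, h.rho2_2i, rho2_ij, mul_sub,
    Finset.sum_sub_distrib, ← mul_assoc, ← Finset.sum_mul, h.one_1i n, h.rho2_21_eq (n + 1)]
  ring

theorem isTodaSystem (h : TodaData a₁ a₂) : IsTodaSystem a₁ a₂ where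
  d_a1_22 := h.hasDerivAt_one_22
  d_a1_2i := h.hasDerivAt_one_2i
  d_a1_i2 := h.hasDerivAt_one_i2
  d_a2_22 := h.hasDerivAt_two_22
  a2_12_ne_zero := h.h_ne_zero
  d_a2_12 := h.hasDerivAt_two_12
  d_a2_i2 := h.hasDerivAt_two_i2
  d_b n t i hn := by
    obtain ⟨m, rfl⟩ : ∃ m, n = m + 1 := ⟨n - 1, by omega⟩
    exact h.hasDerivAt_bvar m t i
  constraint := h.constraint
  init_a1_22 t := h.one_zero t _
  init_a1_i2 t _ := h.one_zero t _
  init_a2_22 t := h.two_zero t _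
  init_a2_12 t := h.two_zero t _
  init_a2_i2 t _ := h.two_zero t _

end TodaData

lemma todaData_coeffA {D : ℕ} (hD : 2 ≤ D) {V₀ : ℝ[X]} (S : ∀ n, SolFamily D V₀ n) :
    TodaData (coeffA S 1) (coeffA S 2) where
  deriv_one := matDeriv_coeffA_one S hD
  deriv_two := matDeriv_coeffA_two S hD
  compat := matDeriv_rho S hD
  one_12 := coeffA_one_12 S
  one_21 := coeffA_one_21 S
  two_inr := coeffA_two_inr S hD
  two_mul := coeffA_two_mul S hD
  one_zero := coeffA_one_zero S
  two_zero := coeffA_two_zero S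

/-! ### Transfer to arbitrary solutions, and the theorem -/

lemma hat_congr {D : ℕ} {A B : ℂ → Mat D} {z : ℂ} (h : A z = B z) : hat A z = hat B z := by
  rw [hat, hat, h]

lemma breve_congr {D : ℕ} (V : ℝ[X]) {A B : ℂ → Mat D} {z : ℂ} (h : A z = B z) :
    breve V A z = breve V B z := by
  rw [breve, breve, hat_congr h]

lemma HasExpansion.congr {D n : ℕ} {F G : ℂ → Mat D} {a₁ a₂ : Mat D}
    (h : HasExpansion D n F a₁ a₂) (he : Set.EqOn F G (gamma D)ᶜ) : HasExpansion D n G a₁ a₂ :=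
  fun i j => (h i j).congr' ((eventually_ne_zero D).mono fun z hz => by simp only [he hz.2])
    EventuallyEq.rfl

lemma IsLaxPair.congr {D : ℕ} {a₁ a₂ : ℕ → ℝ → Mat D} {F G : ℕ → ℝ → ℂ → Mat D}
    (h : IsLaxPair a₁ a₂ F) (he : ∀ n t, Set.EqOn (F n t) (G n t) (gamma D)ᶜ) :
    IsLaxPair a₁ a₂ G where
  shift n t z hz := by rw [← he _ _ hz, ← he _ _ hz, h.shift n t z hz]
  flow n t z hz i j := by
    have h1 := h.flow n t z hz i j
    rw [he n t hz] at h1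
    have h2 : (fun s => F n s z i j) = fun s => G n s z i j := funext fun s => by rw [he n s hz]
    rwa [h2] at h1
  compat := h.compat

end SkewToda

end

theorem mainTheorem2 (D : ℕ) (hD : Even D) (hD0 : 2 ≤ D) (V₀ : Polynomial ℝ)
    (hdeg : V₀.natDegree = D) (hlead : 0 < V₀.leadingCoeff) :
    -- for all `n` and `t` the even problem has a solution, unique off the contour
    (∀ (n : ℕ) (t : ℝ), ∃ A : ℂ → SkewToda.Mat D,
      SkewToda.IsEvenSolution D (SkewToda.deform V₀ t) n A ∧
      ∀ B : ℂ → SkewToda.Mat D, SkewToda.IsEvenSolution D (SkewToda.deform V₀ t) n B →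
        Set.EqOn B A (SkewToda.gamma D)ᶜ) ∧
    -- for the solutions `A n t`
    ∀ A : ℕ → ℝ → ℂ → SkewToda.Mat D,
      (∀ n t, SkewToda.IsEvenSolution D (SkewToda.deform V₀ t) n (A n t)) →
      (∀ n t, SkewToda.HasJump D (SkewToda.breve (SkewToda.deform V₀ t) (A n t))
        (SkewToda.constJump D)) ∧
      ∃ a₁ a₂ : ℕ → ℝ → SkewToda.Mat D,
        (∀ n t, SkewToda.HasExpansion D n (SkewToda.hat (A n t)) (a₁ n t) (a₂ n t)) ∧
        SkewToda.IsLaxPair a₁ a₂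
          (fun n t z => SkewToda.breve (SkewToda.deform V₀ t) (A n t) z) ∧
        SkewToda.IsTodaSystem a₁ a₂ := by
  have S : ∀ n, SkewToda.SolFamily D V₀ n := fun n =>
    (SkewToda.nonempty_solFamily hD0 hD ⟨hdeg, hlead⟩ n).some
  refine ⟨fun n t => ⟨(S n).A t, (S n).isEvenSolution hD0 t,
    fun B hB => ((S n).isEvenSolution hD0 t).eqOn hD0 hB⟩, fun A hA => ?_⟩
  -- By uniqueness, arbitrary solutions agree off `Γ` with the constructed family. The coefficients
  -- of that family serve for them, and the expansion and the Lax pair transfer because they involve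
  -- values off `Γ` only.
  have he : ∀ n t, Set.EqOn ((S n).A t) (A n t) (SkewToda.gamma D)ᶜ := fun n t =>
    (hA n t).eqOn hD0 ((S n).isEvenSolution hD0 t)
  exact ⟨fun n t => (hA n t).hasJump_breve hD0, SkewToda.coeffA S 1, SkewToda.coeffA S 2,
    fun n t => (SkewToda.hasExpansion_hat S hD0 n t).congr fun z hz =>
      SkewToda.hat_congr (he n t hz),
    (SkewToda.isLaxPair_coeffA S hD0).congr fun n t z hz => SkewToda.breve_congr _ (he n t hz),
    (SkewToda.todaData_coeffA hD0 S).isTodaSystem⟩
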